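/- **Notation.** Let $n\ge 1$, $d\in\mathbb R$, and write $x=(x',x_n)$, $\xi=(\xi',\xi_n)\in\mathbb R^{n-1}\times\mathbb R$, $\langle\xi\rangle=(1+|\xi|^2)^{1/2}$, $\langle\xi'\rangle=(1+|\xi'|^2)^{1/2}$, $D^\alpha=(-i)^{|\alpha|}\partial^\alpha$. For $k\ge0$ and $r\in\mathbb R$, $S^r_{1,0}(\mathbb R^k\times\mathbb R^k)$ is the set of $q\in C^\infty(\mathbb R^{k}\times\mathbb R^k;\mathbb C)$ such that $\sup_{x,\xi\in\mathbb R^k}\langle\xi\rangle^{-(r-|\alpha|)}|D_x^\beta D_\xi^\alpha q(x,\xi)|<\infty$ for all multi-indices $\alpha,\beta\in\mathbb N_0^k$. $\mathcal F^{-1}_{\xi_n\to z_n}$ is the inverse Fourier transformation of tempered distributions on $\mathbb R$ (with $\mathcal F^{-1}f(z)=(2\pi)^{-1}\int e^{iz\xi_n}f(\xi_n)\,d\xi_n$ for integrable $f$), applied in the variable $\xi_n$ for fixed $(x',\xi')$; for $p\in S^d_{1,0}(\mathbb R^n\times\mathbb R^n)$ the distributions $\mathcal F^{-1}_{\xi_n\to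 z_n}D_\xi^\alpha D_x^\beta p(x',0,\xi)$ are $C^\infty$ functions of $z_n$ on $\mathbb R\setminus\{0\}$, and below only their values for $z_n\neq0$ are used. **Proposition.** Let $p\in S^d_{1,0}(\mathbb R^n\times\mathbb R^n)$. The following conditions are equivalent: (i) $p$ satisfies the uniform two-sided transmission condition at $x_n=0$ (that is, $p\in S^d_{1,0,\mathrm{uttr}}(\mathbb R^n\times\mathbb R^n)$): for all $\alpha,\beta\in\mathbb N_0^n$, $l,m\in\mathbb N_0$ and each $\xi'\in\mathbb R^{n-1}$, $$\sup_{x'\in\mathbb R^{n-1},\,z_n\ne0}\bigl|z_n^lD_{z_n}^m\mathcal F^{-1}_{\xi_n\to z_n}D_\xi^\alpha D_x^\beta p(x',0,\xi)\bigr|<\infty.$$ (ii) For all $\alpha,\beta\in\mathbb N_0^n$ there exist $s_{j,\alpha,\beta}(x',\xi')\in S^{d-j-|\alpha|}_{1,0}(\mathbb R^{n-1}\times\mathbb R^{n-1})$, for $j\in\mathbb Z$ with $j\le d-|\alpha|$, such that for every $m\in\mathbb N_0$ $$\Bigl|\xi_n^mD_\xi^\alpha D_x^\beta p(x',0,\xi)-\sum_{-m\le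 j\le d-|\alpha|}s_{j,\alpha,\beta}(x',\xi')\,\xi_n^{j+m}\Bigr|\le C\langle\xi'\rangle^{d+1-|\alpha|+m}\langle\xi\rangle^{-1}$$ with a constant $C$ independent of $(x',\xi)\in\mathbb R^{n-1}\times\mathbb R^n$. (iii) For all $\alpha,\beta\in\mathbb N_0^n$ and $l,m\in\mathbb N_0$, $$\sup_{x',\xi'\in\mathbb R^{n-1},\,z_n\neq0}\langle\xi'\rangle^{-(d+1-|\alpha|-l+m)}\bigl|z_n^lD_{z_n}^m\mathcal F^{-1}_{\xi_n\to z_n}D_\xi^\alpha D_x^\beta p(x',0,\xi)\bigr|<\infty.$$ In the affirmative case, the symbols $s_{j,\alpha,\beta}$ in (ii) are uniquely determined, and they are polynomials in $\xi'\in\mathbb R^{n-1}$ of degree $\le d-j-|\alpha|$ (for each fixed $x'$). -/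

import Mathlib

open scoped ContDiff

noncomputable section

/-- Euclidean space `ℝⁿ` with its Euclidean norm. -/
abbrev Euc (n : ℕ) : Type := EuclideanSpace ℝ (Fin n)

/-- The Japanese bracket `⟨ξ⟩ = (1 + |ξ|²)^{1/2}`. -/
def japBracket {n : ℕ} (ξ : Euc n) : ℝ := Real.sqrt (1 + ‖ξ‖ ^ 2)

/-- The point `(x', t) ∈ ℝ^{k+1}` with `x' ∈ ℝᵏ` and last coordinate `t`. -/
def joinLast {k : ℕ} (x' : Euc k) (t : ℝ) : Euc (k + 1) :=
  WithLp.toLp 2 (Fin.snoc (α := fun _ => ℝ) (fun i => x' i) t)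

/-- The length `|α| = α₁ + ⋯ + αₙ` of a multi-index. -/
def multiLength {n : ℕ} (α : Fin n → ℕ) : ℕ := ∑ i, α i

/-- The directional derivative `∂_v f` of a (differentiable) function. -/
def dirDeriv {V : Type*} [NormedAddCommGroup V] [NormedSpace ℝ V] (v : V) (f : V → ℂ) : V → ℂ :=
  fun y => fderiv ℝ f y v

/-- `D^α f = (-i)^{|α|} ∂_{e₁}^{α₁} ⋯ ∂_{eₙ}^{αₙ} f` for the directions `e₁, …, eₙ`. -/
def multiD {V : Type*} [NormedAddCommGroup V] [NormedSpace ℝ V] {n : ℕ}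
    (e : Fin n → V) (α : Fin n → ℕ) (f : V → ℂ) : V → ℂ :=
  fun y => (-Complex.I) ^ multiLength α *
    (List.finRange n).foldr (fun i g => (dirDeriv (e i))^[α i] g) f y

/-- `D_x^β p`, for a function `p(x, ξ)` on `ℝⁿ × ℝⁿ`. -/
def Dx {n : ℕ} (β : Fin n → ℕ) (p : Euc n × Euc n → ℂ) : Euc n × Euc n → ℂ :=
  multiD (fun i => (EuclideanSpace.single i (1 : ℝ), (0 : Euc n))) β p

/-- `D_ξ^α p`, for a function `p(x, ξ)` on `ℝⁿ × ℝⁿ`. -/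
def Dxi {n : ℕ} (α : Fin n → ℕ) (p : Euc n × Euc n → ℂ) : Euc n × Euc n → ℂ :=
  multiD (fun i => ((0 : Euc n), EuclideanSpace.single i (1 : ℝ))) α p

/-- The uniform Hörmander class `S^d_{1,0}(ℝⁿ × ℝⁿ)`. -/
def IsSymbol {n : ℕ} (d : ℝ) (p : Euc n × Euc n → ℂ) : Prop :=
  ContDiff ℝ ∞ p ∧
    ∀ α β : Fin n → ℕ, ∃ C : ℝ, ∀ x ξ : Euc n,
      japBracket ξ ^ (-(d - multiLength α)) * ‖Dx β (Dxi α p) (x, ξ)‖ ≤ C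

/-- The inverse Fourier transform on `ℝ`, `(ℱ⁻¹ φ)(ξ) = (2π)⁻¹ ∫ e^{izξ} φ(z) dz`. -/
def invFourierLine (φ : ℝ → ℂ) (ξ : ℝ) : ℂ :=
  ((2 * Real.pi : ℝ) : ℂ)⁻¹ * ∫ z : ℝ, Complex.exp (Complex.I * z * ξ) * φ z

/-- For `f : ℝ → ℂ` continuous of polynomial growth: the restriction to `ℝ ∖ {0}` of the tempered
distribution `ℱ⁻¹ f` is the function `K`, smooth on `ℝ ∖ {0}`. That is,
`⟨ℱ⁻¹ f, φ⟩ = ⟨f, ℱ⁻¹ φ⟩ = ⟨K, φ⟩` for all test functions `φ ∈ C₀^∞(ℝ ∖ {0})`. The values of `K`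
on `ℝ ∖ {0}` are determined by `f`. -/
def IsInvFourierOffZero (f K : ℝ → ℂ) : Prop :=
  ContDiffOn ℝ ∞ K {0}ᶜ ∧
    ∀ φ : ℝ → ℂ, ContDiff ℝ ∞ φ → HasCompactSupport φ → tsupport φ ⊆ {0}ᶜ →
      ∫ ξ : ℝ, f ξ * invFourierLine φ ξ = ∫ z : ℝ, K z * φ z

/-- `z^l D_z^m K(z)` with `D_z = -i d/dz`. -/
def weightedD (l m : ℕ) (K : ℝ → ℂ) (z : ℝ) : ℂ :=
  (z : ℂ) ^ l * ((-Complex.I) ^ m * iteratedDeriv m K z)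

/-- The function `ξₙ ↦ D_ξ^α D_x^β p(x', 0, ξ', ξₙ)` on `ℝ`. -/
def normalSlice {k : ℕ} (p : Euc (k + 1) × Euc (k + 1) → ℂ) (α β : Fin (k + 1) → ℕ)
    (x' ξ' : Euc k) : ℝ → ℂ :=
  fun ξn => Dxi α (Dx β p) (joinLast x' 0, joinLast ξ' ξn)

/-- The class `S^d_{1,0,uttr}` of symbols in `S^d_{1,0}(ℝ^{k+1} × ℝ^{k+1})` satisfying the uniform
two-sided transmission condition at `xₙ = 0`: for each `ξ'` the functions
`zₙ^l D_{zₙ}^m ℱ⁻¹_{ξₙ → zₙ} D_ξ^α D_x^β p(x', 0, ξ)` are bounded in `x'` and `zₙ ≠ 0`. -/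
def IsSymbolUTTR {k : ℕ} (d : ℝ) (p : Euc (k + 1) × Euc (k + 1) → ℂ) : Prop :=
  IsSymbol d p ∧
    ∀ (α β : Fin (k + 1) → ℕ) (l m : ℕ) (ξ' : Euc k), ∃ C : ℝ, ∀ x' : Euc k,
      ∃ K : ℝ → ℂ, IsInvFourierOffZero (normalSlice p α β x' ξ') K ∧
        ∀ z : ℝ, z ≠ 0 → ‖weightedD l m K z‖ ≤ C

/-- The weighted bounds on `zₙ^l D_{zₙ}^m ℱ⁻¹_{ξₙ → zₙ} D_ξ^α D_x^β p(x', 0, ξ)`, uniform in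
`x'`, `ξ'` and `zₙ ≠ 0`. -/
def HasWeightedKernelBounds {k : ℕ} (d : ℝ) (p : Euc (k + 1) × Euc (k + 1) → ℂ) : Prop :=
  ∀ (α β : Fin (k + 1) → ℕ) (l m : ℕ), ∃ C : ℝ, ∀ x' ξ' : Euc k,
    ∃ K : ℝ → ℂ, IsInvFourierOffZero (normalSlice p α β x' ξ') K ∧
      ∀ z : ℝ, z ≠ 0 →
        japBracket ξ' ^ (-(d + 1 - multiLength α - l + m)) * ‖weightedD l m K z‖ ≤ C

/-- `(s_j)`, of which only the members with `j ≤ d - |α|` matter, is a family of symbols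
`s_j(x', ξ') ∈ S^{d-j-|α|}_{1,0}(ℝᵏ × ℝᵏ)` giving, for every `m`, the expansion of
`ξₙ^m D_ξ^α D_x^β p(x', 0, ξ)` in powers of `ξₙ` with the uniform remainder estimate. -/
def IsNormalExpansion {k : ℕ} (d : ℝ) (p : Euc (k + 1) × Euc (k + 1) → ℂ)
    (α β : Fin (k + 1) → ℕ) (s : ℤ → Euc k × Euc k → ℂ) : Prop :=
  (∀ j : ℤ, (j : ℝ) ≤ d - multiLength α → IsSymbol (d - j - multiLength α) (s j)) ∧
    ∀ m : ℕ, ∃ C : ℝ, ∀ (x' ξ' : Euc k) (ξn : ℝ),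
      ‖(ξn : ℂ) ^ m * normalSlice p α β x' ξ' ξn
          - ∑ j ∈ Finset.Icc (-(m : ℤ)) ⌊d - multiLength α⌋, s j (x', ξ') * (ξn : ℂ) ^ (j + m)‖
        ≤ C * japBracket ξ' ^ (d + 1 - multiLength α + m) * (japBracket (joinLast ξ' ξn))⁻¹

/-- `g` is a polynomial function on `ℝᵏ` of (total) degree at most the real number `r`. -/
def IsPolynomialOfDegreeLE {k : ℕ} (r : ℝ) (g : Euc k → ℂ) : Prop :=
  ∃ P : MvPolynomial (Fin k) ℂ, (P.totalDegree : ℝ) ≤ r ∧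
    ∀ ξ : Euc k, g ξ = MvPolynomial.eval (fun i => (ξ i : ℂ)) P

end

/-! Fix `(x', ξ')` and consider the kernel `K`, off zero, of a slice `ξₙ ↦ D_ξ^α D_x^β p(x', 0, ξ',
ξₙ)`. Polynomials in `ξₙ` have kernels supported at zero, hence invisible off zero, while a term
`ξₙ^(-i-1)` of an asymptotic expansion corresponds to a jump at zero of the `i`-th derivative of
`K`. Thus an expansion in integer powers of `ξₙ` and a rapidly decreasing kernel that is smooth up
to zero from both sides are two sides of one fact. The work lies in the uniformity in `ξ'` and in
the symbol property of the coefficients.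

(i) ⇒ (ii). Only the frequency `ξ' = 0` is used. A slice `f` and the Fourier transform of its kernel
have the same derivative of high order, so they differ by a polynomial; repeated integration by
parts across zero expands the transform in negative powers with the jumps as coefficients; the order
of `f` then removes the powers that are too high (`exists_line_expansion`). For general `ξ'`, the
slice is expanded by Taylor's formula in `ξ'` about `0`, and each Taylor coefficient, a slice at `ξ'
= 0` of a higher derivative of `p`, is replaced by its expansion. Collecting the power `ξₙ^j` gives
`expansionCoeff`, a polynomial in `ξ'` because an extra `ξ'`-derivative lowers the order by one. For
`|ξₙ| ≥ ⟨ξ'⟩` the Taylor remainder is small enough, and for `|ξₙ| ≤ ⟨ξ'⟩` all terms are trivially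
bounded (`norm_remainder_le`). The coefficients at `ξ' = 0` are known only to be bounded in `x'`;
regularity is recovered from the expansion itself, since each coefficient is a locally uniform limit
of the slice minus its higher terms, divided by `ξₙ^j`, and the same holds for the derivatives with
shifted multi-indices (`hasFDerivAt_coeff`, `isSymbol_of_family`).

(ii) ⇒ (iii). After subtraction of the polynomial part, `ξₙ^m` times the slice is only `O(⟨ξ⟩⁻¹)`,
which is not integrable. Its leading term is therefore removed as a multiple of `(ξₙ - i⟨ξ'⟩)⁻¹`,
whose kernel is an explicit bounded exponential, and the rest is dominated by a Poisson kernel of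
total mass independent of `ξ'` (`norm_iteratedDeriv_kernel_le`). Factors `z` are traded for
`ξₙ`-derivatives (`norm_weighted_kernel_le`).

(iii) ⇒ (i) holds by fixing `ξ'`. Uniqueness holds because a Laurent polynomial with powers `≥ -m`
cannot be `O(ξₙ^(-m-1))` unless it vanishes; so every expansion has the polynomial coefficients
constructed above. -/

noncomputable section

/-! ### Calculus of the iterated derivatives `D^α`. -/

section MultiIndex

variable {V : Type*} [NormedAddCommGroup V] [NormedSpace ℝ V]

lemma ContDiff.dirDeriv {f : V → ℂ} (hf : ContDiff ℝ ∞ f) (v : V) :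
    ContDiff ℝ ∞ (dirDeriv v f) := by
  have h : ContDiff ℝ ∞ (fderiv ℝ f) := hf.fderiv_right (by simp)
  exact h.clm_apply contDiff_const

lemma dirDeriv_comm {f : V → ℂ} (hf : ContDiff ℝ ∞ f) (v w : V) :
    dirDeriv v (dirDeriv w f) = dirDeriv w (dirDeriv v f) := by
  have h : ContDiff ℝ ∞ (fderiv ℝ f) := hf.fderiv_right (by simp)
  have hd : Differentiable ℝ (fderiv ℝ f) := h.differentiable (by simp)
  have key : ∀ (a b : V) (y : V), dirDeriv a (dirDeriv b f) y = fderiv ℝ (fderiv ℝ f) y a b := by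
    intro a b y
    have := ((hd y).hasFDerivAt.clm_apply (hasFDerivAt_const b y)).fderiv
    change fderiv ℝ (fun y => fderiv ℝ f y b) y a = _
    rw [this]
    simp
  funext y
  rw [key, key]
  have hs : IsSymmSndFDerivAt ℝ f y :=
    (hf.contDiffAt).isSymmSndFDerivAt (by simp only [minSmoothness_of_isRCLikeNormedField]; exact WithTop.coe_le_coe.2 le_top)
  exact hs v w

lemma dirDeriv_const_mul {f : V → ℂ} (v : V) (c : ℂ) :
    dirDeriv v (fun y => c * f y) = fun y => c * dirDeriv v f y := by
  funext y
  simp only [dirDeriv]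
  have : (fun y => c * f y) = c • f := by funext; simp
  rw [this, fderiv_const_smul_field]
  simp

/-- The iterated partial derivative `∂^α` taken over the directions listed in `l`. -/
def iterDirDeriv {n : ℕ} (e : Fin n → V) (α : Fin n → ℕ) (l : List (Fin n)) (f : V → ℂ) : V → ℂ :=
  l.foldr (fun i g => (dirDeriv (e i))^[α i] g) f

lemma multiD_eq {n : ℕ} (e : Fin n → V) (α : Fin n → ℕ) (f : V → ℂ) :
    multiD e α f = fun y => (-Complex.I) ^ multiLength α *
      iterDirDeriv e α (List.finRange n) f y := rfl

lemma iterDirDeriv_cons {n : ℕ} (e : Fin n → V) (α : Fin n → ℕ) (i : Fin n) (l : List (Fin n))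
    (f : V → ℂ) : iterDirDeriv e α (i :: l) f = (dirDeriv (e i))^[α i] (iterDirDeriv e α l f) := rfl

lemma ContDiff.iterate_dirDeriv {f : V → ℂ} (hf : ContDiff ℝ ∞ f) (v : V) (r : ℕ) :
    ContDiff ℝ ∞ ((_root_.dirDeriv v)^[r] f) := by
  induction r generalizing f with
  | zero => exact hf
  | succ r ih => exact ih (hf.dirDeriv v)

lemma dirDeriv_iterate_comm {f : V → ℂ} (hf : ContDiff ℝ ∞ f) (v w : V) (r : ℕ) :
    dirDeriv v ((dirDeriv w)^[r] f) = (dirDeriv w)^[r] (dirDeriv v f) := by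
  induction r generalizing f with
  | zero => rfl
  | succ r ih =>
    simp only [Function.iterate_succ, Function.comp]
    rw [ih (hf.dirDeriv w), dirDeriv_comm hf]

lemma iterate_dirDeriv_const_mul {f : V → ℂ} (v : V) (c : ℂ) (r : ℕ) :
    (dirDeriv v)^[r] (fun y => c * f y) = fun y => c * (dirDeriv v)^[r] f y := by
  induction r generalizing f with
  | zero => rfl
  | succ r ih => simp only [Function.iterate_succ, Function.comp, dirDeriv_const_mul, ih]

lemma ContDiff.iterDirDeriv {n : ℕ} (e : Fin n → V) (α : Fin n → ℕ) (l : List (Fin n))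
    {f : V → ℂ} (hf : ContDiff ℝ ∞ f) : ContDiff ℝ ∞ (iterDirDeriv e α l f) := by
  induction l with
  | nil => exact hf
  | cons i l ih => exact ih.iterate_dirDeriv _ _

lemma dirDeriv_iterDirDeriv_comm {n : ℕ} (e : Fin n → V) (α : Fin n → ℕ) (l : List (Fin n))
    {f : V → ℂ} (hf : ContDiff ℝ ∞ f) (v : V) :
    dirDeriv v (iterDirDeriv e α l f) = iterDirDeriv e α l (dirDeriv v f) := by
  induction l with
  | nil => rfl
  | cons i l ih =>
    rw [iterDirDeriv_cons, iterDirDeriv_cons, dirDeriv_iterate_comm (hf.iterDirDeriv e α l), ih]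

lemma iterDirDeriv_const_mul {n : ℕ} (e : Fin n → V) (α : Fin n → ℕ) (l : List (Fin n))
    {f : V → ℂ} (c : ℂ) :
    iterDirDeriv e α l (fun y => c * f y) = fun y => c * iterDirDeriv e α l f y := by
  induction l with
  | nil => rfl
  | cons i l ih => rw [iterDirDeriv_cons, iterDirDeriv_cons, ih, iterate_dirDeriv_const_mul]

lemma iterDirDeriv_add_single_of_notMem {n : ℕ} (e : Fin n → V) (α : Fin n → ℕ)
    {l : List (Fin n)} (f : V → ℂ) {i : Fin n} (hi : i ∉ l) :
    iterDirDeriv e (α + Pi.single i 1) l f = iterDirDeriv e α l f := by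
  induction l with
  | nil => rfl
  | cons j l ih =>
    rw [List.mem_cons, not_or] at hi
    rw [iterDirDeriv_cons, iterDirDeriv_cons, ih hi.2]
    simp [Ne.symm hi.1]

/-- Since `l` has no repetitions, only one factor of the composition changes; the additional
derivative commutes past the factors to the left of it. -/
lemma iterDirDeriv_add_single {n : ℕ} (e : Fin n → V) (α : Fin n → ℕ)
    {l : List (Fin n)} (hl : l.Nodup) {f : V → ℂ} (hf : ContDiff ℝ ∞ f) {i : Fin n} (hi : i ∈ l) :
    iterDirDeriv e (α + Pi.single i 1) l f = dirDeriv (e i) (iterDirDeriv e α l f) := by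
  induction l with
  | nil => simp at hi
  | cons j l ih =>
    rw [List.nodup_cons] at hl
    rw [iterDirDeriv_cons, iterDirDeriv_cons, dirDeriv_iterate_comm (hf.iterDirDeriv e α l)]
    by_cases hij : i = j
    · subst hij
      rw [iterDirDeriv_add_single_of_notMem e α f hl.1]
      simp
    · have hi' : i ∈ l := by simpa [hij] using hi
      rw [ih hl.2 hi']
      simp [Ne.symm hij]

lemma multiLength_add {n : ℕ} (α β : Fin n → ℕ) :
    multiLength (α + β) = multiLength α + multiLength β := by
  simp [multiLength, Finset.sum_add_distrib]

@[simp] lemma multiLength_single {n : ℕ} (i : Fin n) (r : ℕ) :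
    multiLength (Pi.single i r : Fin n → ℕ) = r := by
  simp [multiLength]

@[simp] lemma multiLength_zero {n : ℕ} : multiLength (0 : Fin n → ℕ) = 0 := by
  simp [multiLength]

lemma ContDiff.multiD {n : ℕ} (e : Fin n → V) (α : Fin n → ℕ)
    {f : V → ℂ} (hf : ContDiff ℝ ∞ f) : ContDiff ℝ ∞ (multiD e α f) :=
  contDiff_const.mul (hf.iterDirDeriv e α _)

lemma dirDeriv_multiD {n : ℕ} (e : Fin n → V) (α : Fin n → ℕ) {f : V → ℂ}
    (hf : ContDiff ℝ ∞ f) (i : Fin n) :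
    dirDeriv (e i) (multiD e α f) =
      fun y => Complex.I * multiD e (α + Pi.single i 1) f y := by
  rw [multiD_eq, multiD_eq, dirDeriv_const_mul,
    iterDirDeriv_add_single e α (List.nodup_finRange n) hf (List.mem_finRange i)]
  funext y
  rw [multiLength_add, multiLength_single, pow_succ]
  linear_combination ((-Complex.I) ^ multiLength α *
    dirDeriv (e i) (iterDirDeriv e α (List.finRange n) f) y) * Complex.I_mul_I

lemma multiD_const_mul {n : ℕ} (e : Fin n → V) (α : Fin n → ℕ) {f : V → ℂ} (c : ℂ) :
    multiD e α (fun y => c * f y) = fun y => c * multiD e α f y := by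
  rw [multiD_eq, multiD_eq, iterDirDeriv_const_mul]
  funext y
  ring

lemma dirDeriv_multiD_comm {n : ℕ} (e : Fin n → V) (α : Fin n → ℕ) {f : V → ℂ}
    (hf : ContDiff ℝ ∞ f) (v : V) :
    dirDeriv v (multiD e α f) = multiD e α (dirDeriv v f) := by
  rw [multiD_eq, multiD_eq, dirDeriv_const_mul, dirDeriv_iterDirDeriv_comm e α _ hf]

@[simp] lemma multiD_zero {n : ℕ} (e : Fin n → V) (f : V → ℂ) : multiD e 0 f = f := by
  have h : ∀ l : List (Fin n), iterDirDeriv e 0 l f = f := by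
    intro l
    induction l with
    | nil => rfl
    | cons i l ih => rw [iterDirDeriv_cons, ih]; rfl
  rw [multiD_eq, h]
  simp

/-- A family of functions indexed by multi-indices in which `∂ᵢ` shifts the index by `eᵢ` consists
of the derivatives `D^α` of its first member. -/
lemma multiD_family {n : ℕ} (e : Fin n → V) (F : (Fin n → ℕ) → V → ℂ)
    (hF : ∀ α i, dirDeriv (e i) (F α) = fun y => Complex.I * F (α + Pi.single i 1) y)
    (α γ : Fin n → ℕ) : multiD e γ (F α) = F (α + γ) := by
  have hit : ∀ (i : Fin n) (r : ℕ) (α : Fin n → ℕ), (dirDeriv (e i))^[r] (F α) =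
      fun y => Complex.I ^ r * F (α + Pi.single i r) y := by
    intro i r
    induction r with
    | zero => intro α; simp
    | succ r ih =>
      intro α
      rw [Function.iterate_succ, Function.comp, hF, iterate_dirDeriv_const_mul, ih]
      funext y
      rw [add_assoc, ← Pi.single_add, add_comm 1 r]
      ring
  have hl : ∀ l : List (Fin n), iterDirDeriv e γ l (F α) =
      fun y => Complex.I ^ ((l.map γ).sum) *
        F (α + (l.map fun i => Pi.single i (γ i)).sum) y := by
    intro l
    induction l with
    | nil => simp [iterDirDeriv]
    | cons i l ih =>
      rw [iterDirDeriv_cons, ih, iterate_dirDeriv_const_mul, hit]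
      funext y
      simp only [List.map_cons, List.sum_cons]
      rw [add_assoc, add_comm (List.sum (List.map (fun i => (Pi.single i (γ i) : Fin n → ℕ)) l))]
      ring
  rw [multiD_eq, hl]
  funext y
  have h1 : ((List.finRange n).map γ).sum = multiLength γ := by
    rw [multiLength, ← List.sum_ofFn, List.ofFn_eq_map]
  have h2 : ((List.finRange n).map fun i => (Pi.single i (γ i) : Fin n → ℕ)).sum = γ := by
    rw [← List.ofFn_eq_map, List.sum_ofFn]
    exact Finset.univ_sum_single γ
  rw [h1, h2, ← mul_assoc, ← mul_pow]
  simp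

end MultiIndex

/-! ### Japanese brackets, and derivatives of the slices in all variables. -/

section Slices

variable {k : ℕ}

lemma japBracket_pos {n : ℕ} (ξ : Euc n) : 0 < japBracket ξ :=
  Real.sqrt_pos.2 (by positivity)

lemma one_le_japBracket {n : ℕ} (ξ : Euc n) : 1 ≤ japBracket ξ :=
  Real.one_le_sqrt.2 (by nlinarith [sq_nonneg ‖ξ‖])

lemma japBracket_sq {n : ℕ} (ξ : Euc n) : japBracket ξ ^ 2 = 1 + ‖ξ‖ ^ 2 :=
  Real.sq_sqrt (by positivity)

lemma norm_le_japBracket {n : ℕ} (ξ : Euc n) : ‖ξ‖ ≤ japBracket ξ :=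
  Real.le_sqrt_of_sq_le (by linarith)

lemma abs_apply_le_japBracket {n : ℕ} (ξ : Euc n) (i : Fin n) : |ξ i| ≤ japBracket ξ :=
  (by simpa using PiLp.norm_apply_le ξ i : |ξ i| ≤ ‖ξ‖).trans (norm_le_japBracket ξ)

lemma joinLast_castSucc (x : Euc k) (t : ℝ) (i : Fin k) : joinLast x t i.castSucc = x i := by
  simp [joinLast]

lemma joinLast_last (x : Euc k) (t : ℝ) : joinLast x t (Fin.last k) = t := by
  simp [joinLast]

lemma joinLast_eq (x : Euc k) (t : ℝ) :
    joinLast x t = ∑ i, x i • EuclideanSpace.single i.castSucc (1 : ℝ)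
      + t • EuclideanSpace.single (Fin.last k) (1 : ℝ) := by
  ext j
  refine Fin.lastCases ?_ (fun i => ?_) j
  · rw [joinLast_last]
    simp [(Fin.castSucc_ne_last _).symm]
  · rw [joinLast_castSucc]
    simp [Pi.single_apply, Fin.castSucc_ne_last]

lemma japBracket_joinLast_sq (x : Euc k) (t : ℝ) :
    japBracket (joinLast x t) ^ 2 = japBracket x ^ 2 + t ^ 2 := by
  rw [japBracket_sq, japBracket_sq, EuclideanSpace.norm_sq_eq, EuclideanSpace.norm_sq_eq,
    Fin.sum_univ_castSucc]
  simp only [joinLast_castSucc, joinLast_last, Real.norm_eq_abs, sq_abs]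
  ring

/-- The real-linear map `(v, w) ↦ ∑ vᵢ aᵢ + ∑ wᵢ bᵢ`. -/
def gradCLM (a b : Fin k → ℂ) : Euc k × Euc k →L[ℝ] ℂ :=
  ∑ i, ((EuclideanSpace.proj i).comp (ContinuousLinearMap.fst ℝ (Euc k) (Euc k))).smulRight (a i) +
  ∑ i, ((EuclideanSpace.proj i).comp (ContinuousLinearMap.snd ℝ (Euc k) (Euc k))).smulRight (b i)

lemma gradCLM_apply (a b : Fin k → ℂ) (v w : Euc k) :
    gradCLM a b (v, w) = ∑ i, v i • a i + ∑ i, w i • b i := by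
  simp [gradCLM]

/-- Lets uniform convergence of the partial derivatives pass to uniform convergence of the Fréchet
derivatives. -/
lemma norm_gradCLM_le (a b : Fin k → ℂ) : ‖gradCLM a b‖ ≤ ∑ i, ‖a i‖ + ∑ i, ‖b i‖ := by
  refine ContinuousLinearMap.opNorm_le_bound _ (by positivity) ?_
  rintro ⟨v, w⟩
  rw [gradCLM_apply]
  have h : ∀ (y : Euc k) (c : Fin k → ℂ), ‖∑ i, y i • c i‖ ≤ (∑ i, ‖c i‖) * ‖y‖ := by
    intro y c
    rw [Finset.sum_mul]
    refine norm_sum_le_of_le _ fun i _ => ?_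
    rw [norm_smul, mul_comm]
    exact mul_le_mul_of_nonneg_left (PiLp.norm_apply_le y i) (norm_nonneg _)
  rw [add_mul]
  refine (norm_add_le _ _).trans (add_le_add ((h v a).trans ?_) ((h w b).trans ?_))
  · exact mul_le_mul_of_nonneg_left (norm_fst_le (v, w)) (by positivity)
  · exact mul_le_mul_of_nonneg_left (norm_snd_le (v, w)) (by positivity)

lemma gradCLM_sub (a b a' b' : Fin k → ℂ) :
    gradCLM (a - a') (b - b') = gradCLM a b - gradCLM a' b' := by
  refine ContinuousLinearMap.ext fun ⟨v, w⟩ => ?_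
  simp only [_root_.sub_apply, gradCLM_apply, Pi.sub_apply, smul_sub,
    Finset.sum_sub_distrib]
  ring

lemma gradCLM_smul (c : ℂ) (a b : Fin k → ℂ) :
    gradCLM (c • a) (c • b) = c • gradCLM a b := by
  refine ContinuousLinearMap.ext fun ⟨v, w⟩ => ?_
  simp only [_root_.smul_apply, gradCLM_apply, Pi.smul_apply, smul_add,
    Finset.smul_sum, smul_comm c]

lemma gradCLM_finset_sum {ι : Type*} (S : Finset ι) (a b : ι → Fin k → ℂ) :
    gradCLM (∑ j ∈ S, a j) (∑ j ∈ S, b j) = ∑ j ∈ S, gradCLM (a j) (b j) := by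
  refine ContinuousLinearMap.ext fun ⟨v, w⟩ => ?_
  simp only [_root_.sum_apply, gradCLM_apply, Finset.sum_apply,
    Finset.smul_sum, Finset.sum_add_distrib]
  rw [Finset.sum_comm, Finset.sum_comm (s := S) (t := Finset.univ) (f := fun j i => w i • b j i)]

variable {d : ℝ} {p : Euc (k + 1) × Euc (k + 1) → ℂ}

lemma contDiff_Dxi_Dx {n : ℕ} {p : Euc n × Euc n → ℂ} (hp : ContDiff ℝ ∞ p)
    (α β : Fin n → ℕ) :
    ContDiff ℝ ∞ (Dxi α (Dx β p)) :=
  (hp.multiD _ _).multiD _ _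

lemma dirDeriv_Dxi_Dx_snd {n : ℕ} {p : Euc n × Euc n → ℂ} (hp : ContDiff ℝ ∞ p)
    (α β : Fin n → ℕ) (i : Fin n) :
    dirDeriv ((0 : Euc n), EuclideanSpace.single i (1 : ℝ)) (Dxi α (Dx β p)) =
      fun y => Complex.I * Dxi (α + Pi.single i 1) (Dx β p) y :=
  dirDeriv_multiD (fun i => ((0 : Euc n), EuclideanSpace.single i (1 : ℝ))) α (hp.multiD _ _) i

lemma dirDeriv_Dxi_Dx_fst {n : ℕ} {p : Euc n × Euc n → ℂ} (hp : ContDiff ℝ ∞ p)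
    (α β : Fin n → ℕ) (i : Fin n) :
    dirDeriv (EuclideanSpace.single i (1 : ℝ), (0 : Euc n)) (Dxi α (Dx β p)) =
      fun y => Complex.I * Dxi α (Dx (β + Pi.single i 1) p) y := by
  have hc : ContDiff ℝ ∞ (Dx β p) := hp.multiD _ _
  rw [Dxi, dirDeriv_multiD_comm _ _ hc, Dx,
    dirDeriv_multiD (fun i => (EuclideanSpace.single i (1 : ℝ), (0 : Euc n))) β hp i,
    multiD_const_mul]
  rfl

/-- Reconciles the order of differentiation in `IsSymbol` with that in `normalSlice`. -/
lemma Dx_Dxi_comm {n : ℕ} {p : Euc n × Euc n → ℂ} (hp : ContDiff ℝ ∞ p) (α β : Fin n → ℕ) :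
    Dx β (Dxi α p) = Dxi α (Dx β p) := by
  have := multiD_family (fun i => (EuclideanSpace.single i (1 : ℝ), (0 : Euc n)))
    (fun β => Dxi α (Dx β p)) (fun β i => dirDeriv_Dxi_Dx_fst hp α β i) 0 β
  simpa [Dx] using this

lemma IsSymbol.norm_normalSlice_le (hp : IsSymbol d p) (α β : Fin (k + 1) → ℕ) :
    ∃ C : ℝ, 0 ≤ C ∧ ∀ (x ξ : Euc k) (t : ℝ), ‖normalSlice p α β x ξ t‖ ≤
      C * japBracket (joinLast ξ t) ^ (d - multiLength α) := by
  obtain ⟨C, hC⟩ := hp.2 α β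
  have h : ∀ (x ξ : Euc k) (t : ℝ), ‖normalSlice p α β x ξ t‖ ≤
      C * japBracket (joinLast ξ t) ^ (d - multiLength α) := by
    intro x ξ t
    have := hC (joinLast x 0) (joinLast ξ t)
    rw [Dx_Dxi_comm hp.1, Real.rpow_neg (japBracket_pos _).le,
      inv_mul_le_iff₀ (Real.rpow_pos_of_pos (japBracket_pos _) _), mul_comm] at this
    exact this
  refine ⟨max C 0, le_max_right _ _, fun x ξ t => (h x ξ t).trans ?_⟩
  gcongr
  · exact Real.rpow_nonneg (japBracket_pos _).le _
  · exact le_max_left _ _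

lemma hasDerivAt_normalSlice (hp : ContDiff ℝ ∞ p) (α β : Fin (k + 1) → ℕ) (x ξ : Euc k) (t : ℝ) :
    HasDerivAt (normalSlice p α β x ξ)
      (Complex.I * normalSlice p (α + Pi.single (Fin.last k) 1) β x ξ t) t := by
  have hq := ((contDiff_Dxi_Dx hp α β).differentiable (by simp)
    (joinLast x 0, joinLast ξ t)).hasFDerivAt
  have hj : HasDerivAt (fun t : ℝ => (joinLast x 0, joinLast ξ t))
      ((0 : Euc (k + 1)), EuclideanSpace.single (Fin.last k) (1 : ℝ)) t := by
    refine (hasDerivAt_const _ _).prodMk ?_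
    have e : joinLast ξ = fun t => ∑ i, ξ i • EuclideanSpace.single i.castSucc (1 : ℝ)
      + t • EuclideanSpace.single (Fin.last k) (1 : ℝ) := funext (joinLast_eq ξ)
    rw [e]
    simpa using ((hasDerivAt_id t).smul_const
      (EuclideanSpace.single (Fin.last k) (1 : ℝ))).const_add
      (∑ i, ξ i • EuclideanSpace.single i.castSucc (1 : ℝ))
  have h := hq.comp_hasDerivAt t hj
  have e := congrFun (dirDeriv_Dxi_Dx_snd hp α β (Fin.last k)) (joinLast x 0, joinLast ξ t)
  simp only [dirDeriv] at e
  rw [e] at h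
  exact h

/-- Moving `(x', ξ')` leaves the last coordinates `0` and `t` fixed, so only the shifts by
`i.castSucc` occur. The family of slices over all `α`, `β` is thus closed under tangential
differentiation, and every later regularity statement rests on this closure. -/
lemma hasFDerivAt_normalSlice (hp : ContDiff ℝ ∞ p) (α β : Fin (k + 1) → ℕ) (t : ℝ)
    (y : Euc k × Euc k) :
    HasFDerivAt (fun y : Euc k × Euc k => normalSlice p α β y.1 y.2 t)
      (Complex.I • gradCLM
        (fun i => normalSlice p α (β + Pi.single i.castSucc 1) y.1 y.2 t)
        (fun i => normalSlice p (α + Pi.single i.castSucc 1) β y.1 y.2 t)) y := by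
  have hq := ((contDiff_Dxi_Dx hp α β).differentiable (by simp)
    (joinLast y.1 0, joinLast y.2 t)).hasFDerivAt
  let P : Euc k →L[ℝ] Euc (k + 1) := ∑ i, (EuclideanSpace.proj (𝕜 := ℝ) i).smulRight
    (EuclideanSpace.single i.castSucc (1 : ℝ))
  have hP : ∀ (r : ℝ) (v : Euc k), joinLast v r =
      P v + r • EuclideanSpace.single (Fin.last k) (1 : ℝ) := by
    intro r v
    rw [joinLast_eq]
    simp [P]
  have hj : HasFDerivAt (fun y : Euc k × Euc k => (joinLast y.1 0, joinLast y.2 t))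
      ((P.comp (ContinuousLinearMap.fst ℝ _ _)).prod (P.comp (ContinuousLinearMap.snd ℝ _ _))) y := by
    simp only [hP]
    exact (((P.comp (ContinuousLinearMap.fst ℝ (Euc k) (Euc k))).hasFDerivAt).add_const _).prodMk
      (((P.comp (ContinuousLinearMap.snd ℝ (Euc k) (Euc k))).hasFDerivAt).add_const _)
  have h := hq.comp y hj
  refine h.congr_fderiv ?_
  refine ContinuousLinearMap.ext fun ⟨v, w⟩ => ?_
  have e1 := fun i => congrFun (dirDeriv_Dxi_Dx_snd hp α β i) (joinLast y.1 0, joinLast y.2 t)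
  have e2 := fun i => congrFun (dirDeriv_Dxi_Dx_fst hp α β i) (joinLast y.1 0, joinLast y.2 t)
  simp only [dirDeriv] at e1 e2
  have split : ((P.comp (ContinuousLinearMap.fst ℝ _ _)).prod
      (P.comp (ContinuousLinearMap.snd ℝ _ _))) (v, w) =
      ∑ i, v i • (EuclideanSpace.single i.castSucc (1 : ℝ), (0 : Euc (k + 1))) +
      ∑ i, w i • ((0 : Euc (k + 1)), EuclideanSpace.single i.castSucc (1 : ℝ)) := by
    simp [P, Prod.ext_iff, Prod.fst_sum, Prod.snd_sum]
  rw [ContinuousLinearMap.comp_apply, split, map_add, map_sum, map_sum]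
  simp only [map_smul, e1, e2, _root_.smul_apply, gradCLM_apply, smul_add,
    Finset.smul_sum, smul_comm Complex.I]
  rfl

end Slices

end

noncomputable section

/-! ### The Fourier transform on the line and its inversion. -/

section Fourier

open MeasureTheory FourierTransform Filter Topology

/-- The Fourier transform on `ℝ`, `(ℱ K)(t) = ∫ e^{-izt} K(z) dz`. -/
def lineFourier (K : ℝ → ℂ) (t : ℝ) : ℂ := ∫ z : ℝ, Complex.exp (-Complex.I * z * t) * K z

lemma norm_exp_I_mul_mul (z t : ℝ) : ‖Complex.exp (Complex.I * z * t)‖ = 1 := by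
  rw [show Complex.I * z * t = ((z * t : ℝ) : ℂ) * Complex.I by push_cast; ring,
    Complex.norm_exp_ofReal_mul_I]

lemma norm_exp_neg_I_mul_mul (z t : ℝ) : ‖Complex.exp (-Complex.I * z * t)‖ = 1 := by
  rw [show -Complex.I * z * t = ((-(z * t) : ℝ) : ℂ) * Complex.I by push_cast; ring,
    Complex.norm_exp_ofReal_mul_I]

lemma two_pi_ne_zero' : ((2 * Real.pi : ℝ) : ℂ) ≠ 0 := by
  exact_mod_cast Real.two_pi_pos.ne'

lemma lineFourier_eq_invFourierLine (K : ℝ → ℂ) (t : ℝ) :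
    lineFourier K t = ((2 * Real.pi : ℝ) : ℂ) * invFourierLine K (-t) := by
  rw [invFourierLine, mul_inv_cancel_left₀ two_pi_ne_zero', lineFourier]
  congr 1
  funext z
  push_cast
  ring_nf

lemma invFourierLine_eq_fourierInv (φ : ℝ → ℂ) (ξ : ℝ) :
    invFourierLine φ ξ = ((2 * Real.pi : ℝ) : ℂ)⁻¹ * 𝓕⁻ φ (ξ / (2 * Real.pi)) := by
  rw [invFourierLine, Real.fourierInv_eq']
  congr 2
  funext z
  rw [smul_eq_mul]
  congr 2
  have := Real.pi_pos.ne'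
  have e : (2 * Real.pi * inner ℝ z (ξ / (2 * Real.pi)) : ℝ) = z * ξ := by
    simp only [RCLike.inner_apply, conj_trivial]
    field_simp
  rw [e]
  push_cast
  ring

lemma norm_invFourierLine_le (φ : ℝ → ℂ) (ξ : ℝ) :
    ‖invFourierLine φ ξ‖ ≤ ∫ z, ‖φ z‖ := by
  have h1 : ‖∫ z : ℝ, Complex.exp (Complex.I * z * ξ) * φ z‖ ≤ ∫ z, ‖φ z‖ := by
    refine (norm_integral_le_integral_norm _).trans (le_of_eq ?_)
    congr 1; funext z
    rw [norm_mul, norm_exp_I_mul_mul, one_mul]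
  have h2 : ‖((2 * Real.pi : ℝ) : ℂ)⁻¹‖ ≤ 1 := by
    rw [norm_inv, Complex.norm_real, Real.norm_of_nonneg Real.two_pi_pos.le]
    exact inv_le_one_of_one_le₀ (by linarith [Real.pi_gt_three])
  rw [invFourierLine, norm_mul]
  exact (mul_le_mul h2 h1 (norm_nonneg _) zero_le_one).trans (one_mul _).le

lemma norm_lineFourier_le (φ : ℝ → ℂ) (ξ : ℝ) :
    ‖lineFourier φ ξ‖ ≤ ∫ z, ‖φ z‖ := by
  refine (norm_integral_le_integral_norm _).trans (le_of_eq ?_)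
  congr 1; funext z
  rw [norm_mul, norm_exp_neg_I_mul_mul, one_mul]

lemma invFourierLine_const_mul (c : ℂ) (φ : ℝ → ℂ) (ξ : ℝ) :
    invFourierLine (fun z => c * φ z) ξ = c * invFourierLine φ ξ := by
  simp only [invFourierLine]
  rw [mul_left_comm, ← integral_const_mul c]
  congr 2; funext z; ring

lemma integrable_exp_mul {φ : ℝ → ℂ} (hφ : Integrable φ) (ξ : ℝ) :
    Integrable fun z : ℝ => Complex.exp (Complex.I * z * ξ) * φ z := by
  refine hφ.bdd_mul (c := 1) ?_ ?_
  · exact (by fun_prop : Continuous fun z : ℝ => Complex.exp (Complex.I * z * ξ)).aestronglyMeasurable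
  · exact Eventually.of_forall fun z => (norm_exp_I_mul_mul z ξ).le

lemma integrable_exp_neg_mul {φ : ℝ → ℂ} (hφ : Integrable φ) (ξ : ℝ) :
    Integrable fun z : ℝ => Complex.exp (-Complex.I * z * ξ) * φ z := by
  refine hφ.bdd_mul (c := 1) ?_ ?_
  · exact (by fun_prop : Continuous fun z : ℝ => Complex.exp (-Complex.I * z * ξ)).aestronglyMeasurable
  · exact Eventually.of_forall fun z => (norm_exp_neg_I_mul_mul z ξ).le

/-- The inverse Fourier transform is symmetric for the bilinear pairing. -/
lemma integral_mul_invFourierLine {Q φ : ℝ → ℂ} (hQ : Integrable Q) (hφ : Integrable φ) :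
    ∫ ξ, Q ξ * invFourierLine φ ξ = ∫ z, invFourierLine Q z * φ z := by
  have hint : Integrable (Function.uncurry fun ξ z : ℝ =>
      Complex.exp (Complex.I * z * ξ) * (Q ξ * φ z)) (volume.prod volume) := by
    refine (hQ.mul_prod hφ).bdd_mul (c := 1) ?_ ?_
    · exact (by fun_prop : Continuous fun y : ℝ × ℝ =>
        Complex.exp (Complex.I * y.2 * y.1)).aestronglyMeasurable
    · exact Eventually.of_forall fun y => (norm_exp_I_mul_mul y.2 y.1).le
  have h := integral_integral_swap hint
  have h1 : ∀ ξ, Q ξ * invFourierLine φ ξ = ((2 * Real.pi : ℝ) : ℂ)⁻¹ *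
      ∫ z : ℝ, Complex.exp (Complex.I * z * ξ) * (Q ξ * φ z) := by
    intro ξ
    rw [invFourierLine, mul_left_comm, ← integral_const_mul (Q ξ)]
    congr 2; funext z; ring
  have h2 : ∀ z, invFourierLine Q z * φ z = ((2 * Real.pi : ℝ) : ℂ)⁻¹ *
      ∫ ξ : ℝ, Complex.exp (Complex.I * z * ξ) * (Q ξ * φ z) := by
    intro z
    rw [invFourierLine, mul_assoc, ← integral_mul_const]
    congr 2; funext ξ; ring_nf
  simp only [h1, h2]
  rw [integral_const_mul, integral_const_mul, h]

lemma hasDerivAt_invFourierLine {φ : ℝ → ℂ} (hφ : Integrable φ)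
    (hφ' : Integrable fun z : ℝ => (z : ℂ) * φ z) (ξ : ℝ) :
    HasDerivAt (invFourierLine φ) (invFourierLine (fun z : ℝ => Complex.I * z * φ z) ξ) ξ := by
  have hm : ∀ ξ : ℝ, AEStronglyMeasurable (fun z : ℝ => Complex.exp (Complex.I * z * ξ) * φ z) :=
    fun ξ => (integrable_exp_mul hφ ξ).aestronglyMeasurable
  have h := hasDerivAt_integral_of_dominated_loc_of_deriv_le (μ := volume) (𝕜 := ℝ)
    (F := fun (ξ : ℝ) (z : ℝ) => Complex.exp (Complex.I * z * ξ) * φ z)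
    (F' := fun (ξ : ℝ) (z : ℝ) => Complex.exp (Complex.I * z * ξ) * (Complex.I * z * φ z))
    (x₀ := ξ) (s := Set.univ) (bound := fun z : ℝ => ‖(z : ℂ) * φ z‖) Filter.univ_mem
    (Eventually.of_forall hm) (integrable_exp_mul hφ ξ)
    (by
      have : Integrable fun z : ℝ => Complex.I * z * φ z := by
        simpa only [mul_assoc] using hφ'.const_mul Complex.I
      exact (integrable_exp_mul this ξ).aestronglyMeasurable)
    (Eventually.of_forall fun z y _ => by
      rw [norm_mul, norm_exp_I_mul_mul, one_mul, mul_assoc, norm_mul, Complex.norm_I, one_mul])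
    hφ'.norm
    (Eventually.of_forall fun z y _ => by
      have h0 : HasDerivAt (fun y : ℝ => (y : ℂ)) 1 y := Complex.ofRealCLM.hasDerivAt
      have h1 := ((h0.const_mul (Complex.I * z)).cexp).mul_const (φ z)
      refine h1.congr_deriv ?_
      ring)
  exact h.2.const_mul _

lemma continuous_invFourierLine {φ : ℝ → ℂ} (hφ : Integrable φ) :
    Continuous (invFourierLine φ) := by
  refine continuous_const.mul (continuous_of_dominated (bound := fun z => ‖φ z‖)
    (fun ξ => (integrable_exp_mul hφ ξ).aestronglyMeasurable) ?_ hφ.norm ?_)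
  · intro ξ
    exact Eventually.of_forall fun z => by rw [norm_mul, norm_exp_I_mul_mul, one_mul]
  · exact Eventually.of_forall fun z => by fun_prop

lemma hasDerivAt_lineFourier {φ : ℝ → ℂ} (hφ : Integrable φ)
    (hφ' : Integrable fun z : ℝ => (z : ℂ) * φ z) (ξ : ℝ) :
    HasDerivAt (lineFourier φ) (lineFourier (fun z : ℝ => -Complex.I * z * φ z) ξ) ξ := by
  have : lineFourier φ = fun t => ((2 * Real.pi : ℝ) : ℂ) * invFourierLine φ (-t) :=
    funext (lineFourier_eq_invFourierLine φ)
  rw [this, lineFourier_eq_invFourierLine]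
  have h := ((hasDerivAt_invFourierLine hφ hφ' (-ξ)).scomp ξ (hasDerivAt_neg ξ)).const_mul
    ((2 * Real.pi : ℝ) : ℂ)
  refine h.congr_deriv ?_
  have e : (fun z : ℝ => -Complex.I * z * φ z) = fun z : ℝ => (-1) * (Complex.I * z * φ z) := by
    funext z; ring
  rw [e, invFourierLine_const_mul]
  simp

lemma invFourierLine_deriv {φ φ' : ℝ → ℂ} (h : ∀ z, HasDerivAt φ (φ' z) z) (hφ : Integrable φ)
    (hφ' : Integrable φ') (ξ : ℝ) :
    invFourierLine φ' ξ = -Complex.I * ξ * invFourierLine φ ξ := by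
  have hE : ∀ z : ℝ, HasDerivAt (fun z : ℝ => Complex.exp (Complex.I * z * ξ))
      (Complex.I * ξ * Complex.exp (Complex.I * z * ξ)) z := by
    intro z
    have h0 : HasDerivAt (fun ξ : ℝ => (ξ : ℂ)) 1 z := Complex.ofRealCLM.hasDerivAt
    refine (((h0.const_mul Complex.I).mul_const (ξ : ℂ)).cexp).congr_deriv ?_
    ring
  have := integral_mul_deriv_eq_deriv_mul_of_integrable (fun z _ => hE z) (fun z _ => h z)
    (integrable_exp_mul hφ' ξ)
    (by
      have := (integrable_exp_mul hφ ξ).const_mul (Complex.I * ξ)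
      refine this.congr (Eventually.of_forall fun z => ?_)
      simp only [Pi.mul_apply]; ring)
    (integrable_exp_mul hφ ξ)
  simp only [invFourierLine]
  rw [this]
  have e : ∀ z : ℝ, Complex.I * ξ * Complex.exp (Complex.I * z * ξ) * φ z =
    (Complex.I * ξ) * (Complex.exp (Complex.I * z * ξ) * φ z) := fun z => by ring
  simp only [e]
  rw [integral_const_mul]
  ring

/-- Fourier inversion on the line. -/
lemma lineFourier_invFourierLine {f : ℝ → ℂ} (hc : Continuous f) (hf : Integrable f)
    (hF : Integrable (invFourierLine f)) (z : ℝ) : lineFourier (invFourierLine f) z = f z := by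
  have hpi := Real.two_pi_pos
  have e1 : ∀ η : ℝ, 𝓕⁻ f η = ((2 * Real.pi : ℝ) : ℂ) * invFourierLine f (2 * Real.pi * η) := by
    intro η
    rw [invFourierLine_eq_fourierInv, mul_inv_cancel_left₀ two_pi_ne_zero',
      mul_div_cancel_left₀ _ hpi.ne']
  have hi : Integrable (𝓕⁻ f) := by
    have := (hF.comp_mul_left' hpi.ne').const_mul ((2 * Real.pi : ℝ) : ℂ)
    exact this.congr (Eventually.of_forall fun η => (e1 η).symm)
  have hi' : Integrable (𝓕 f) := by
    refine hi.comp_neg.congr (Eventually.of_forall fun η => ?_)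
    simp only
    rw [Real.fourierInv_eq_fourier_neg, neg_neg]
  have h := congrFun (hc.fourier_fourierInv_eq hf hi') z
  rw [← h, Real.fourier_real_eq_integral_exp_smul]
  have := Measure.integral_comp_mul_left (fun ξ : ℝ =>
    Complex.exp (-Complex.I * ξ * z) * invFourierLine f ξ) (2 * Real.pi)
  rw [lineFourier]
  simp only [e1, smul_eq_mul]
  rw [abs_of_pos (inv_pos.2 hpi), eq_inv_smul_iff₀ hpi.ne'] at this
  rw [← this, Complex.real_smul, ← integral_const_mul]
  congr 1; funext v
  rw [mul_left_comm]
  congr 2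
  push_cast
  ring

lemma integrable_inv_one_add_sq_mul (C : ℝ) : Integrable fun z : ℝ => C * (1 + z ^ 2)⁻¹ :=
  integrable_inv_one_add_sq.const_mul C

lemma integrable_of_norm_le_inv_one_add_sq {f : ℝ → ℂ} (hm : AEStronglyMeasurable f) {C : ℝ}
    (h : ∀ᵐ z : ℝ, ‖f z‖ ≤ C * (1 + z ^ 2)⁻¹) : Integrable f :=
  (integrable_inv_one_add_sq_mul C).mono' hm h

lemma integral_norm_le_of_le_inv_one_add_sq {f : ℝ → ℂ} {C : ℝ}
    (h : ∀ᵐ z : ℝ, ‖f z‖ ≤ C * (1 + z ^ 2)⁻¹) : ∫ z, ‖f z‖ ≤ C * Real.pi := by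
  rw [← integral_univ_inv_one_add_sq, ← integral_const_mul]
  exact integral_mono_of_nonneg (Eventually.of_forall fun z => norm_nonneg _)
    (integrable_inv_one_add_sq_mul C) h

end Fourier

end

noncomputable section

/-! ### Kernels off zero, by duality with test functions supported away from zero. -/

section OffZero

open MeasureTheory Filter Topology

/-- Test functions on `ℝ ∖ {0}`. -/
structure IsTestOffZero (φ : ℝ → ℂ) : Prop where
  contDiff : ContDiff ℝ ∞ φ
  hasCompactSupport : HasCompactSupport φ
  tsupport_subset : tsupport φ ⊆ {0}ᶜ

/-- The restriction of `ℱ⁻¹ f` to `ℝ ∖ {0}` is the function `K`. -/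
def RepOffZero (f K : ℝ → ℂ) : Prop :=
  ∀ φ : ℝ → ℂ, IsTestOffZero φ → ∫ ξ : ℝ, f ξ * invFourierLine φ ξ = ∫ z : ℝ, K z * φ z

/-- Continuous functions of polynomial growth. -/
def PolyGrowth (f : ℝ → ℂ) : Prop :=
  Continuous f ∧ ∃ (C : ℝ) (N : ℕ), ∀ t : ℝ, ‖f t‖ ≤ C * (1 + |t|) ^ N

lemma isInvFourierOffZero_iff {f K : ℝ → ℂ} :
    IsInvFourierOffZero f K ↔ ContDiffOn ℝ ∞ K {0}ᶜ ∧ RepOffZero f K :=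
  ⟨fun h => ⟨h.1, fun φ hφ => h.2 φ hφ.1 hφ.2 hφ.3⟩,
    fun h => ⟨h.1, fun φ h1 h2 h3 => h.2 φ ⟨h1, h2, h3⟩⟩⟩

namespace IsTestOffZero

variable {φ : ℝ → ℂ}

lemma integrable (hφ : IsTestOffZero φ) : Integrable φ :=
  hφ.contDiff.continuous.integrable_of_hasCompactSupport hφ.hasCompactSupport

lemma deriv (hφ : IsTestOffZero φ) : IsTestOffZero (deriv φ) where
  contDiff := (contDiff_infty_iff_deriv.1 hφ.contDiff).2
  hasCompactSupport := hφ.hasCompactSupport.deriv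
  tsupport_subset := (closure_minimal support_deriv_subset
    (isClosed_tsupport φ)).trans hφ.tsupport_subset

lemma hasDerivAt (hφ : IsTestOffZero φ) (z : ℝ) : HasDerivAt φ (_root_.deriv φ z) z :=
  (hφ.contDiff.differentiable (by simp) z).hasDerivAt

/-- Test functions supported away from zero may be divided by powers of `z`; this is what permits
solving `-iz K = L` for `K` off zero. -/
lemma mul (hφ : IsTestOffZero φ) {g : ℝ → ℂ} (hg : ContDiffOn ℝ ∞ g {0}ᶜ) :
    IsTestOffZero fun z => g z * φ z where
  contDiff := by
    refine contDiff_iff_contDiffAt.2 fun z => ?_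
    by_cases hz : z ∈ tsupport φ
    · exact (hg.contDiffAt (isOpen_compl_singleton.mem_nhds (hφ.tsupport_subset hz))).mul
        hφ.contDiff.contDiffAt
    · refine (contDiffAt_const (c := (0 : ℂ))).congr_of_eventuallyEq ?_
      filter_upwards [notMem_tsupport_iff_eventuallyEq.1 hz] with y hy
      simp [hy]
  hasCompactSupport := hφ.hasCompactSupport.mul_left
  tsupport_subset := tsupport_mul_subset_right.trans hφ.tsupport_subset

lemma apply_zero (hφ : IsTestOffZero φ) : φ 0 = 0 :=
  image_eq_zero_of_notMem_tsupport fun h => hφ.tsupport_subset h rfl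

lemma contDiffOn_I_mul : ContDiffOn ℝ ∞ (fun z : ℝ => Complex.I * z) {0}ᶜ :=
  (contDiff_const.mul Complex.ofRealCLM.contDiff).contDiffOn

lemma invFourierLine_deriv (hφ : IsTestOffZero φ) (ξ : ℝ) :
    invFourierLine (_root_.deriv φ) ξ = -Complex.I * ξ * invFourierLine φ ξ :=
  _root_.invFourierLine_deriv hφ.hasDerivAt hφ.integrable hφ.deriv.integrable ξ

lemma hasDerivAt_invFourierLine (hφ : IsTestOffZero φ) (ξ : ℝ) :
    HasDerivAt (invFourierLine φ) (invFourierLine (fun z : ℝ => Complex.I * z * φ z) ξ) ξ :=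
  _root_.hasDerivAt_invFourierLine hφ.integrable
    (hφ.mul Complex.ofRealCLM.contDiff.contDiffOn).integrable ξ

/-- One integration by parts for each power of `ξ`, the derivative again being a test function. -/
lemma abs_pow_mul_norm_invFourierLine_le (hφ : IsTestOffZero φ) (N : ℕ) :
    ∃ C : ℝ, ∀ ξ : ℝ, |ξ| ^ N * ‖invFourierLine φ ξ‖ ≤ C := by
  induction N generalizing φ with
  | zero => exact ⟨∫ z, ‖φ z‖, fun ξ => by simpa using norm_invFourierLine_le φ ξ⟩
  | succ N ih =>
    obtain ⟨C, hC⟩ := ih hφ.deriv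
    refine ⟨C, fun ξ => ?_⟩
    have := hC ξ
    rw [hφ.invFourierLine_deriv] at this
    simp only [norm_mul, norm_neg, Complex.norm_I, one_mul, Complex.norm_real,
      Real.norm_eq_abs] at this
    rw [pow_succ, mul_assoc]
    exact this

end IsTestOffZero

namespace PolyGrowth

variable {f g : ℝ → ℂ}

lemma integrable_mul (hf : PolyGrowth f) {φ : ℝ → ℂ} (hφ : IsTestOffZero φ) :
    Integrable fun ξ => f ξ * invFourierLine φ ξ := by
  obtain ⟨hc, C, N, hC⟩ := hf
  -- `N` powers absorb the growth of `f`; two more give the integrable majorant `(1 + ξ²)⁻¹`.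
  obtain ⟨A, hA⟩ := hφ.abs_pow_mul_norm_invFourierLine_le (N + 2)
  obtain ⟨B, hB⟩ := hφ.abs_pow_mul_norm_invFourierLine_le 0
  have hC0 : 0 ≤ C := by simpa using (norm_nonneg _).trans (hC 0)
  refine integrable_of_norm_le_inv_one_add_sq (C := C * (2 ^ (N + 2) * (A + B)))
    (hc.mul (continuous_invFourierLine hφ.integrable)).aestronglyMeasurable
    (Eventually.of_forall fun ξ => ?_)
  have h1 : (1 + |ξ|) ^ (N + 2) ≤ 2 ^ (N + 2) * (|ξ| ^ (N + 2) + 1) := by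
    rcases le_total |ξ| 1 with h | h
    · have h3 : (1 + |ξ|) ^ (N + 2) ≤ 2 ^ (N + 2) :=
        pow_le_pow_left₀ (by positivity) (by linarith) _
      have : 0 ≤ 2 ^ (N + 2) * |ξ| ^ (N + 2) := by positivity
      linarith
    · have h3 : (1 + |ξ|) ^ (N + 2) ≤ (2 * |ξ|) ^ (N + 2) :=
        pow_le_pow_left₀ (by positivity) (by linarith) _
      rw [mul_pow] at h3
      have : (0 : ℝ) ≤ 2 ^ (N + 2) := by positivity
      linarith
  have h2 : (1 + |ξ|) ^ (N + 2) * ‖invFourierLine φ ξ‖ ≤ 2 ^ (N + 2) * (A + B) := by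
    calc _ ≤ 2 ^ (N + 2) * (|ξ| ^ (N + 2) + 1) * ‖invFourierLine φ ξ‖ := by gcongr
      _ = 2 ^ (N + 2) * (|ξ| ^ (N + 2) * ‖invFourierLine φ ξ‖ + |ξ| ^ 0 * ‖invFourierLine φ ξ‖) := by
          ring
      _ ≤ _ := by gcongr; exacts [hA ξ, hB ξ]
  rw [← div_eq_mul_inv, le_div_iff₀ (by positivity), norm_mul]
  have h4 : 1 + ξ ^ 2 ≤ (1 + |ξ|) ^ 2 := by
    rw [← sq_abs]; nlinarith [abs_nonneg ξ]
  calc ‖f ξ‖ * ‖invFourierLine φ ξ‖ * (1 + ξ ^ 2)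
      ≤ (C * (1 + |ξ|) ^ N) * ‖invFourierLine φ ξ‖ * (1 + |ξ|) ^ 2 := by
        gcongr; exact hC ξ
    _ = C * ((1 + |ξ|) ^ (N + 2) * ‖invFourierLine φ ξ‖) := by ring
    _ ≤ _ := by gcongr

lemma id_mul (hf : PolyGrowth f) : PolyGrowth fun t : ℝ => (t : ℂ) * f t := by
  obtain ⟨hc, C, N, hC⟩ := hf
  refine ⟨by fun_prop, C, N + 1, fun t => ?_⟩
  rw [norm_mul, Complex.norm_real, Real.norm_eq_abs, pow_succ, ← mul_assoc, mul_comm]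
  have h0 := (norm_nonneg _).trans (hC t)
  gcongr
  · exact hC t
  · linarith

lemma const_mul (hf : PolyGrowth f) (c : ℂ) : PolyGrowth fun t : ℝ => c * f t := by
  obtain ⟨hc, C, N, hC⟩ := hf
  refine ⟨by fun_prop, ‖c‖ * C, N, fun t => ?_⟩
  rw [norm_mul, mul_assoc]
  gcongr
  exact hC t

lemma add (hf : PolyGrowth f) (hg : PolyGrowth g) : PolyGrowth fun t : ℝ => f t + g t := by
  obtain ⟨hc, C, N, hC⟩ := hf
  obtain ⟨hc', C', N', hC'⟩ := hg
  have h0 : 0 ≤ C := by simpa using (norm_nonneg _).trans (hC 0)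
  have h0' : 0 ≤ C' := by simpa using (norm_nonneg _).trans (hC' 0)
  refine ⟨by fun_prop, C + C', N + N', fun t => ?_⟩
  rw [add_mul]
  refine (norm_add_le _ _).trans (add_le_add ((hC t).trans ?_) ((hC' t).trans ?_))
  all_goals gcongr
  all_goals first | omega | linarith [abs_nonneg t]

lemma pow_mul (hf : PolyGrowth f) (m : ℕ) : PolyGrowth fun t : ℝ => (t : ℂ) ^ m * f t := by
  induction m with
  | zero => simpa using hf
  | succ m ih => simpa only [pow_succ', mul_assoc] using ih.id_mul

lemma one : PolyGrowth fun _ => 1 :=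
  ⟨continuous_const, 1, 0, fun t => by simp⟩

lemma sum {ι : Type*} (S : Finset ι) {F : ι → ℝ → ℂ} (h : ∀ i ∈ S, PolyGrowth (F i)) :
    PolyGrowth fun t => ∑ i ∈ S, F i t := by
  classical
  induction S using Finset.induction_on with
  | empty => exact ⟨by simpa using continuous_const, 0, 0, fun t => by simp⟩
  | insert i S hi ih =>
    simp only [Finset.sum_insert hi]
    exact (h i (by simp)).add (ih fun j hj => h j (by simp [hj]))

end PolyGrowth

namespace RepOffZero

variable {f g K L : ℝ → ℂ}

lemma of_integrable (hf : Integrable f) : RepOffZero f (invFourierLine f) :=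
  fun _ hφ => integral_mul_invFourierLine hf hφ.integrable

lemma integrable_invFourierLine {φ : ℝ → ℂ} (hφ : IsTestOffZero φ) :
    Integrable (invFourierLine φ) := by
  simpa using PolyGrowth.one.integrable_mul hφ

lemma lineFourier_invFourierLine_test {φ : ℝ → ℂ} (hφ : IsTestOffZero φ) (z : ℝ) :
    lineFourier (invFourierLine φ) z = φ z :=
  lineFourier_invFourierLine hφ.contDiff.continuous hφ.integrable
    (integrable_invFourierLine hφ) z

/-- Symmetry of `ℱ⁻¹`, applied to `K` and the reflection of `ℱ⁻¹ φ`, whose inverse transform is `φ /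
2π` by Fourier inversion. -/
lemma lineFourier_of_integrable (hK : Integrable K) : RepOffZero (lineFourier K) K := by
  intro φ hφ
  have h := integral_mul_invFourierLine hK
    ((integrable_invFourierLine hφ).comp_neg)
  have e1 : ∀ ξ, invFourierLine (fun z => invFourierLine φ (-z)) ξ =
      ((2 * Real.pi : ℝ) : ℂ)⁻¹ * φ ξ := by
    intro ξ
    rw [← lineFourier_invFourierLine_test hφ ξ, invFourierLine, lineFourier,
      ← integral_neg_eq_self]
    congr 2
    funext z
    push_cast
    ring_nf
  simp only [e1] at h
  rw [← integral_neg_eq_self (fun z => invFourierLine K z * invFourierLine φ (-z))] at h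
  simp only [neg_neg, lineFourier_eq_invFourierLine, mul_assoc] at h ⊢
  rw [integral_const_mul, ← h, ← integral_const_mul]
  congr 1
  funext z
  rw [mul_left_comm, mul_inv_cancel_left₀ two_pi_ne_zero']

lemma const_mul (h : RepOffZero f K) (c : ℂ) :
    RepOffZero (fun t => c * f t) (fun z => c * K z) := by
  intro φ hφ
  simp only [mul_assoc]
  rw [integral_const_mul, integral_const_mul, h φ hφ]

lemma integrable_mul_test (hK : ContinuousOn K {0}ᶜ) {φ : ℝ → ℂ} (hφ : IsTestOffZero φ) :
    Integrable fun z => K z * φ z := by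
  refine Continuous.integrable_of_hasCompactSupport ?_ hφ.hasCompactSupport.mul_left
  refine continuous_of_tsupport fun z hz => ?_
  have hz' : z ∈ ({0} : Set ℝ)ᶜ := hφ.tsupport_subset (tsupport_mul_subset_right hz)
  exact (hK.continuousAt (isOpen_compl_singleton.mem_nhds hz')).mul
    hφ.contDiff.continuous.continuousAt

lemma add (hf : PolyGrowth f) (hg : PolyGrowth g) (hK : ContinuousOn K {0}ᶜ)
    (hL : ContinuousOn L {0}ᶜ) (h : RepOffZero f K) (h' : RepOffZero g L) :
    RepOffZero (fun t => f t + g t) (fun z => K z + L z) := by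
  intro φ hφ
  simp only [add_mul]
  rw [integral_add (hf.integrable_mul hφ) (hg.integrable_mul hφ),
    integral_add (integrable_mul_test hK hφ) (integrable_mul_test hL hφ), h φ hφ, h' φ hφ]

/-- `ℱ⁻¹ 1` is the point mass at zero: by inversion the integral of `ℱ⁻¹ φ` is `φ 0`, which
vanishes. -/
lemma one : RepOffZero (fun _ => 1) 0 := by
  intro φ hφ
  have := lineFourier_invFourierLine_test hφ 0
  simp only [lineFourier, hφ.apply_zero] at this
  simpa using this

/-- Multiplication by `iξ` corresponds to differentiation. -/
lemma id_mul (hK : ContDiffOn ℝ ∞ K {0}ᶜ) (h : RepOffZero f K) :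
    RepOffZero (fun t : ℝ => Complex.I * t * f t) (deriv K) := by
  intro φ hφ
  have h1 := h _ hφ.deriv
  have e : ∀ ξ : ℝ, f ξ * invFourierLine (deriv φ) ξ =
      -(Complex.I * ξ * f ξ * invFourierLine φ ξ) := fun ξ => by
    rw [hφ.invFourierLine_deriv]; ring
  simp only [e] at h1
  rw [integral_neg] at h1
  have hKd : ∀ z ∈ ({0} : Set ℝ)ᶜ, HasDerivAt K (deriv K z) z := fun z hz =>
    ((hK.differentiableOn (by simp) z hz).differentiableAt
      (isOpen_compl_singleton.mem_nhds hz)).hasDerivAt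
  have hdK : ContinuousOn (deriv K) {0}ᶜ :=
    hK.continuousOn_deriv_of_isOpen isOpen_compl_singleton (by simp)
  have h2 := integral_mul_deriv_eq_deriv_mul_of_integrable (u := K) (v := φ)
    (fun z hz => hKd z (hφ.tsupport_subset hz))
    (fun z _ => hφ.hasDerivAt z)
    (integrable_mul_test hK.continuousOn hφ.deriv) (integrable_mul_test hdK hφ)
    (integrable_mul_test hK.continuousOn hφ)
  rw [h2] at h1
  exact neg_injective h1

/-- `ℱ⁻¹` of a derivative and of the function itself, tested against `ψ` and `-izψ`. -/
lemma integral_deriv_mul_invFourierLine {f' φ : ℝ → ℂ} (hd : ∀ t, HasDerivAt f (f' t) t)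
    (hf : PolyGrowth f) (hf' : PolyGrowth f') (hφ : IsTestOffZero φ) :
    ∫ ξ, f' ξ * invFourierLine φ ξ =
      -∫ ξ, f ξ * invFourierLine (fun z : ℝ => Complex.I * z * φ z) ξ := by
  rw [eq_neg_iff_add_eq_zero, add_comm, ← eq_neg_iff_add_eq_zero]
  exact integral_mul_deriv_eq_deriv_mul_of_integrable (fun t _ => hd t)
    (fun t _ => hφ.hasDerivAt_invFourierLine t)
    (hf.integrable_mul (hφ.mul IsTestOffZero.contDiffOn_I_mul))
    (hf'.integrable_mul hφ) (hf.integrable_mul hφ)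

/-- Differentiation corresponds to multiplication by `-iz`. -/
lemma deriv_left {f' : ℝ → ℂ} (hd : ∀ t, HasDerivAt f (f' t) t)
    (hf : PolyGrowth f) (hf' : PolyGrowth f') (h : RepOffZero f K) :
    RepOffZero f' (fun z : ℝ => -Complex.I * z * K z) := by
  intro φ hφ
  rw [integral_deriv_mul_invFourierLine hd hf hf' hφ,
    h _ (hφ.mul IsTestOffZero.contDiffOn_I_mul), ← integral_neg]
  congr 1; funext z; ring

/-- Testing against `φ` divided by `-iz` inverts `deriv_left`. In this way a kernel for a symbol is
obtained from the kernel of an integrable derivative of it. -/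
lemma of_deriv {f' : ℝ → ℂ} (hd : ∀ t, HasDerivAt f (f' t) t)
    (hf : PolyGrowth f) (hf' : PolyGrowth f') (h : RepOffZero f' K) :
    RepOffZero f (fun z : ℝ => (-Complex.I * z)⁻¹ * K z) := by
  intro φ hφ
  have hinv : ContDiffOn ℝ ∞ (fun z : ℝ => (-Complex.I * z)⁻¹) {0}ᶜ := by
    refine ContDiffOn.inv (contDiff_const.mul Complex.ofRealCLM.contDiff).contDiffOn ?_
    intro z hz
    simpa using hz
  have hψ := hφ.mul hinv
  -- At `z = 0` the default value of the inverse does no harm, because `φ 0 = 0`.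
  have e : (fun z : ℝ => Complex.I * z * ((-Complex.I * z)⁻¹ * φ z)) = fun z => (-1) * φ z := by
    funext z
    by_cases hz : z = 0
    · simp [hz, hφ.apply_zero]
    · have : (z : ℂ) ≠ 0 := by exact_mod_cast hz
      have := Complex.I_ne_zero
      field_simp
  have h1 := integral_deriv_mul_invFourierLine hd hf hf' hψ
  rw [e] at h1
  simp only [invFourierLine_const_mul] at h1
  rw [h _ hψ] at h1
  simp only [neg_mul, one_mul, mul_neg, integral_neg, neg_neg] at h1
  rw [← h1]
  congr 1; funext z; simp only [neg_mul]; ring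

/-- The kernel is determined off zero. -/
lemma eqOn (hK : ContinuousOn K {0}ᶜ) (hL : ContinuousOn L {0}ᶜ) (h : RepOffZero f K)
    (h' : RepOffZero f L) : Set.EqOn K L {0}ᶜ := by
  have hsub : ContinuousOn (fun z => K z - L z) {0}ᶜ := hK.sub hL
  have hae := IsOpen.ae_eq_zero_of_integral_contDiff_smul_eq_zero (μ := volume)
    (U := ({0} : Set ℝ)ᶜ) isOpen_compl_singleton (f := fun z => K z - L z)
    (hsub.locallyIntegrableOn isOpen_compl_singleton.measurableSet)
    (by
      intro g hg hg1 hg2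
      have hsupp : tsupport (fun z => (g z : ℂ)) ⊆ tsupport g := by
        refine closure_mono fun z hz => ?_
        simpa using hz
      have hφ : IsTestOffZero fun z => (g z : ℂ) :=
        ⟨Complex.ofRealCLM.contDiff.comp hg, hg1.comp_left (g := Complex.ofReal) (by simp),
          hsupp.trans hg2⟩
      have e : ∀ z, g z • (K z - L z) = K z * (g z : ℂ) - L z * (g z : ℂ) := fun z => by
        rw [Complex.real_smul]; ring
      simp only [e]
      rw [integral_sub (integrable_mul_test hK hφ) (integrable_mul_test hL hφ),
        ← h _ hφ, ← h' _ hφ, sub_self])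
  have hae' : (fun z => K z - L z) =ᵐ[volume.restrict ({0} : Set ℝ)ᶜ] fun _ => 0 := by
    rw [EventuallyEq, ae_restrict_iff' isOpen_compl_singleton.measurableSet]
    exact hae
  have := Measure.eqOn_open_of_ae_eq hae' isOpen_compl_singleton hsub continuousOn_const
  intro z hz
  exact sub_eq_zero.1 (this hz)

end RepOffZero

end OffZero

end

noncomputable section

/-! ### Symbols on the line and smoothness of their kernels off zero. -/

section LineSymbol

open MeasureTheory Filter Topology

/-- `f 0` is a symbol of order `d` on the line and `f r` is its `r`-th derivative. -/
structure IsLineSymbol (d : ℝ) (f : ℕ → ℝ → ℂ) : Prop where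
  hasDerivAt : ∀ r t, HasDerivAt (f r) (f (r + 1) t) t
  bound : ∀ r : ℕ, ∃ C : ℝ, ∀ t : ℝ, ‖f r t‖ ≤ C * (1 + |t|) ^ (d - r)

namespace IsLineSymbol

variable {d : ℝ} {f : ℕ → ℝ → ℂ}

lemma continuous (hf : IsLineSymbol d f) (r : ℕ) : Continuous (f r) :=
  continuous_iff_continuousAt.2 fun t => (hf.hasDerivAt r t).continuousAt

lemma polyGrowth (hf : IsLineSymbol d f) (r : ℕ) : PolyGrowth (f r) := by
  obtain ⟨C, hC⟩ := hf.bound r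
  refine ⟨hf.continuous r, C, ⌈d⌉₊, fun t => (hC t).trans ?_⟩
  have h0 : 0 ≤ C := by simpa using (norm_nonneg _).trans (hC 0)
  rw [← Real.rpow_natCast]
  have := Nat.le_ceil d
  gcongr
  · linarith [abs_nonneg t]
  · have : (0 : ℝ) ≤ r := r.cast_nonneg
    linarith

lemma integrable_pow_mul (hf : IsLineSymbol d f) {r m : ℕ} (h : d - r + m ≤ -2) :
    Integrable fun t : ℝ => (t : ℂ) ^ m * f r t := by
  obtain ⟨C, hC⟩ := hf.bound r
  have h0 : 0 ≤ C := by simpa using (norm_nonneg _).trans (hC 0)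
  refine integrable_of_norm_le_inv_one_add_sq (C := C)
    ((by fun_prop : Continuous fun t : ℝ => (t : ℂ) ^ m).mul
      (hf.continuous r)).aestronglyMeasurable (Eventually.of_forall fun t => ?_)
  have h1 : 1 ≤ 1 + |t| := by linarith [abs_nonneg t]
  have h2 : (1 + |t|) ^ m * (1 + |t|) ^ (d - r) ≤ (1 + t ^ 2)⁻¹ := by
    rw [← Real.rpow_natCast, ← Real.rpow_add (by linarith)]
    calc (1 + |t|) ^ ((m : ℝ) + (d - r)) ≤ (1 + |t|) ^ (-2 : ℝ) :=
          Real.rpow_le_rpow_of_exponent_le h1 (by linarith)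
      _ = ((1 + |t|) ^ 2)⁻¹ := by rw [Real.rpow_neg (by linarith)]; norm_cast
      _ ≤ _ := by
        refine inv_anti₀ (by positivity) ?_
        rw [← sq_abs]; nlinarith [abs_nonneg t]
  calc ‖(t : ℂ) ^ m * f r t‖ = |t| ^ m * ‖f r t‖ := by
        rw [norm_mul, norm_pow, Complex.norm_real, Real.norm_eq_abs]
    _ ≤ (1 + |t|) ^ m * (C * (1 + |t|) ^ (d - r)) := by
        gcongr
        · linarith
        · exact hC t
    _ = C * ((1 + |t|) ^ m * (1 + |t|) ^ (d - r)) := by ring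
    _ ≤ _ := by gcongr

lemma integrable (hf : IsLineSymbol d f) {r : ℕ} (h : d - r ≤ -2) : Integrable (f r) := by
  simpa using hf.integrable_pow_mul (m := 0) (by simpa using h)

lemma invFourierLine_succ (hf : IsLineSymbol d f) {r : ℕ} (h : d - r ≤ -2) (z : ℝ) :
    invFourierLine (f (r + 1)) z = -Complex.I * z * invFourierLine (f r) z :=
  invFourierLine_deriv (hf.hasDerivAt r) (hf.integrable h)
    (hf.integrable (by push_cast; linarith)) z

/-- Integrability of `t ^ n * f r t` for `n ≤ m` allows `m` differentiations under the integral. -/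
lemma contDiff_invFourierLine (hf : IsLineSymbol d f) {r m : ℕ} (h : d - r + m ≤ -2) :
    ContDiff ℝ m (invFourierLine (f r)) := by
  have e : invFourierLine (f r) = fun ξ => ((2 * Real.pi : ℝ) : ℂ)⁻¹ *
      FourierTransform.fourier (f r) (-(ξ / (2 * Real.pi))) := by
    funext ξ
    rw [invFourierLine_eq_fourierInv, Real.fourierInv_eq_fourier_neg]
  rw [e]
  refine contDiff_const.mul (ContDiff.comp (g := FourierTransform.fourier (f r))
    ?_ (by fun_prop))
  refine Real.contDiff_fourier (N := m) fun n hn => ?_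
  have hn' : (n : ℝ) ≤ m := by exact_mod_cast hn
  have := (hf.integrable_pow_mul (r := r) (m := n) (by linarith)).norm
  simpa using this

lemma repOffZero_of_add (hf : IsLineSymbol d f) (n r : ℕ) {L : ℝ → ℂ}
    (h : RepOffZero (f (r + n)) L) :
    RepOffZero (f r) fun z : ℝ => ((-Complex.I * z) ^ n)⁻¹ * L z := by
  induction n generalizing L with
  | zero => simpa using h
  | succ n ih =>
    have := ih (RepOffZero.of_deriv (hf.hasDerivAt (r + n)) (hf.polyGrowth _)
      (hf.polyGrowth _) h)
    convert this using 2 with z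
    rw [pow_succ, mul_inv, mul_assoc]

lemma repOffZero_add (hf : IsLineSymbol d f) (n r : ℕ) {L : ℝ → ℂ}
    (h : RepOffZero (f r) L) :
    RepOffZero (f (r + n)) fun z : ℝ => (-Complex.I * z) ^ n * L z := by
  induction n with
  | zero => simpa using h
  | succ n ih =>
    have := RepOffZero.deriv_left (hf.hasDerivAt (r + n)) (hf.polyGrowth _)
      (hf.polyGrowth _) ih
    simp only [← mul_assoc, ← pow_succ'] at this
    exact this

/-- The inverse Fourier transform of a symbol is smooth off zero. -/
theorem exists_isInvFourierOffZero (hf : IsLineSymbol d f) :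
    ∃ K : ℝ → ℂ, IsInvFourierOffZero (f 0) K := by
  -- The `N`-th derivative has order at most `-2`, hence is integrable.
  obtain ⟨N, hN⟩ : ∃ N : ℕ, d + 2 ≤ N := exists_nat_ge _
  refine ⟨fun z : ℝ => ((-Complex.I * z) ^ N)⁻¹ * invFourierLine (f N) z,
    isInvFourierOffZero_iff.2 ⟨?_, ?_⟩⟩
  · refine contDiffOn_infty.2 fun m => ?_
    -- The kernel does not change when `N` is replaced by `N + m`, and in the latter form it is
    -- visibly of class `C^m` off zero.
    have key : ∀ n : ℕ, ∀ z : ℝ, invFourierLine (f (N + n)) z =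
        (-Complex.I * z) ^ n * invFourierLine (f N) z := by
      intro n
      induction n with
      | zero => simp
      | succ n ih =>
        intro z
        rw [← add_assoc, hf.invFourierLine_succ (by push_cast; linarith [n.cast_nonneg (α := ℝ)]),
          ih, pow_succ', ← mul_assoc]
    have hs : ContDiffOn ℝ m (fun z : ℝ => ((-Complex.I * z) ^ (N + m))⁻¹ *
        invFourierLine (f (N + m)) z) {0}ᶜ := by
      refine ContDiffOn.mul (ContDiffOn.inv ?_ ?_)
        (hf.contDiff_invFourierLine (by push_cast; linarith)).contDiffOn
      · exact ((contDiff_const.mul Complex.ofRealCLM.contDiff).pow _).contDiffOn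
      · intro z hz
        refine pow_ne_zero _ ?_
        simpa using hz
    refine hs.congr fun z hz => ?_
    have hz' : (-Complex.I * (z : ℂ)) ≠ 0 := by simpa using hz
    rw [key, pow_add, mul_inv, mul_assoc, inv_mul_cancel_left₀ (pow_ne_zero _ hz')]
  · have := hf.repOffZero_of_add N 0 (L := invFourierLine (f N))
      (by rw [zero_add]; exact RepOffZero.of_integrable (hf.integrable (by linarith)))
    exact this

end IsLineSymbol

/-! ### Derivatives of kernels against powers of the dual variable. -/

section Iterated

variable {f K : ℝ → ℂ}

lemma ContDiffOn.deriv_compl_zero (hK : ContDiffOn ℝ ∞ K {0}ᶜ) :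
    ContDiffOn ℝ ∞ (deriv K) {0}ᶜ :=
  ((contDiffOn_infty_iff_deriv_of_isOpen isOpen_compl_singleton).1 hK).2

lemma ContDiffOn.iteratedDeriv_compl_zero (hK : ContDiffOn ℝ ∞ K {0}ᶜ) (m : ℕ) :
    ContDiffOn ℝ ∞ (iteratedDeriv m K) {0}ᶜ := by
  induction m with
  | zero => simpa using hK
  | succ m ih => rw [iteratedDeriv_succ]; exact ih.deriv_compl_zero

lemma ContDiffOn.hasDerivAt_iteratedDeriv (hK : ContDiffOn ℝ ∞ K {0}ᶜ) (m : ℕ) {z : ℝ}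
    (hz : z ≠ 0) : HasDerivAt (iteratedDeriv m K) (iteratedDeriv (m + 1) K z) z := by
  rw [iteratedDeriv_succ]
  exact (((hK.iteratedDeriv_compl_zero m).differentiableOn (by simp) z hz).differentiableAt
    (isOpen_compl_singleton.mem_nhds hz)).hasDerivAt

lemma RepOffZero.pow_mul (hK : ContDiffOn ℝ ∞ K {0}ᶜ) (h : RepOffZero f K) (m : ℕ) :
    RepOffZero (fun t : ℝ => (t : ℂ) ^ m * f t)
      (fun z => (-Complex.I) ^ m * iteratedDeriv m K z) := by
  have key : RepOffZero (fun t : ℝ => (Complex.I * t) ^ m * f t) (iteratedDeriv m K) := by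
    induction m with
    | zero => simpa using h
    | succ m ih =>
      rw [iteratedDeriv_succ]
      convert ih.id_mul (hK.iteratedDeriv_compl_zero m) using 2 with t
      rw [pow_succ', mul_assoc]
  convert key.const_mul ((-Complex.I) ^ m) using 2 with t
  rw [← mul_assoc, ← mul_pow, ← mul_assoc]
  simp

/-- Derivatives of the point mass at zero: polynomials can be added to a function without changing
its kernel off zero. -/
lemma RepOffZero.pow (n : ℕ) : RepOffZero (fun t : ℝ => (t : ℂ) ^ n) (fun _ => 0) := by
  have := RepOffZero.one.pow_mul (K := 0) contDiffOn_const n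
  convert this using 2 with t z
  · simp
  · rw [show iteratedDeriv n (0 : ℝ → ℂ) = 0 from ?_]
    · simp
    · funext y
      exact iteratedDeriv_const_zero

/-- Leibniz' rule with a linear factor. For `m = 0` the truncated `m - 1` is immaterial, its
coefficient being `0`. -/
lemma iteratedDeriv_id_mul (hK : ContDiffOn ℝ ∞ K {0}ᶜ) (m : ℕ) :
    ∀ z : ℝ, z ≠ 0 → iteratedDeriv m (fun z : ℝ => (z : ℂ) * K z) z =
      z * iteratedDeriv m K z + m * iteratedDeriv (m - 1) K z := by
  induction m with
  | zero => intro z _; simp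
  | succ m ih =>
    intro z hz
    rw [iteratedDeriv_succ]
    have he : iteratedDeriv m (fun z : ℝ => (z : ℂ) * K z) =ᶠ[𝓝 z] fun z : ℝ =>
        z * iteratedDeriv m K z + m * iteratedDeriv (m - 1) K z := by
      filter_upwards [isOpen_compl_singleton.mem_nhds hz] with y hy using ih y hy
    rw [he.deriv_eq]
    have h0 : HasDerivAt (fun y : ℝ => (y : ℂ)) 1 z := Complex.ofRealCLM.hasDerivAt
    have h1 := h0.mul (hK.hasDerivAt_iteratedDeriv m hz)
    have h2 := (hK.hasDerivAt_iteratedDeriv (m - 1) hz).const_mul (m : ℂ)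
    refine (h1.add h2).deriv.trans ?_
    rcases m with _ | m
    · simp
      ring
    · simp only [Nat.add_sub_cancel]
      push_cast
      ring

end Iterated

/-! ### An explicit kernel for the leading `1/t` behaviour, and the resulting bound. -/

section ResolventKernel

/-- The function `i e^{-az} 1_{z > 0}`, whose Fourier transform is `(t - ia)⁻¹`. -/
def resolventKernel (a : ℝ) (z : ℝ) : ℂ :=
  Set.indicator (Set.Ioi 0) (fun z : ℝ => Complex.I * Complex.exp (-a * z)) z

lemma norm_resolventKernel_le {a : ℝ} (ha : 0 < a) (z : ℝ) : ‖resolventKernel a z‖ ≤ 1 := by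
  by_cases hz : z ∈ Set.Ioi (0 : ℝ)
  · rw [resolventKernel, Set.indicator_of_mem hz, norm_mul, Complex.norm_I, one_mul,
      Complex.norm_exp]
    simp only [Set.mem_Ioi] at hz
    simp
    positivity
  · simp [resolventKernel, Set.indicator_of_notMem hz]

lemma continuousOn_resolventKernel (a : ℝ) : ContinuousOn (resolventKernel a) {0}ᶜ := by
  intro z hz
  refine ContinuousAt.continuousWithinAt ?_
  rcases lt_or_gt_of_ne hz with h | h
  · refine (continuousAt_const (y := (0 : ℂ))).congr ?_
    filter_upwards [Iio_mem_nhds h] with y hy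
    simp [resolventKernel, not_lt.2 (le_of_lt (Set.mem_Iio.1 hy))]
  · refine (by fun_prop : ContinuousAt
      (fun z : ℝ => Complex.I * Complex.exp (-a * z)) z).congr ?_
    filter_upwards [Ioi_mem_nhds h] with y hy
    rw [resolventKernel, Set.indicator_of_mem hy]

lemma integrable_resolventKernel {a : ℝ} (ha : 0 < a) : Integrable (resolventKernel a) := by
  unfold resolventKernel
  refine (integrable_indicator_iff measurableSet_Ioi).2 ?_
  exact (integrableOn_exp_mul_complex_Ioi (a := (-a : ℂ)) (by simpa using ha) 0).const_mul _

lemma lineFourier_resolventKernel {a : ℝ} (ha : 0 < a) (t : ℝ) :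
    lineFourier (resolventKernel a) t = ((t : ℂ) - Complex.I * a)⁻¹ := by
  have e : ∀ z : ℝ, Complex.exp (-Complex.I * z * t) * resolventKernel a z =
      Set.indicator (Set.Ioi 0)
        (fun z : ℝ => Complex.I * Complex.exp ((-a - Complex.I * t) * z)) z := by
    intro z
    by_cases hz : z ∈ Set.Ioi (0 : ℝ)
    · rw [resolventKernel, Set.indicator_of_mem hz, Set.indicator_of_mem hz, mul_left_comm,
        ← Complex.exp_add]
      congr 2; ring
    · rw [resolventKernel, Set.indicator_of_notMem hz, Set.indicator_of_notMem hz, mul_zero]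
  have hre : ((-a : ℂ) - Complex.I * t).re < 0 := by simpa using ha
  have hne : ((-a : ℂ) - Complex.I * t) ≠ 0 := fun h => by rw [h] at hre; simp at hre
  have hne2 : ((t : ℂ) - Complex.I * a) ≠ 0 := fun h => by
    have := congrArg Complex.im h
    simp at this
    exact ha.ne' this
  simp only [lineFourier, e]
  rw [integral_indicator measurableSet_Ioi, integral_const_mul, integral_exp_mul_complex_Ioi hre]
  simp only [Complex.ofReal_zero, mul_zero, Complex.exp_zero]
  rw [← mul_eq_one_iff_eq_inv₀ hne2, mul_div_assoc', div_mul_eq_mul_div, div_eq_one_iff_eq hne]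
  linear_combination (a : ℂ) * Complex.I_mul_I

lemma integrable_poisson {a : ℝ} (ha : 0 < a) : Integrable fun t : ℝ => a / (a ^ 2 + t ^ 2) := by
  have h := (integrable_inv_one_add_sq.comp_div ha.ne').const_mul a⁻¹
  refine h.congr (Eventually.of_forall fun t => ?_)
  simp only
  field_simp

/-- The value is independent of `a`; with `a = ⟨ξ'⟩` this makes the kernel bounds uniform in `ξ'`.
-/
lemma integral_poisson {a : ℝ} (ha : 0 < a) : ∫ t : ℝ, a / (a ^ 2 + t ^ 2) = Real.pi := by
  have h := Measure.integral_comp_div (fun t : ℝ => (1 + t ^ 2)⁻¹) a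
  rw [integral_univ_inv_one_add_sq, abs_of_pos ha, smul_eq_mul] at h
  rw [← mul_right_inj' ha.ne', ← h, ← integral_const_mul]
  congr 1; funext t
  field_simp

/-- A kernel is bounded if its Fourier transform is, modulo polynomials, the sum of a multiple of
`(t - ia)⁻¹` and an integrable function. -/
lemma norm_kernel_le {F K Q : ℝ → ℂ} (hK : ContinuousOn K {0}ᶜ) (h : RepOffZero F K)
    {ι : Type*} (S : Finset ι) (c : ι → ℂ) (n : ι → ℕ) (s : ℂ) {a B : ℝ} (ha : 0 < a)
    (hF : ∀ t : ℝ, F t = ∑ i ∈ S, c i * (t : ℂ) ^ n i + s * ((t : ℂ) - Complex.I * a)⁻¹ + Q t)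
    (hFc : Continuous F)
    (hQ : ∀ t, ‖Q t‖ ≤ B * (a / (a ^ 2 + t ^ 2))) {z : ℝ} (hz : z ≠ 0) :
    ‖K z‖ ≤ ‖s‖ + B * Real.pi := by
  have hne2 : ∀ t : ℝ, ((t : ℂ) - Complex.I * a) ≠ 0 := fun t h => by
    have := congrArg Complex.im h
    simp at this
    exact ha.ne' this
  have hrc : Continuous fun t : ℝ => ((t : ℂ) - Complex.I * a)⁻¹ :=
    Continuous.inv₀ (by fun_prop) hne2
  have hQc : Continuous Q := by
    have : Q = fun t => F t - (∑ i ∈ S, c i * (t : ℂ) ^ n i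
        + s * ((t : ℂ) - Complex.I * a)⁻¹) := by
      funext t; rw [hF t]; ring
    rw [this]
    fun_prop
  have hB : 0 ≤ B := by
    have h1 := (norm_nonneg _).trans (hQ 0)
    refine nonneg_of_mul_nonneg_left h1 (by positivity)
  have hQi : Integrable Q := ((integrable_poisson ha).const_mul B).mono'
    hQc.aestronglyMeasurable (Eventually.of_forall hQ)
  have hQb : ∀ z, ‖invFourierLine Q z‖ ≤ B * Real.pi := fun z => by
    refine (norm_invFourierLine_le Q z).trans ?_
    rw [← integral_poisson ha, ← integral_const_mul]
    exact integral_mono_of_nonneg (Eventually.of_forall fun z => norm_nonneg _)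
      ((integrable_poisson ha).const_mul B) (Eventually.of_forall hQ)
  have hpoly : ∀ T : Finset ι, PolyGrowth (fun t : ℝ => ∑ i ∈ T, c i * (t : ℂ) ^ n i) ∧
      RepOffZero (fun t : ℝ => ∑ i ∈ T, c i * (t : ℂ) ^ n i) (fun _ => 0) := by
    intro T
    have hpg : ∀ i, PolyGrowth fun t : ℝ => c i * (t : ℂ) ^ n i := fun i => by
      simpa using (PolyGrowth.one.pow_mul (n i)).const_mul (c i)
    refine ⟨PolyGrowth.sum _ fun i _ => hpg i, ?_⟩
    classical
    induction T using Finset.induction_on with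
    | empty => intro φ _; simp
    | insert i T hi ih =>
      simp only [Finset.sum_insert hi]
      have := RepOffZero.add (hpg i) (PolyGrowth.sum T fun i _ => hpg i)
        continuousOn_const continuousOn_const ((RepOffZero.pow (n i)).const_mul (c i)) ih
      simpa using this
  have hres : RepOffZero (fun t : ℝ => s * ((t : ℂ) - Complex.I * a)⁻¹)
      (fun z => s * resolventKernel a z) := by
    have := (RepOffZero.lineFourier_of_integrable (integrable_resolventKernel ha)).const_mul s
    simpa only [lineFourier_resolventKernel ha] using this
  have hres_g : PolyGrowth (fun t : ℝ => s * ((t : ℂ) - Complex.I * a)⁻¹) := by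
    refine PolyGrowth.const_mul ⟨hrc, a⁻¹, 0, fun t => ?_⟩ s
    rw [norm_inv, pow_zero, mul_one]
    refine inv_anti₀ ha ?_
    have := Complex.abs_im_le_norm ((t : ℂ) - Complex.I * a)
    simpa [abs_of_pos ha] using this
  have hQg : PolyGrowth Q := by
    refine ⟨hQc, B * a⁻¹, 0, fun t => (hQ t).trans ?_⟩
    rw [pow_zero, mul_one]
    refine mul_le_mul_of_nonneg_left ?_ hB
    rw [div_le_iff₀ (by positivity)]
    have : a⁻¹ * (a ^ 2 + t ^ 2) = a + a⁻¹ * t ^ 2 := by field_simp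
    rw [this]
    have : 0 ≤ a⁻¹ * t ^ 2 := by positivity
    linarith
  have hck : ContinuousOn (fun z => s * resolventKernel a z) {0}ᶜ :=
    continuousOn_const.mul (continuousOn_resolventKernel a)
  have h1 := RepOffZero.add (hpoly S).1 hres_g continuousOn_const hck (hpoly S).2 hres
  have h2 := RepOffZero.add ((hpoly S).1.add hres_g) hQg
    (continuousOn_const.add hck) (continuous_invFourierLine hQi).continuousOn h1
    (RepOffZero.of_integrable hQi)
  rw [← funext hF] at h2
  -- The given kernel and the explicit sum both represent `F`, so they agree off zero, where the
  -- polynomial contributes nothing.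
  rw [h.eqOn hK ((continuousOn_const.add hck).add (continuous_invFourierLine hQi).continuousOn)
    h2 hz]
  simp only [Pi.add_apply, zero_add]
  refine (norm_add_le _ _).trans (add_le_add ?_ (hQb z))
  rw [norm_mul]
  exact mul_le_of_le_one_right (norm_nonneg _) (norm_resolventKernel_le ha z)

end ResolventKernel

end LineSymbol

end

noncomputable section

/-! ### From the expansion to the weighted kernel bounds. -/

section KernelBounds

open MeasureTheory Filter Topology

/-- Needed because the orders of the symbols may have either sign: comparability in both directions
covers both cases. -/
lemma rpow_le_of_comparable {x y c : ℝ} (hx : 0 < x) (hy : 0 < y) (hxy : x ≤ c * y)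
    (hyx : y ≤ c * x) (e : ℝ) : x ^ e ≤ c ^ |e| * y ^ e := by
  have hc : 0 < c := by
    by_contra h
    exact absurd (hx.trans_le hxy) (not_lt.2 (mul_nonpos_of_nonpos_of_nonneg (not_lt.1 h) hy.le))
  rcases le_total 0 e with he | he
  · rw [abs_of_nonneg he, ← Real.mul_rpow hc.le hy.le]
    exact Real.rpow_le_rpow hx.le hxy he
  · rw [abs_of_nonpos he]
    have h := Real.rpow_le_rpow_of_nonpos hy hyx he
    rw [Real.mul_rpow hc.le hx.le] at h
    rw [Real.rpow_neg hc.le]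
    rw [inv_mul_eq_div, le_div_iff₀ (Real.rpow_pos_of_pos hc _), mul_comm]
    exact h

section

variable {k : ℕ} (ξ : Euc k) (t : ℝ)

lemma japBracket_le_joinLast : japBracket ξ ≤ japBracket (joinLast ξ t) := by
  refine le_of_sq_le_sq ?_ (japBracket_pos _).le
  rw [japBracket_joinLast_sq]
  nlinarith [sq_nonneg t]

lemma abs_le_japBracket_joinLast : |t| ≤ japBracket (joinLast ξ t) := by
  refine le_of_sq_le_sq ?_ (japBracket_pos _).le
  rw [japBracket_joinLast_sq, sq_abs]
  nlinarith [sq_nonneg (japBracket ξ)]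

lemma japBracket_joinLast_le : japBracket (joinLast ξ t) ≤ japBracket ξ + |t| := by
  refine le_of_sq_le_sq ?_ (by have := japBracket_pos ξ; positivity)
  rw [japBracket_joinLast_sq, ← sq_abs t]
  nlinarith [mul_nonneg (japBracket_pos ξ).le (abs_nonneg t)]

end

variable {k : ℕ} {d : ℝ} {p : Euc (k + 1) × Euc (k + 1) → ℂ}

lemma japBracket_joinLast_rpow_le (ξ : Euc k) (e t : ℝ) :
    japBracket (joinLast ξ t) ^ e ≤ (2 * japBracket ξ) ^ |e| * (1 + |t|) ^ e := by
  have h1 := one_le_japBracket ξ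
  have h2 := japBracket_le_joinLast ξ t
  have h3 := abs_le_japBracket_joinLast ξ t
  have h4 := japBracket_joinLast_le ξ t
  have ht := abs_nonneg t
  refine rpow_le_of_comparable (japBracket_pos _) (by positivity) ?_ ?_ e
  · nlinarith
  · nlinarith

/-- The iterated normal derivatives of a slice of a symbol. -/
lemma IsSymbol.isLineSymbol_normalSlice (hp : IsSymbol d p) (α β : Fin (k + 1) → ℕ)
    (x ξ : Euc k) :
    IsLineSymbol (d - multiLength α) (fun r t =>
      Complex.I ^ r * normalSlice p (α + Pi.single (Fin.last k) r) β x ξ t) where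
  hasDerivAt r t := by
    refine ((hasDerivAt_normalSlice hp.1 _ β x ξ t).const_mul _).congr_deriv ?_
    rw [add_assoc, ← Pi.single_add, pow_succ]
    ring
  bound r := by
    obtain ⟨C, hC0, hC⟩ := hp.norm_normalSlice_le (α + Pi.single (Fin.last k) r) β
    refine ⟨C * (2 * japBracket ξ) ^ |d - multiLength α - r|, fun t => ?_⟩
    rw [norm_mul, norm_pow, Complex.norm_I, one_pow, one_mul, mul_assoc]
    refine (hC x ξ t).trans ?_
    rw [multiLength_add, multiLength_single]
    push_cast
    rw [← sub_sub]
    gcongr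
    exact japBracket_joinLast_rpow_le _ _ _

lemma IsSymbol.exists_isInvFourierOffZero (hp : IsSymbol d p) (α β : Fin (k + 1) → ℕ)
    (x ξ : Euc k) : ∃ K : ℝ → ℂ, IsInvFourierOffZero (normalSlice p α β x ξ) K := by
  obtain ⟨K, hK⟩ := (hp.isLineSymbol_normalSlice α β x ξ).exists_isInvFourierOffZero
  refine ⟨K, ?_⟩
  simpa using hK

lemma IsSymbol.polyGrowth_normalSlice (hp : IsSymbol d p) (α β : Fin (k + 1) → ℕ)
    (x ξ : Euc k) : PolyGrowth (normalSlice p α β x ξ) := by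
  have := (hp.isLineSymbol_normalSlice α β x ξ).polyGrowth 0
  simpa using this

/-- `D_{ξₙ}` becomes multiplication by `-z`; the factor `-i` in `D` cancels the `i` in `∂ = iD`. -/
lemma IsSymbol.isInvFourierOffZero_add_single (hp : IsSymbol d p) {α β : Fin (k + 1) → ℕ}
    {x ξ : Euc k} {K : ℝ → ℂ} (hK : IsInvFourierOffZero (normalSlice p α β x ξ) K) :
    IsInvFourierOffZero (normalSlice p (α + Pi.single (Fin.last k) 1) β x ξ)
      (fun z : ℝ => (-1) * ((z : ℂ) * K z)) := by
  rw [isInvFourierOffZero_iff] at hK ⊢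
  refine ⟨contDiffOn_const.mul (Complex.ofRealCLM.contDiff.contDiffOn.mul hK.1), ?_⟩
  have h := RepOffZero.deriv_left (fun t => hasDerivAt_normalSlice hp.1 α β x ξ t)
    (hp.polyGrowth_normalSlice α β x ξ)
    ((hp.polyGrowth_normalSlice (α + Pi.single (Fin.last k) 1) β x ξ).const_mul Complex.I) hK.2
  have h' := h.const_mul (-Complex.I)
  convert h' using 2 with t z
  · rw [← mul_assoc]; simp
  · linear_combination (-(z : ℂ) * K z) * Complex.I_mul_I

lemma IsSymbol.norm_le {n : ℕ} {r : ℝ} {s : Euc n × Euc n → ℂ} (hs : IsSymbol r s) :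
    ∃ C : ℝ, 0 ≤ C ∧ ∀ x ξ : Euc n, ‖s (x, ξ)‖ ≤ C * japBracket ξ ^ r := by
  obtain ⟨C, hC⟩ := hs.2 0 0
  have h : ∀ x ξ : Euc n, ‖s (x, ξ)‖ ≤ C * japBracket ξ ^ r := by
    intro x ξ
    have := hC x ξ
    simp only [Dx, Dxi, multiD_zero, multiLength_zero, Nat.cast_zero, sub_zero] at this
    rwa [Real.rpow_neg (japBracket_pos _).le,
      inv_mul_le_iff₀ (Real.rpow_pos_of_pos (japBracket_pos _) _), mul_comm] at this
  refine ⟨max C 0, le_max_right _ _, fun x ξ => (h x ξ).trans ?_⟩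
  have := Real.rpow_nonneg (japBracket_pos ξ).le r
  gcongr
  exact le_max_left _ _

/-- The bound on the derivatives of the kernel without weights, from the expansion. -/
lemma norm_iteratedDeriv_kernel_le (hp : IsSymbol d p) {α β : Fin (k + 1) → ℕ}
    {s : ℤ → Euc k × Euc k → ℂ} (hs : IsNormalExpansion d p α β s) (m : ℕ) :
    ∃ C : ℝ, ∀ (x ξ : Euc k) (K : ℝ → ℂ), IsInvFourierOffZero (normalSlice p α β x ξ) K →
      ∀ z : ℝ, z ≠ 0 →
        ‖iteratedDeriv m K z‖ ≤ C * japBracket ξ ^ (d + 1 - multiLength α + m) := by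
  set M : ℤ := ⌊d - multiLength α⌋ with hM
  set E : ℝ := d + 1 - multiLength α + m with hE
  -- The estimate for `m` controls the remainder where `t` is small compared with `⟨ξ'⟩`, the one
  -- for `m + 1` supplies the additional decay for large `t`.
  obtain ⟨C₁, hC₁⟩ := hs.2 m
  obtain ⟨C₂, hC₂⟩ := hs.2 (m + 1)
  -- `σ` is the coefficient of `t⁻¹` in the remainder for `m`: it is `s (-m-1)` if that index lies
  -- below the cut-off, and `0` if both sums are empty.
  obtain ⟨σ, C₃, hC₃0, hσ, hrec⟩ : ∃ (σ : Euc k → Euc k → ℂ) (C₃ : ℝ), 0 ≤ C₃ ∧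
      (∀ x ξ, ‖σ x ξ‖ ≤ C₃ * japBracket ξ ^ E) ∧
      ∀ x ξ (t : ℝ), ∑ j ∈ Finset.Icc (-((m + 1 : ℕ) : ℤ)) M,
          s j (x, ξ) * (t : ℂ) ^ (j + ((m + 1 : ℕ) : ℤ)) =
        t * ∑ j ∈ Finset.Icc (-(m : ℤ)) M, s j (x, ξ) * (t : ℂ) ^ (j + m) + σ x ξ := by
    have hpow : ∀ (j : ℤ) (t : ℝ), -(m : ℤ) ≤ j →
        (t : ℂ) ^ (j + ((m + 1 : ℕ) : ℤ)) = t * (t : ℂ) ^ (j + m) := by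
      intro j t hj
      obtain ⟨n, hn⟩ := Int.eq_ofNat_of_zero_le (show 0 ≤ j + m by linarith)
      rw [hn, show j + ((m + 1 : ℕ) : ℤ) = ((n + 1 : ℕ) : ℤ) by push_cast; linarith,
        zpow_natCast, zpow_natCast, pow_succ']
    by_cases hmM : -((m + 1 : ℕ) : ℤ) ≤ M
    · obtain ⟨C₃, h0, h⟩ := (hs.1 (-((m + 1 : ℕ) : ℤ)) (Int.le_floor.1 hmM)).norm_le
      refine ⟨fun x ξ => s (-((m + 1 : ℕ) : ℤ)) (x, ξ), C₃, h0, fun x ξ => ?_, ?_⟩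
      · refine (h x ξ).trans (le_of_eq ?_)
        rw [hE]; congr 2; push_cast; ring
      · intro x ξ t
        rw [Finset.mul_sum, ← Finset.insert_Icc_add_one_left_eq_Icc hmM, Finset.sum_insert (by simp)]
        have e : -((m + 1 : ℕ) : ℤ) + 1 = -(m : ℤ) := by push_cast; ring
        rw [e, add_comm]
        congr 1
        · refine Finset.sum_congr rfl fun j hj => ?_
          rw [hpow j t (Finset.mem_Icc.1 hj).1]; ring
        · simp
    · refine ⟨fun _ _ => 0, 0, le_rfl, fun x ξ => by simp, fun x ξ t => ?_⟩
      have h1 : Finset.Icc (-((m + 1 : ℕ) : ℤ)) M = ∅ := Finset.Icc_eq_empty hmM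
      have h2 : Finset.Icc (-(m : ℤ)) M = ∅ := Finset.Icc_eq_empty (by push_cast at hmM; omega)
      rw [h1, h2]; simp
  have hJ : ∀ (x ξ : Euc k) (t : ℝ), 0 ≤ C₁ * japBracket ξ ^ E * (japBracket (joinLast ξ t))⁻¹ :=
    fun x ξ t => (norm_nonneg _).trans (hC₁ x ξ t)
  refine ⟨C₃ + (C₁ + C₂ + 2 * C₃) * Real.pi, fun x ξ K hK z hz => ?_⟩
  rw [isInvFourierOffZero_iff] at hK
  set a := japBracket ξ with ha_def
  have ha : 0 < a := japBracket_pos ξ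
  have hpg := hp.polyGrowth_normalSlice α β x ξ
  -- The pole is placed at `i⟨ξ'⟩` so that `|t - ia|` is exactly `⟨ξ⟩`.
  have hnorm : ∀ t : ℝ, ‖(t : ℂ) - Complex.I * a‖ = japBracket (joinLast ξ t) := by
    intro t
    refine (sq_eq_sq₀ (norm_nonneg _) (japBracket_pos _).le).1 ?_
    rw [japBracket_joinLast_sq, ← Complex.normSq_eq_norm_sq, Complex.normSq_apply]
    simp
    ring
  have hne : ∀ t : ℝ, (t : ℂ) - Complex.I * a ≠ 0 := fun t h => by
    have := hnorm t
    rw [h, norm_zero] at this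
    exact (japBracket_pos _).ne this
  set R : ℝ → ℂ := fun t => (t : ℂ) ^ m * normalSlice p α β x ξ t
    - ∑ j ∈ Finset.Icc (-(m : ℤ)) M, s j (x, ξ) * (t : ℂ) ^ (j + m) with hR
  have hbound := norm_kernel_le (F := fun t : ℝ => (t : ℂ) ^ m * normalSlice p α β x ξ t)
    (K := fun z => (-Complex.I) ^ m * iteratedDeriv m K z)
    (Q := fun t => R t - σ x ξ * ((t : ℂ) - Complex.I * a)⁻¹)
    (continuousOn_const.mul (hK.1.iteratedDeriv_compl_zero m).continuousOn)
    (hK.2.pow_mul hK.1 m) (Finset.Icc (-(m : ℤ)) M) (fun j => s j (x, ξ))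
    (fun j => (j + m).toNat) (σ x ξ) ha (B := (C₁ + C₂ + 2 * C₃) * a ^ E)
    (by
      intro t
      have : ∑ j ∈ Finset.Icc (-(m : ℤ)) M, s j (x, ξ) * (t : ℂ) ^ (j + m).toNat =
          ∑ j ∈ Finset.Icc (-(m : ℤ)) M, s j (x, ξ) * (t : ℂ) ^ (j + m) := by
        refine Finset.sum_congr rfl fun j hj => ?_
        have : 0 ≤ j + m := by linarith [(Finset.mem_Icc.1 hj).1]
        rw [← zpow_natCast, Int.toNat_of_nonneg this]
      rw [this, hR]
      ring)
    (hpg.pow_mul m).1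
    (by
      intro t
      set J := japBracket (joinLast ξ t) with hJd
      have hJ0 : 0 < J := japBracket_pos _
      have hJsq : J ^ 2 = a ^ 2 + t ^ 2 := japBracket_joinLast_sq ξ t
      have hJle : J ≤ a + |t| := japBracket_joinLast_le ξ t
      have haE : 0 < a ^ E := Real.rpow_pos_of_pos ha _
      have haE1 : a ^ (E + 1) = a ^ E * a := Real.rpow_add_one ha.ne' E
      have hσr : ‖σ x ξ * ((t : ℂ) - Complex.I * a)⁻¹‖ ≤ C₃ * a ^ E * J⁻¹ := by
        rw [norm_mul, norm_inv, hnorm]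
        exact mul_le_mul_of_nonneg_right (hσ x ξ) (inv_nonneg.2 hJ0.le)
      have hQ1 : ‖R t - σ x ξ * ((t : ℂ) - Complex.I * a)⁻¹‖ ≤ (C₁ + C₃) * a ^ E * J⁻¹ := by
        refine (norm_sub_le _ _).trans ?_
        have := hC₁ x ξ t
        rw [add_mul, add_mul]
        exact add_le_add this hσr
      have hQ2 : |t| * ‖R t - σ x ξ * ((t : ℂ) - Complex.I * a)⁻¹‖
          ≤ (C₂ + C₃) * (a ^ E * a) * J⁻¹ := by
        -- Since `t/(t - ia) = 1 + ia/(t - ia)`, multiplication by `t` turns the corrected remainder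
        -- for `m` into the remainder for `m + 1`, up to a term of the right size.
        have e : (t : ℂ) * (R t - σ x ξ * ((t : ℂ) - Complex.I * a)⁻¹) =
            ((t : ℂ) ^ (m + 1) * normalSlice p α β x ξ t -
              ∑ j ∈ Finset.Icc (-((m + 1 : ℕ) : ℤ)) M,
                s j (x, ξ) * (t : ℂ) ^ (j + ((m + 1 : ℕ) : ℤ)))
            - Complex.I * a * (σ x ξ * ((t : ℂ) - Complex.I * a)⁻¹) := by
          rw [hrec, hR]
          have h1 : σ x ξ = ((t : ℂ) - Complex.I * a) *
            (σ x ξ * ((t : ℂ) - Complex.I * a)⁻¹) := by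
            field_simp [hne t]
          linear_combination h1
        have e2 : |t| * ‖R t - σ x ξ * ((t : ℂ) - Complex.I * a)⁻¹‖ =
            ‖(t : ℂ) * (R t - σ x ξ * ((t : ℂ) - Complex.I * a)⁻¹)‖ := by
          rw [norm_mul, Complex.norm_real, Real.norm_eq_abs]
        rw [e2, e, add_mul, add_mul]
        refine (norm_sub_le _ _).trans (add_le_add ?_ ?_)
        · have := hC₂ x ξ t
          rwa [show d + 1 - multiLength α + ((m + 1 : ℕ) : ℝ) = E + 1 by
            rw [hE]; push_cast; ring, haE1] at this
        · rw [norm_mul, norm_mul, Complex.norm_I, one_mul, Complex.norm_real,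
            Real.norm_of_nonneg ha.le]
          calc a * ‖σ x ξ * ((t : ℂ) - Complex.I * a)⁻¹‖ ≤ a * (C₃ * a ^ E * J⁻¹) := by gcongr
            _ = _ := by ring
      set q := ‖R t - σ x ξ * ((t : ℂ) - Complex.I * a)⁻¹‖ with hq
      have hq0 : 0 ≤ q := norm_nonneg _
      -- By `⟨ξ⟩ ≤ a + |t|`, the bounds for `a q` and `|t| q` add up to a bound for `⟨ξ⟩ q`;
      -- dividing by `⟨ξ⟩` leaves the Poisson majorant.
      have hJq : J * q ≤ (C₁ + C₂ + 2 * C₃) * (a ^ E * a) * J⁻¹ := by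
        calc J * q ≤ (a + |t|) * q := by gcongr
          _ = a * q + |t| * q := by ring
          _ ≤ a * ((C₁ + C₃) * a ^ E * J⁻¹) + (C₂ + C₃) * (a ^ E * a) * J⁻¹ := by gcongr
          _ = _ := by ring
      rw [← hJsq, mul_div_assoc', le_div_iff₀ (by positivity)]
      calc q * J ^ 2 = (J * q) * J := by ring
        _ ≤ ((C₁ + C₂ + 2 * C₃) * (a ^ E * a) * J⁻¹) * J := by gcongr
        _ = _ := by field_simp)
    hz
  rw [norm_mul, norm_pow, norm_neg, Complex.norm_I, one_pow, one_mul] at hbound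
  refine hbound.trans ?_
  have := hσ x ξ
  calc ‖σ x ξ‖ + (C₁ + C₂ + 2 * C₃) * a ^ E * Real.pi
      ≤ C₃ * a ^ E + (C₁ + C₂ + 2 * C₃) * a ^ E * Real.pi := by gcongr
    _ = _ := by ring

/-- Induction on `l` for all `α`, `m` together: `-zK` is the kernel for `α + e_n`, and commuting `z`
past `m` derivatives produces a term with `m - 1` derivatives. Both the longer multi-index and the
lost derivative lower the exponent of `⟨ξ'⟩` by one, as the extra factor `z` requires. -/
lemma norm_weighted_kernel_le (hp : IsSymbol d p)
    (hs : ∀ α β : Fin (k + 1) → ℕ, ∃ s : ℤ → Euc k × Euc k → ℂ, IsNormalExpansion d p α β s)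
    (l : ℕ) : ∀ (α β : Fin (k + 1) → ℕ) (m : ℕ),
    ∃ C : ℝ, ∀ (x ξ : Euc k) (K : ℝ → ℂ), IsInvFourierOffZero (normalSlice p α β x ξ) K →
      ∀ z : ℝ, z ≠ 0 →
        ‖(z : ℂ) ^ l * iteratedDeriv m K z‖
          ≤ C * japBracket ξ ^ (d + 1 - multiLength α - l + m) := by
  induction l with
  | zero =>
    intro α β m
    obtain ⟨s, hs⟩ := hs α β
    obtain ⟨C, hC⟩ := norm_iteratedDeriv_kernel_le hp hs m
    exact ⟨C, fun x ξ K hK z hz => by simpa using hC x ξ K hK z hz⟩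
  | succ l ih =>
    intro α β m
    obtain ⟨C₁, hC₁⟩ := ih (α + Pi.single (Fin.last k) 1) β m
    obtain ⟨C₂, hC₂⟩ := ih α β (m - 1)
    refine ⟨C₁ + m * C₂, fun x ξ K hK z hz => ?_⟩
    have hK' := isInvFourierOffZero_iff.1 hK
    have h1 := hC₁ x ξ _ (hp.isInvFourierOffZero_add_single hK) z hz
    have h2 := hC₂ x ξ K hK z hz
    rw [iteratedDeriv_const_mul_field, iteratedDeriv_id_mul hK'.1 m z hz] at h1
    have e : (z : ℂ) ^ (l + 1) * iteratedDeriv m K z =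
        -((z : ℂ) ^ l * ((-1) * (z * iteratedDeriv m K z + m * iteratedDeriv (m - 1) K z)))
          - m * ((z : ℂ) ^ l * iteratedDeriv (m - 1) K z) := by ring
    rw [e, add_mul]
    refine (norm_sub_le _ _).trans (add_le_add ?_ ?_)
    · rw [norm_neg]
      refine h1.trans (le_of_eq ?_)
      rw [multiLength_add, multiLength_single]
      congr 2; push_cast; ring
    · rw [norm_mul, Complex.norm_natCast, mul_assoc]
      -- For `m = 0` the bound `C₂` belongs to a meaningless `m - 1` and is multiplied by `0`.
      rcases m with _ | m
      · simp
      · refine mul_le_mul_of_nonneg_left (h2.trans (le_of_eq ?_)) (by positivity)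
        congr 2; push_cast; ring

theorem hasWeightedKernelBounds_of_expansion (hp : IsSymbol d p)
    (hs : ∀ α β : Fin (k + 1) → ℕ, ∃ s : ℤ → Euc k × Euc k → ℂ, IsNormalExpansion d p α β s) :
    HasWeightedKernelBounds d p := by
  intro α β l m
  obtain ⟨C, hC⟩ := norm_weighted_kernel_le hp hs l α β m
  refine ⟨C, fun x ξ => ?_⟩
  obtain ⟨K, hK⟩ := hp.exists_isInvFourierOffZero α β x ξ
  refine ⟨K, hK, fun z hz => ?_⟩
  rw [Real.rpow_neg (japBracket_pos _).le,
    inv_mul_le_iff₀ (Real.rpow_pos_of_pos (japBracket_pos _) _), mul_comm]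
  refine le_trans (le_of_eq ?_) (hC x ξ K hK z hz)
  rw [weightedD, norm_mul, norm_mul, norm_mul, norm_pow (-Complex.I), norm_neg, Complex.norm_I,
    one_pow, one_mul]

theorem HasWeightedKernelBounds.isSymbolUTTR (hp : IsSymbol d p)
    (h : HasWeightedKernelBounds d p) : IsSymbolUTTR d p := by
  refine ⟨hp, fun α β l m ξ => ?_⟩
  obtain ⟨C, hC⟩ := h α β l m
  refine ⟨C * japBracket ξ ^ (d + 1 - multiLength α - l + m), fun x => ?_⟩
  obtain ⟨K, hK, hb⟩ := hC x ξ
  refine ⟨K, hK, fun z hz => ?_⟩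
  have := hb z hz
  rwa [Real.rpow_neg (japBracket_pos _).le,
    inv_mul_le_iff₀ (Real.rpow_pos_of_pos (japBracket_pos _) _), mul_comm] at this

end KernelBounds

end

noncomputable section

/-! ### Expansion in powers of `t` of one-dimensional symbols. -/

section LineExpansion

open MeasureTheory Filter Topology

/-- The derivative of the remainder is the remainder of the shifted sequence, so the mean value
inequality on `[0, 1]` propagates the bound. The gain of `1/N!` is not needed. -/
lemma norm_sub_taylor_le (N : ℕ) (φ : ℕ → ℝ → ℂ) (hφ : ∀ r τ, HasDerivAt (φ r) (φ (r + 1) τ) τ)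
    {M : ℝ} (hM : ∀ τ ∈ Set.Icc (0 : ℝ) 1, ‖φ N τ‖ ≤ M) :
    ∀ τ ∈ Set.Icc (0 : ℝ) 1,
      ‖φ 0 τ - ∑ r ∈ Finset.range N, φ r 0 * ((τ : ℂ) ^ r / (r.factorial : ℂ))‖ ≤ M := by
  induction N generalizing φ with
  | zero => simpa using hM
  | succ N ih =>
    have ih' := ih (fun r => φ (r + 1)) (fun r τ => hφ (r + 1) τ) hM
    set ψ : ℝ → ℂ := fun τ => φ 0 τ -
      ∑ r ∈ Finset.range (N + 1), φ r 0 * ((τ : ℂ) ^ r / (r.factorial : ℂ)) with hψ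
    have hd : ∀ τ : ℝ, HasDerivAt ψ (φ 1 τ -
        ∑ r ∈ Finset.range N, φ (r + 1) 0 * ((τ : ℂ) ^ r / (r.factorial : ℂ))) τ := by
      intro τ
      have e : ψ = fun τ => φ 0 τ - (∑ r ∈ Finset.range N,
          φ (r + 1) 0 * ((τ : ℂ) ^ (r + 1) / ((r + 1).factorial : ℂ)) + φ 0 0) := by
        funext τ
        rw [hψ]
        simp only [Finset.sum_range_succ']
        simp
      rw [e]
      refine (hφ 0 τ).sub (HasDerivAt.add_const _ (HasDerivAt.fun_sum fun r _ => ?_))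
      refine HasDerivAt.const_mul _ ?_
      have h0 : HasDerivAt (fun y : ℝ => (y : ℂ)) 1 τ := Complex.ofRealCLM.hasDerivAt
      refine ((h0.pow (r + 1)).div_const _).congr_deriv ?_
      have h1 : (r.factorial : ℂ) ≠ 0 := by exact_mod_cast r.factorial_ne_zero
      have h2 : ((r : ℂ) + 1) ≠ 0 := by exact_mod_cast Nat.succ_ne_zero r
      rw [Nat.factorial_succ]
      push_cast
      field_simp
    intro τ hτ
    have h := Convex.norm_image_sub_le_of_norm_hasDerivWithin_le (s := Set.Icc (0 : ℝ) 1)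
      (fun τ _ => (hd τ).hasDerivWithinAt) ih' (convex_Icc 0 1)
      (Set.left_mem_Icc.2 zero_le_one) hτ
    have h0 : ψ 0 = 0 := by
      rw [hψ]
      simp only [Finset.sum_range_succ']
      simp
    rw [h0, sub_zero, sub_zero, Real.norm_eq_abs, abs_of_nonneg hτ.1] at h
    refine h.trans ?_
    have hM0 : 0 ≤ M := (norm_nonneg _).trans (hM τ hτ)
    exact mul_le_of_le_one_right hM0 hτ.2

lemma eq_taylor_of_deriv_eq_zero (N : ℕ) (h : ℕ → ℝ → ℂ)
    (hd : ∀ r τ, HasDerivAt (h r) (h (r + 1) τ) τ) (h0 : ∀ t, h N t = 0) (t : ℝ) :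
    h 0 t = ∑ r ∈ Finset.range N, h r 0 / (r.factorial : ℂ) * (t : ℂ) ^ r := by
  -- The estimate is applied along the segment `τ ↦ τt` with bound `M = 0`.
  have := norm_sub_taylor_le N (fun r τ => (t : ℂ) ^ r * h r (τ * t)) (M := 0)
    (fun r τ => by
      have h1 : HasDerivAt (fun τ : ℝ => τ * t) t τ := by
        simpa using (hasDerivAt_id τ).mul_const t
      refine (((hd r (τ * t)).scomp τ h1).const_mul ((t : ℂ) ^ r)).congr_deriv ?_
      rw [Complex.real_smul, pow_succ, mul_assoc])
    (fun τ _ => by simp [h0]) 1 (Set.right_mem_Icc.2 zero_le_one)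
  rw [norm_le_zero_iff, sub_eq_zero] at this
  simp only [pow_zero, one_mul, zero_mul] at this
  rw [this]
  refine Finset.sum_congr rfl fun r _ => ?_
  simp
  ring

/-- If a Laurent polynomial grows at most like `t ^ r`, its coefficients of order above `r`
vanish. -/
lemma coeff_eq_zero_of_growth {a b : ℤ} {c : ℤ → ℂ} {C r : ℝ}
    (h : ∀ t : ℝ, 1 ≤ t → ‖∑ j ∈ Finset.Icc a b, c j * (t : ℂ) ^ j‖ ≤ C * t ^ r) :
    ∀ j ∈ Finset.Icc a b, r < j → c j = 0 := by
  -- Induction on the length of the range, removing the top coefficient: after division by `t ^ b`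
  -- with `b > r`, all else tends to zero, and the growth bound persists for the shorter sum.
  obtain ⟨n, hn⟩ : ∃ n : ℕ, b < a + n := ⟨(b - a + 1).toNat, by omega⟩
  induction n generalizing b with
  | zero =>
    intro j hj
    have := Finset.mem_Icc.1 hj
    simp at hn
    omega
  | succ n ih =>
    intro j hj hrj
    have hj' := Finset.mem_Icc.1 hj
    have hab : a ≤ b := hj'.1.trans hj'.2
    have hrb : r < b := hrj.trans_le (by exact_mod_cast hj'.2)
    have hsplit : ∀ t : ℝ, ∑ j ∈ Finset.Icc a b, c j * (t : ℂ) ^ j =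
        c b * (t : ℂ) ^ b + ∑ j ∈ Finset.Icc a (b - 1), c j * (t : ℂ) ^ j := by
      intro t
      rw [← Finset.insert_Icc_sub_one_right_eq_Icc hab, Finset.sum_insert (by simp)]
    have hb0 : c b = 0 := by
      have hlim : Tendsto (fun t : ℝ => C * t ^ (-((b : ℝ) - r)) +
          ∑ j ∈ Finset.Icc a (b - 1), ‖c j‖ * t ^ (-((b : ℝ) - j))) atTop
          (𝓝 (C * 0 + ∑ j ∈ Finset.Icc a (b - 1), ‖c j‖ * 0)) := by
        refine ((tendsto_rpow_neg_atTop (by linarith)).const_mul C).add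
          (tendsto_finsetSum _ fun j hj => (tendsto_rpow_neg_atTop ?_).const_mul _)
        have := (Finset.mem_Icc.1 hj).2
        have : (j : ℝ) ≤ b - 1 := by exact_mod_cast this
        linarith
      simp only [mul_zero, Finset.sum_const_zero, add_zero] at hlim
      refine norm_le_zero_iff.1 (ge_of_tendsto hlim ?_)
      filter_upwards [eventually_ge_atTop (1 : ℝ)] with t ht
      have ht0 : 0 < t := by linarith
      have htb : 0 < t ^ (b : ℝ) := Real.rpow_pos_of_pos ht0 _
      have hz : ∀ j : ℤ, ‖(t : ℂ) ^ j‖ = t ^ (j : ℝ) := fun j => by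
        rw [norm_zpow, Complex.norm_real, Real.norm_of_nonneg ht0.le, Real.rpow_intCast]
      have h1 : ‖c b‖ * t ^ (b : ℝ) ≤
          C * t ^ r + ∑ j ∈ Finset.Icc a (b - 1), ‖c j‖ * t ^ (j : ℝ) := by
        have e : c b * (t : ℂ) ^ b = ∑ j ∈ Finset.Icc a b, c j * (t : ℂ) ^ j -
            ∑ j ∈ Finset.Icc a (b - 1), c j * (t : ℂ) ^ j := by rw [hsplit]; ring
        rw [← hz, ← norm_mul, e]
        refine (norm_sub_le _ _).trans (add_le_add (h t ht) (norm_sum_le_of_le _ fun j _ => ?_))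
        rw [norm_mul, hz]
      rw [← le_div_iff₀ htb] at h1
      refine h1.trans (le_of_eq ?_)
      rw [add_div, Finset.sum_div, mul_div_assoc, ← Real.rpow_sub ht0]
      congr 1
      · congr 2; ring
      · refine Finset.sum_congr rfl fun j _ => ?_
        rw [mul_div_assoc, ← Real.rpow_sub ht0]
        congr 2; ring
    rcases hj'.2.eq_or_lt with rfl | hlt
    · exact hb0
    · refine ih (b := b - 1) (fun t ht => ?_) (by push_cast at hn; omega) j
        (Finset.mem_Icc.2 ⟨hj'.1, by omega⟩) hrj
      have := h t ht
      rwa [hsplit, hb0, zero_mul, zero_add] at this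

lemma ae_ne_zero : ∀ᵐ z : ℝ, z ≠ 0 := by
  simp [ae_iff]

lemma aestronglyMeasurable_of_continuousOn_compl_zero {K : ℝ → ℂ} (hK : ContinuousOn K {0}ᶜ) :
    AEStronglyMeasurable K := by
  have h := hK.aestronglyMeasurable (μ := volume) isOpen_compl_singleton.measurableSet
  rwa [Measure.restrict_eq_self_of_ae_mem (by simpa using ae_ne_zero)] at h

/-- The Fourier transform of a function with a jump at zero. -/
lemma id_mul_lineFourier {κ κ' : ℝ → ℂ} {B B' : ℝ} (hd : ∀ z : ℝ, z ≠ 0 → HasDerivAt κ (κ' z) z)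
    (hκ'c : ContinuousOn κ' {0}ᶜ)
    (hκ : ∀ z : ℝ, z ≠ 0 → ‖κ z‖ ≤ B * (1 + z ^ 2)⁻¹)
    (hκ' : ∀ z : ℝ, z ≠ 0 → ‖κ' z‖ ≤ B' * (1 + z ^ 2)⁻¹) (t : ℝ) :
    Complex.I * t * lineFourier κ t = -(∫ z, κ' z) + lineFourier κ' t := by
  have hκc : ContinuousOn κ {0}ᶜ := fun z hz => (hd z hz).continuousAt.continuousWithinAt
  have hi : Integrable κ := integrable_of_norm_le_inv_one_add_sq
    (aestronglyMeasurable_of_continuousOn_compl_zero hκc)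
    (ae_ne_zero.mono fun z hz => hκ z hz)
  have hi' : Integrable κ' := integrable_of_norm_le_inv_one_add_sq
    (aestronglyMeasurable_of_continuousOn_compl_zero hκ'c)
    (ae_ne_zero.mono fun z hz => hκ' z hz)
  set e : ℝ → ℂ := fun z => Complex.exp (-Complex.I * z * t) with he
  have hec : Continuous e := by fun_prop
  have hed : ∀ z : ℝ, HasDerivAt e (-Complex.I * t * e z) z := fun z => by
    have h0 : HasDerivAt (fun y : ℝ => (y : ℂ)) 1 z := Complex.ofRealCLM.hasDerivAt
    refine (((h0.const_mul (-Complex.I)).mul_const (t : ℂ)).cexp).congr_deriv ?_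
    rw [he]; ring
  -- Subtracting `1` makes the product continuous at zero despite the jump of `κ`. Hence `w'` has
  -- integral zero over the line, and the subtracted part contributes the integral of `κ'`, which
  -- carries the jump.
  set w : ℝ → ℂ := fun z => (e z - 1) * κ z with hw
  set w' : ℝ → ℂ := fun z => -Complex.I * t * (e z * κ z) + (e z * κ' z - κ' z) with hw'
  have hwd : ∀ z : ℝ, z ≠ 0 → HasDerivAt w (w' z) z := fun z hz => by
    refine (((hed z).sub_const 1).mul (hd z hz)).congr_deriv ?_
    rw [hw']; ring
  have hie : Integrable fun z => e z * κ z := integrable_exp_neg_mul hi t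
  have hie' : Integrable fun z => e z * κ' z := integrable_exp_neg_mul hi' t
  have hwi : Integrable w' := (hie.const_mul _).add (hie'.sub hi')
  have hw0 : w 0 = 0 := by simp [hw, he]
  have hB : 0 ≤ B := by
    have := (norm_nonneg _).trans (hκ 1 one_ne_zero)
    norm_num at this
    linarith
  have hwcont : ContinuousAt w 0 := by
    rw [ContinuousAt, hw0]
    refine squeeze_zero_norm' (a := fun z => ‖e z - 1‖ * (B + ‖κ 0‖))
      (Eventually.of_forall fun z => ?_) ?_
    · rw [hw]
      simp only [norm_mul]
      refine mul_le_mul_of_nonneg_left ?_ (norm_nonneg _)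
      by_cases hz : z = 0
      · rw [hz]; linarith
      · refine (hκ z hz).trans ?_
        have : (1 + z ^ 2)⁻¹ ≤ 1 := inv_le_one_of_one_le₀ (by nlinarith [sq_nonneg z])
        nlinarith [norm_nonneg (κ 0)]
    · have : Tendsto (fun z => ‖e z - 1‖ * (B + ‖κ 0‖)) (𝓝 0) (𝓝 (‖e 0 - 1‖ * (B + ‖κ 0‖))) :=
        (by fun_prop : Continuous fun z => ‖e z - 1‖ * (B + ‖κ 0‖)).tendsto 0
      simpa [he] using this
  have hwb : ∀ z : ℝ, z ≠ 0 → ‖w z‖ ≤ 2 * B * (1 + z ^ 2)⁻¹ := fun z hz => by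
    rw [hw]
    simp only [norm_mul]
    have h1 : ‖e z - 1‖ ≤ 2 := by
      refine (norm_sub_le _ _).trans ?_
      rw [he]
      simp only [norm_exp_neg_I_mul_mul, norm_one]
      norm_num
    rw [mul_assoc]
    exact mul_le_mul h1 (hκ z hz) (norm_nonneg _) zero_le_two
  have hinf : ∀ l : Filter ℝ, Tendsto (fun z : ℝ => |z|) l atTop → Tendsto w l (𝓝 0) := by
    intro l hl
    have hq : Tendsto (fun z : ℝ => 1 + z ^ 2) l atTop := by
      refine tendsto_atTop_add_const_left _ _ ?_
      have := (tendsto_pow_atTop (α := ℝ) two_ne_zero).comp hl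
      refine this.congr fun z => ?_
      simp
    have h2 := (tendsto_inv_atTop_zero.comp hq).const_mul (2 * B)
    rw [mul_zero] at h2
    refine squeeze_zero_norm' ?_ h2
    filter_upwards [hl.eventually_ge_atTop 1] with z hz
    refine hwb z ?_
    rintro rfl
    norm_num at hz
  have h1 := integral_Ioi_of_hasDerivAt_of_tendsto (a := 0) hwcont.continuousWithinAt
    (fun z hz => hwd z (ne_of_gt hz)) hwi.integrableOn (hinf _ tendsto_abs_atTop_atTop)
  have h2 := integral_Iic_of_hasDerivAt_of_tendsto (a := 0) hwcont.continuousWithinAt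
    (fun z hz => hwd z (ne_of_lt hz)) hwi.integrableOn (hinf _ tendsto_abs_atBot_atTop)
  have h3 : ∫ z, w' z = 0 := by
    rw [← setIntegral_univ, ← Set.Iic_union_Ioi (a := (0 : ℝ)),
      setIntegral_union (Set.Iic_disjoint_Ioi le_rfl) measurableSet_Ioi hwi.integrableOn
      hwi.integrableOn, h1, h2, hw0]
    simp
  have h4 : ∫ z, w' z = -Complex.I * t * (∫ z, e z * κ z) +
      ((∫ z, e z * κ' z) - ∫ z, κ' z) := by
    rw [← integral_const_mul, ← integral_sub hie' hi']
    exact integral_add (hie.const_mul _) (hie'.sub hi')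
  rw [h3] at h4
  simp only [lineFourier]
  linear_combination h4

/-- Separates nonnegative powers from negative ones in the form of the two constructors of `ℤ`, by
which the coefficients are defined below. -/
lemma sum_Icc_neg_eq {E : Type*} [AddCommMonoid E] (F : ℤ → E) (m N : ℕ) :
    ∑ j ∈ Finset.Icc (-(m : ℤ)) ((N : ℤ) - 1), F j =
      ∑ r ∈ Finset.range N, F r + ∑ i ∈ Finset.range m, F (Int.negSucc i) := by
  induction m with
  | zero =>
    simp only [Nat.cast_zero, neg_zero, Finset.range_zero, Finset.sum_empty, add_zero]
    induction N with
    | zero => simp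
    | succ N ih =>
      rw [Finset.sum_range_succ, ← ih]
      have : (((N + 1 : ℕ) : ℤ) - 1) = N := by push_cast; ring
      rw [this, ← Finset.insert_Icc_sub_one_right_eq_Icc (by positivity),
        Finset.sum_insert (by simp), add_comm]
  | succ m ih =>
    rw [Finset.sum_range_succ, ← add_assoc, ← ih]
    have h : (-((m + 1 : ℕ) : ℤ)) ≤ (N : ℤ) - 1 := by push_cast; omega
    rw [← Finset.insert_Icc_add_one_left_eq_Icc h, Finset.sum_insert (by simp), add_comm]
    congr 2
    push_cast
    ring_nf

/-- Uniform expansion in powers of `t` of a family of symbols on the line whose kernels are rapidly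
decreasing and smooth up to zero from both sides. -/
theorem exists_line_expansion {X : Type*} {d : ℝ} (f : X → ℕ → ℝ → ℂ)
    (hf : ∀ x, IsLineSymbol d (f x))
    (hb : ∀ r : ℕ, ∃ C : ℝ, ∀ x t, ‖f x r t‖ ≤ C * (1 + |t|) ^ (d - r))
    (K : X → ℝ → ℂ) (hK : ∀ x, IsInvFourierOffZero (f x 0) (K x))
    (hKb : ∀ l m : ℕ, ∃ C : ℝ, ∀ x, ∀ z : ℝ, z ≠ 0 →
      ‖(z : ℂ) ^ l * iteratedDeriv m (K x) z‖ ≤ C) :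
    ∃ c : ℤ → X → ℂ, (∀ j, ∃ C : ℝ, ∀ x, ‖c j x‖ ≤ C) ∧ (∀ j : ℤ, d < j → ∀ x, c j x = 0) ∧
      ∀ m : ℕ, ∃ C : ℝ, ∀ x (t : ℝ),
        ‖(t : ℂ) ^ m * f x 0 t - ∑ j ∈ Finset.Icc (-(m : ℤ)) ⌊d⌋, c j x * (t : ℂ) ^ (j + m)‖
          ≤ C * (1 + |t|)⁻¹ := by
  have hKc : ∀ x, ContDiffOn ℝ ∞ (K x) {0}ᶜ := fun x => (hK x).1
  have hKr : ∀ x, RepOffZero (f x 0) (K x) := fun x => (isInvFourierOffZero_iff.1 (hK x)).2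
  have hdec : ∀ l m : ℕ, ∃ B : ℝ, ∀ x, ∀ z : ℝ, z ≠ 0 →
      ‖(z : ℂ) ^ l * iteratedDeriv m (K x) z‖ ≤ B * (1 + z ^ 2)⁻¹ := by
    intro l m
    obtain ⟨C₁, h₁⟩ := hKb l m
    -- Two more powers of `z` give integrability, with norms uniform in the parameter.
    obtain ⟨C₂, h₂⟩ := hKb (l + 2) m
    refine ⟨C₁ + C₂, fun x z hz => ?_⟩
    have h1 := h₁ x z hz
    have h2 := h₂ x z hz
    rw [← div_eq_mul_inv, le_div_iff₀ (by positivity), mul_add, mul_one]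
    refine add_le_add h1 (le_trans (le_of_eq ?_) h2)
    simp only [norm_mul, norm_pow, Complex.norm_real, Real.norm_eq_abs, pow_add, sq_abs]
    ring
  have hmeas : ∀ (l m : ℕ) x, AEStronglyMeasurable
      (fun z : ℝ => (z : ℂ) ^ l * iteratedDeriv m (K x) z) := fun l m x =>
    aestronglyMeasurable_of_continuousOn_compl_zero
      (((by fun_prop : Continuous fun z : ℝ => (z : ℂ) ^ l).continuousOn).mul
        ((hKc x).iteratedDeriv_compl_zero m).continuousOn)
  have hint : ∀ (l m : ℕ) x, Integrable (fun z : ℝ => (z : ℂ) ^ l * iteratedDeriv m (K x) z) := by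
    intro l m x
    obtain ⟨B, hB⟩ := hdec l m
    exact integrable_of_norm_le_inv_one_add_sq (hmeas l m x)
      (ae_ne_zero.mono fun z hz => hB x z hz)
  have hintnorm : ∀ l m : ℕ, ∃ B : ℝ, ∀ x,
      ∫ z : ℝ, ‖(z : ℂ) ^ l * iteratedDeriv m (K x) z‖ ≤ B := by
    intro l m
    obtain ⟨B, hB⟩ := hdec l m
    exact ⟨B * Real.pi, fun x => integral_norm_le_of_le_inv_one_add_sq
      (ae_ne_zero.mono fun z hz => hB x z hz)⟩
  obtain ⟨N, hN⟩ : ∃ N : ℕ, |d| + 2 ≤ N := exists_nat_ge _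
  have hN' : d - N ≤ -2 := by linarith [le_abs_self d]
  -- the regular part of `f` and its derivatives
  set g : X → ℕ → ℝ → ℂ := fun x r => lineFourier fun z : ℝ => (-Complex.I * z) ^ r * K x z with hg
  have hgi : ∀ x r, Integrable fun z : ℝ => (-Complex.I * z) ^ r * K x z := by
    intro x r
    have := (hint r 0 x).const_mul ((-Complex.I) ^ r)
    simpa only [iteratedDeriv_zero, mul_pow, mul_assoc] using this
  have hgd : ∀ x r t, HasDerivAt (g x r) (g x (r + 1) t) t := by
    intro x r t
    have := hasDerivAt_lineFourier (hgi x r) (by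
      have := (hgi x (r + 1)).const_mul Complex.I
      refine this.congr (Eventually.of_forall fun z => ?_)
      simp only [pow_succ]
      linear_combination (-(z : ℂ) * ((-Complex.I * z) ^ r * K x z)) * Complex.I_mul_I) t
    simp only [← mul_assoc, ← pow_succ'] at this
    exact this
  -- The inverse transform of the integrable function `f x N` is the continuous representative of
  -- `(-iz)^N K`. The two agree off zero, hence almost everywhere, and Fourier inversion identifies
  -- their transforms; distributions supported at zero have no room to appear.
  have hfgN : ∀ x t, f x N t - g x N t = 0 := by
    intro x t
    have hfi := (hf x).integrable hN'
    have hrep := (hf x).repOffZero_add N 0 (hKr x)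
    rw [zero_add] at hrep
    have heq := (RepOffZero.of_integrable hfi).eqOn
      (continuous_invFourierLine hfi).continuousOn
      (((by fun_prop : Continuous fun z : ℝ => (-Complex.I * (z : ℂ)) ^ N).continuousOn).mul
        (hKc x).continuousOn) hrep
    have hae : invFourierLine (f x N) =ᵐ[volume] fun z : ℝ => (-Complex.I * z) ^ N * K x z :=
      ae_ne_zero.mono fun z hz => heq hz
    rw [sub_eq_zero, ← lineFourier_invFourierLine ((hf x).continuous N) hfi
      ((hgi x N).congr hae.symm) t, hg]
    simp only [lineFourier]
    refine integral_congr_ae (hae.mono fun z hz => ?_)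
    simp only [hz]
  set A : X → ℕ → ℂ := fun x r => (f x r 0 - g x r 0) / (r.factorial : ℂ) with hA
  have hpoly : ∀ x t, f x 0 t = ∑ r ∈ Finset.range N, A x r * (t : ℂ) ^ r + g x 0 t := by
    intro x t
    have := eq_taylor_of_deriv_eq_zero N (fun r t => f x r t - g x r t)
      (fun r t => ((hf x).hasDerivAt r t).sub (hgd x r t)) (hfgN x) t
    rw [← this]
    ring
  have hAb : ∀ r, ∃ C : ℝ, ∀ x, ‖A x r‖ ≤ C := by
    intro r
    obtain ⟨C, hC⟩ := hb r
    obtain ⟨B, hB⟩ := hintnorm r 0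
    refine ⟨(C + B) / (r.factorial : ℝ), fun x => ?_⟩
    rw [hA]
    simp only [norm_div, Complex.norm_natCast]
    gcongr
    refine (norm_sub_le _ _).trans (add_le_add (by simpa using hC x 0) ?_)
    refine (norm_lineFourier_le _ _).trans (le_trans (le_of_eq ?_) (hB x))
    congr 1; funext z
    simp
  -- the jumps of the kernel at zero
  set κ : X → ℕ → ℝ → ℂ := fun x m => lineFourier (iteratedDeriv m (K x)) with hκ
  -- The jump of the `m`-th derivative of `K x` at zero, written as an integral so that one-sided
  -- limits need not be constructed.
  set J : X → ℕ → ℂ := fun x m => -∫ z, iteratedDeriv (m + 1) (K x) z with hJ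
  have hjump : ∀ x m (t : ℝ), Complex.I * t * κ x m t = J x m + κ x (m + 1) t := by
    intro x m t
    obtain ⟨B, hB⟩ := hdec 0 m
    obtain ⟨B', hB'⟩ := hdec 0 (m + 1)
    exact id_mul_lineFourier (fun z hz => (hKc x).hasDerivAt_iteratedDeriv m hz)
      ((hKc x).iteratedDeriv_compl_zero (m + 1)).continuousOn
      (fun z hz => by simpa using hB x z hz) (fun z hz => by simpa using hB' x z hz) t
  have hJb : ∀ m, ∃ C : ℝ, ∀ x, ‖J x m‖ ≤ C := by
    intro m
    obtain ⟨B, hB⟩ := hintnorm 0 (m + 1)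
    refine ⟨B, fun x => ?_⟩
    rw [hJ]
    simp only [norm_neg]
    refine (norm_integral_le_integral_norm _).trans ?_
    simpa using hB x
  have hκb : ∀ m, ∃ C : ℝ, ∀ x (t : ℝ), ‖κ x m t‖ ≤ C * (1 + |t|)⁻¹ := by
    intro m
    obtain ⟨B, hB⟩ := hintnorm 0 m
    obtain ⟨B', hB'⟩ := hintnorm 0 (m + 1)
    obtain ⟨C, hC⟩ := hJb m
    refine ⟨B + (C + B'), fun x t => ?_⟩
    rw [← div_eq_mul_inv, le_div_iff₀ (by positivity), mul_add, mul_one]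
    refine add_le_add ((norm_lineFourier_le _ _).trans (by simpa using hB x)) ?_
    have e : ‖κ x m t‖ * |t| = ‖Complex.I * t * κ x m t‖ := by
      simp [mul_comm]
    rw [e, hjump]
    refine (norm_add_le _ _).trans (add_le_add (hC x) ?_)
    exact (norm_lineFourier_le _ _).trans (by simpa using hB' x)
  -- Iteration of `hjump`: each factor `t` releases one jump and passes to the next derivative.
  have hκexp : ∀ x (m : ℕ) (t : ℝ), (t : ℂ) ^ m * κ x 0 t =
      ∑ i ∈ Finset.range m, (-Complex.I) ^ (i + 1) * J x i * (t : ℂ) ^ (m - 1 - i)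
        + (-Complex.I) ^ m * κ x m t := by
    intro x m t
    induction m with
    | zero => simp
    | succ m ih =>
      rw [pow_succ', mul_assoc, ih, Finset.sum_range_succ, mul_add, Finset.mul_sum]
      have e : ∀ i ∈ Finset.range m, (t : ℂ) * ((-Complex.I) ^ (i + 1) * J x i *
          (t : ℂ) ^ (m - 1 - i)) = (-Complex.I) ^ (i + 1) * J x i * (t : ℂ) ^ (m + 1 - 1 - i) := by
        intro i hi
        have : m + 1 - 1 - i = (m - 1 - i) + 1 := by
          have := Finset.mem_range.1 hi
          omega
        rw [this, pow_succ]
        ring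
      rw [Finset.sum_congr rfl e, add_assoc]
      congr 1
      simp only [Nat.add_sub_cancel, Nat.sub_self, pow_zero, mul_one]
      linear_combination (-(-Complex.I) ^ (m + 1)) * (- hjump x m t) +
        (t : ℂ) * (-Complex.I) ^ m * κ x m t * Complex.I_mul_I
  -- Nonnegative powers come from the polynomial difference, negative ones from the jumps;
  -- `Int.negSucc i` is the exponent `-i-1`.
  set c : ℤ → X → ℂ := fun j x => match j with
    | Int.ofNat r => A x r
    | Int.negSucc i => (-Complex.I) ^ (i + 1) * J x i with hc
  have hcb : ∀ j, ∃ C : ℝ, ∀ x, ‖c j x‖ ≤ C := by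
    intro j
    match j with
    | Int.ofNat r => exact hAb r
    | Int.negSucc i =>
      obtain ⟨C, hC⟩ := hJb i
      exact ⟨C, fun x => by simpa [hc] using hC x⟩
  have hg0 : ∀ x t, g x 0 t = κ x 0 t := by
    intro x t
    simp [hg, hκ]
  have hexp : ∀ x (m : ℕ) (t : ℝ), (t : ℂ) ^ m * f x 0 t =
      ∑ j ∈ Finset.Icc (-(m : ℤ)) ((N : ℤ) - 1), c j x * (t : ℂ) ^ (j + m)
        + (-Complex.I) ^ m * κ x m t := by
    intro x m t
    rw [hpoly, hg0, mul_add, hκexp, sum_Icc_neg_eq, Finset.mul_sum, add_assoc]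
    congr 1
    · refine Finset.sum_congr rfl fun r _ => ?_
      rw [← Nat.cast_add, zpow_natCast, pow_add]
      change _ = A x r * _
      ring
    · congr 1
      refine Finset.sum_congr rfl fun i hi => ?_
      have hi' := Finset.mem_range.1 hi
      rw [show Int.negSucc i + (m : ℤ) = ((m - 1 - i : ℕ) : ℤ) by
        rw [Int.negSucc_eq]; omega, zpow_natCast]
  -- The sum is `f`, of growth `t ^ d`, up to an error `t ^ (-m-1)`. With `m = |j|` the index `j`
  -- lies in the range of summation and above the error.
  have hc0 : ∀ j : ℤ, d < j → j ≤ (N : ℤ) - 1 → ∀ x, c j x = 0 := by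
    intro j hj hjN x
    obtain ⟨C, hC⟩ := hb 0
    set m : ℕ := j.natAbs with hm
    obtain ⟨C', hC'⟩ := hκb m
    have hmj : -(m : ℤ) ≤ j := by omega
    have hC0 : 0 ≤ C := by simpa using (norm_nonneg _).trans (hC x 0)
    have hC0' : 0 ≤ C' := by simpa using (norm_nonneg _).trans (hC' x 0)
    refine coeff_eq_zero_of_growth (a := -(m : ℤ)) (b := (N : ℤ) - 1) (c := fun j => c j x)
      (C := C * 2 ^ |d| + C') (r := max d (-m - 1)) ?_ j
      (Finset.mem_Icc.2 ⟨hmj, hjN⟩) (max_lt hj ?_)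
    · intro t ht
      have ht0 : 0 < t := by linarith
      have htC : (t : ℂ) ≠ 0 := by exact_mod_cast ht0.ne'
      have hsum : ∑ j ∈ Finset.Icc (-(m : ℤ)) ((N : ℤ) - 1), c j x * (t : ℂ) ^ j =
          f x 0 t - ((t : ℂ) ^ m)⁻¹ * ((-Complex.I) ^ m * κ x m t) := by
        have h1 := hexp x m t
        have h2 : ∑ j ∈ Finset.Icc (-(m : ℤ)) ((N : ℤ) - 1), c j x * (t : ℂ) ^ (j + m) =
            (t : ℂ) ^ m * ∑ j ∈ Finset.Icc (-(m : ℤ)) ((N : ℤ) - 1), c j x * (t : ℂ) ^ j := by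
          rw [Finset.mul_sum]
          refine Finset.sum_congr rfl fun j _ => ?_
          rw [zpow_add₀ htC, zpow_natCast]
          ring
        rw [h2] at h1
        have h3 : (t : ℂ) ^ m ≠ 0 := pow_ne_zero _ htC
        field_simp
        linear_combination -h1
      rw [hsum]
      refine (norm_sub_le _ _).trans ?_
      rw [add_mul]
      refine add_le_add ?_ ?_
      · refine (hC x t).trans ?_
        rw [mul_assoc]
        refine mul_le_mul_of_nonneg_left ?_ hC0
        rw [Nat.cast_zero, sub_zero, abs_of_pos ht0]
        refine (rpow_le_of_comparable (c := 2) (by linarith) ht0 (by linarith)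
          (by linarith) d).trans ?_
        gcongr
        exact le_max_left _ _
      · rw [norm_mul, norm_inv, norm_pow, Complex.norm_real, Real.norm_of_nonneg ht0.le, norm_mul,
          norm_pow, norm_neg, Complex.norm_I, one_pow, one_mul]
        have h1 : (1 + |t|)⁻¹ ≤ t⁻¹ := inv_anti₀ ht0 (by rw [abs_of_pos ht0]; linarith)
        calc (t ^ m)⁻¹ * ‖κ x m t‖ ≤ (t ^ m)⁻¹ * (C' * t⁻¹) := by
              gcongr
              exact (hC' x t).trans (by gcongr)
          _ = C' * t ^ (-m - 1 : ℝ) := by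
              rw [Real.rpow_sub ht0, Real.rpow_neg ht0.le, Real.rpow_natCast, Real.rpow_one]
              ring
          _ ≤ _ := by
              gcongr
              exact le_max_right _ _
    · have : (-(m : ℤ) - 1 : ℤ) < j := by omega
      exact_mod_cast this
  have hfl : ⌊d⌋ ≤ (N : ℤ) - 1 := by
    have h1 := Int.floor_le d
    have : (⌊d⌋ : ℝ) ≤ ((N : ℤ) - 1 : ℤ) := by push_cast; linarith [le_abs_self d]
    exact_mod_cast this
  -- Cutting off at `d` also takes care of the indices `j ≥ N`, which do not enter the expansion.
  refine ⟨fun j x => if (j : ℝ) ≤ d then c j x else 0, ?_, ?_, ?_⟩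
  · intro j
    obtain ⟨C, hC⟩ := hcb j
    refine ⟨C, fun x => ?_⟩
    beta_reduce
    split_ifs
    · exact hC x
    · simpa using (norm_nonneg _).trans (hC x)
  · intro j hj x
    simp [not_le.2 hj]
  · intro m
    obtain ⟨C, hC⟩ := hκb m
    refine ⟨C, fun x t => ?_⟩
    have e : ∑ j ∈ Finset.Icc (-(m : ℤ)) ⌊d⌋, (if (j : ℝ) ≤ d then c j x else 0) *
        (t : ℂ) ^ (j + m) = ∑ j ∈ Finset.Icc (-(m : ℤ)) ((N : ℤ) - 1), c j x *
        (t : ℂ) ^ (j + m) := by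
      have h1 : ∑ j ∈ Finset.Icc (-(m : ℤ)) ⌊d⌋, (if (j : ℝ) ≤ d then c j x else 0) *
        (t : ℂ) ^ (j + m) = ∑ j ∈ Finset.Icc (-(m : ℤ)) ⌊d⌋, c j x * (t : ℂ) ^ (j + m) := by
        refine Finset.sum_congr rfl fun j hj => ?_
        rw [if_pos (Int.le_floor.1 (Finset.mem_Icc.1 hj).2)]
      rw [h1]
      refine Finset.sum_subset (Finset.Icc_subset_Icc_right hfl) fun j hj hj' => ?_
      have hj1 := Finset.mem_Icc.1 hj
      have hj2 : ⌊d⌋ < j := by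
        by_contra h
        exact hj' (Finset.mem_Icc.2 ⟨hj1.1, not_lt.1 h⟩)
      rw [hc0 j (Int.floor_lt.1 hj2) hj1.2, zero_mul]
    rw [e, hexp, add_sub_cancel_left, norm_mul, norm_pow, norm_neg, Complex.norm_I, one_pow,
      one_mul]
    exact hC x t

end LineExpansion

end

noncomputable section

/-! ### Taylor expansion in `ξ'` through an operator on families of derivatives. -/

section TangentialTaylor

open MeasureTheory Filter Topology

variable {k : ℕ} {d : ℝ} {p : Euc (k + 1) × Euc (k + 1) → ℂ}

/-- The operator `c ↦ (α ↦ ∑ᵢ i ξᵢ c(α + eᵢ))` on families indexed by multi-indices; applied to the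
derivatives of a function it gives the derivatives of the directional derivative along `ξ`. -/
def tangentialOp (ξ : Euc k) : Module.End ℂ ((Fin (k + 1) → ℕ) → ℂ) where
  toFun F := fun α => ∑ i, Complex.I * ξ i * F (α + Pi.single i.castSucc 1)
  map_add' F G := by
    funext α
    simp [mul_add, Finset.sum_add_distrib]
  map_smul' c F := by
    funext α
    simp only [Pi.smul_apply, smul_eq_mul, RingHom.id_apply, Finset.mul_sum]
    exact Finset.sum_congr rfl fun i _ => by ring

lemma tangentialOp_apply (ξ : Euc k) (F : (Fin (k + 1) → ℕ) → ℂ) (α : Fin (k + 1) → ℕ) :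
    tangentialOp ξ F α = ∑ i, Complex.I * ξ i * F (α + Pi.single i.castSucc 1) := rfl

lemma tangentialOp_pow_succ (ξ : Euc k) (r : ℕ) (F : (Fin (k + 1) → ℕ) → ℂ)
    (α : Fin (k + 1) → ℕ) :
    (tangentialOp ξ ^ (r + 1)) F α =
      ∑ i, Complex.I * ξ i * (tangentialOp ξ ^ r) F (α + Pi.single i.castSucc 1) := by
  rw [pow_succ', Module.End.mul_apply, tangentialOp_apply]

/-- Each application costs one factor `⟨ξ⟩` and raises the length of the multi-index by one, so only
entries of length `|α| + r` matter. The parameter type `Y` and weight `w` serve to keep the constant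
uniform. -/
lemma norm_tangentialOp_pow_le {Y : Type*} (F : Y → (Fin (k + 1) → ℕ) → ℂ) (ξ : Y → Euc k)
    (w : Y → ℝ) (r : ℕ) (α : Fin (k + 1) → ℕ)
    (hF : ∀ γ, multiLength γ = multiLength α + r → ∃ C : ℝ, ∀ y, ‖F y γ‖ ≤ C * w y) :
    ∃ C : ℝ, ∀ y, ‖(tangentialOp (ξ y) ^ r) (F y) α‖ ≤ C * (japBracket (ξ y) ^ r * w y) := by
  induction r generalizing α with
  | zero =>
    obtain ⟨C, hC⟩ := hF α (by simp)
    exact ⟨C, fun y => by simpa using hC y⟩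
  | succ r ih =>
    have h : ∀ i : Fin k, ∃ C : ℝ, ∀ y, ‖(tangentialOp (ξ y) ^ r) (F y)
        (α + Pi.single i.castSucc 1)‖ ≤ C * (japBracket (ξ y) ^ r * w y) := fun i =>
      ih _ fun γ hγ => hF γ (by rw [hγ, multiLength_add, multiLength_single]; ring)
    choose C hC using h
    refine ⟨∑ i, C i, fun y => ?_⟩
    rw [tangentialOp_pow_succ, Finset.sum_mul]
    refine norm_sum_le_of_le _ fun i _ => ?_
    rw [norm_mul, norm_mul, Complex.norm_I, one_mul, Complex.norm_real, Real.norm_eq_abs]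
    calc |ξ y i| * ‖(tangentialOp (ξ y) ^ r) (F y) (α + Pi.single i.castSucc 1)‖
        ≤ japBracket (ξ y) * (C i * (japBracket (ξ y) ^ r * w y)) :=
          mul_le_mul (abs_apply_le_japBracket _ _) (hC i y) (norm_nonneg _) (japBracket_pos _).le
      _ = _ := by ring

lemma tangentialOp_pow_eq_zero (ξ : Euc k) (F : (Fin (k + 1) → ℕ) → ℂ) (r : ℕ)
    (α : Fin (k + 1) → ℕ) (hF : ∀ γ, multiLength γ = multiLength α + r → F γ = 0) :
    (tangentialOp ξ ^ r) F α = 0 := by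
  obtain ⟨C, hC⟩ := norm_tangentialOp_pow_le (Y := Unit) (fun _ => F) (fun _ => ξ) (fun _ => 0) r α
    (fun γ hγ => ⟨0, fun _ => by simp [hF γ hγ]⟩)
  simpa using hC ()

lemma tangentialOp_pow_polynomial (F : (Fin (k + 1) → ℕ) → ℂ) (r : ℕ) (α : Fin (k + 1) → ℕ) :
    ∃ P : MvPolynomial (Fin k) ℂ, P.totalDegree ≤ r ∧
      ∀ ξ : Euc k, (tangentialOp ξ ^ r) F α = MvPolynomial.eval (fun i => (ξ i : ℂ)) P := by
  induction r generalizing α with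
  | zero => exact ⟨MvPolynomial.C (F α), by simp, fun ξ => by simp⟩
  | succ r ih =>
    choose P hP hPe using fun i : Fin k => ih (α + Pi.single i.castSucc 1)
    refine ⟨∑ i, MvPolynomial.C Complex.I * MvPolynomial.X i * P i, ?_, fun ξ => ?_⟩
    · refine MvPolynomial.totalDegree_finsetSum_le fun i _ => ?_
      refine (MvPolynomial.totalDegree_mul _ _).trans ?_
      have h1 : (MvPolynomial.C Complex.I * MvPolynomial.X i :
          MvPolynomial (Fin k) ℂ).totalDegree ≤ 1 := by
        refine (MvPolynomial.totalDegree_mul _ _).trans ?_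
        simp
      have := hP i
      omega
    · rw [tangentialOp_pow_succ, map_sum]
      refine Finset.sum_congr rfl fun i _ => ?_
      rw [hPe i ξ]
      simp

lemma hasDerivAt_tangentialOp_pow (ξ : Euc k) {U : ℝ → (Fin (k + 1) → ℕ) → ℂ}
    (hU : ∀ γ τ, HasDerivAt (fun τ => U τ γ) (tangentialOp ξ (U τ) γ) τ) (r : ℕ)
    (α : Fin (k + 1) → ℕ) (τ : ℝ) :
    HasDerivAt (fun τ => (tangentialOp ξ ^ r) (U τ) α) ((tangentialOp ξ ^ (r + 1)) (U τ) α) τ := by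
  induction r generalizing α with
  | zero => simpa using hU α τ
  | succ r ih =>
    have h := HasDerivAt.fun_sum (u := Finset.univ) fun (i : Fin k) _ =>
      (ih (α + Pi.single i.castSucc 1)).const_mul (Complex.I * ξ i)
    simpa only [← tangentialOp_pow_succ] using h

/-- By this, the `r`-th derivative along the ray through `ξ` is the `r`-th power of `tangentialOp
ξ`. -/
lemma hasDerivAt_normalSlice_ray (hp : ContDiff ℝ ∞ p) (α β : Fin (k + 1) → ℕ) (x ξ : Euc k)
    (t τ : ℝ) :
    HasDerivAt (fun τ : ℝ => normalSlice p α β x (τ • ξ) t)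
      (tangentialOp ξ (fun γ => normalSlice p γ β x (τ • ξ) t) α) τ := by
  have h1 : HasDerivAt (fun τ : ℝ => (x, τ • ξ)) ((0 : Euc k), ξ) τ := by
    refine (hasDerivAt_const _ _).prodMk ?_
    simpa using (hasDerivAt_id τ).smul_const ξ
  have h2 := (hasFDerivAt_normalSlice hp α β t (x, τ • ξ)).comp_hasDerivAt τ h1
  refine h2.congr_deriv ?_
  rw [_root_.smul_apply, gradCLM_apply, tangentialOp_apply]
  simp [Finset.mul_sum, mul_assoc]

end TangentialTaylor

/-! ### Coefficients of the expansion for all `ξ'` and the remainder estimate. -/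

section Coefficients

open MeasureTheory Filter Topology

variable {k : ℕ} {d : ℝ} {p : Euc (k + 1) × Euc (k + 1) → ℂ}

@[simp] lemma japBracket_zero {n : ℕ} : japBracket (0 : Euc n) = 1 := by
  simp [japBracket]

/-- The expansion at the frequency `ξ' = 0`. -/
lemma IsSymbolUTTR.exists_expansion_zero (hp : IsSymbolUTTR d p) (α β : Fin (k + 1) → ℕ) :
    ∃ c : ℤ → Euc k → ℂ, (∀ j, ∃ C : ℝ, ∀ x, ‖c j x‖ ≤ C) ∧
      (∀ j : ℤ, d - multiLength α < j → ∀ x, c j x = 0) ∧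
      ∀ m : ℕ, ∃ C : ℝ, ∀ (x : Euc k) (t : ℝ),
        ‖(t : ℂ) ^ m * normalSlice p α β x 0 t -
          ∑ j ∈ Finset.Icc (-(m : ℤ)) ⌊d - multiLength α⌋, c j x * (t : ℂ) ^ (j + m)‖
          ≤ C * (1 + |t|)⁻¹ := by
  choose K hK using fun x => hp.1.exists_isInvFourierOffZero α β x 0
  set f : Euc k → ℕ → ℝ → ℂ := fun x r t =>
    Complex.I ^ r * normalSlice p (α + Pi.single (Fin.last k) r) β x 0 t with hf
  have hf0 : ∀ x, f x 0 = normalSlice p α β x 0 := fun x => by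
    funext t
    simp [hf]
  have hb : ∀ r : ℕ, ∃ C : ℝ, ∀ x t, ‖f x r t‖ ≤ C * (1 + |t|) ^ (d - multiLength α - r) := by
    intro r
    obtain ⟨C, hC0, hC⟩ := hp.1.norm_normalSlice_le (α + Pi.single (Fin.last k) r) β
    refine ⟨C * 2 ^ |d - multiLength α - r|, fun x t => ?_⟩
    rw [hf, norm_mul, norm_pow, Complex.norm_I, one_pow, one_mul, mul_assoc]
    refine (hC x 0 t).trans ?_
    rw [multiLength_add, multiLength_single]
    push_cast
    rw [← sub_sub]
    refine mul_le_mul_of_nonneg_left ?_ hC0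
    have := japBracket_joinLast_rpow_le (0 : Euc k) (d - multiLength α - r) t
    rwa [japBracket_zero, mul_one] at this
  have hKb : ∀ l m : ℕ, ∃ C : ℝ, ∀ x, ∀ z : ℝ, z ≠ 0 →
      ‖(z : ℂ) ^ l * iteratedDeriv m (K x) z‖ ≤ C := by
    intro l m
    obtain ⟨C, hC⟩ := hp.2 α β l m 0
    refine ⟨C, fun x z hz => ?_⟩
    -- The hypothesis offers a kernel `L` that may depend on `l` and `m`; uniqueness off zero
    -- transfers its bounds to the fixed kernel `K x`.
    obtain ⟨L, hL, hLb⟩ := hC x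
    have h1 := isInvFourierOffZero_iff.1 hL
    have h2 := isInvFourierOffZero_iff.1 (hK x)
    have heq := (h2.2.eqOn h2.1.continuousOn h1.1.continuousOn h1.2).iteratedDeriv_of_isOpen
      isOpen_compl_singleton m
    have := hLb z hz
    rw [weightedD, ← heq hz] at this
    refine le_trans (le_of_eq ?_) this
    rw [norm_mul, norm_mul, norm_mul, norm_pow (-Complex.I), norm_neg, Complex.norm_I,
      one_pow, one_mul]
  obtain ⟨c, h1, h2, h3⟩ := exists_line_expansion f
    (fun x => hp.1.isLineSymbol_normalSlice α β x 0) hb K (fun x => (hf0 x).symm ▸ hK x) hKb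
  simp only [hf0] at h3
  exact ⟨c, h1, h2, h3⟩

/-- The Taylor polynomial in `ξ'` of the coefficient of order `j`, built from the coefficients `c`
at `ξ' = 0`. -/
def expansionCoeff (d : ℝ)
    (c : (Fin (k + 1) → ℕ) → (Fin (k + 1) → ℕ) → ℤ → Euc k → ℂ) (α β : Fin (k + 1) → ℕ) (j : ℤ)
    (y : Euc k × Euc k) : ℂ :=
  ∑ r ∈ Finset.range (⌊d - multiLength α⌋ - j + 1).toNat,
    (r.factorial : ℂ)⁻¹ * (tangentialOp y.2 ^ r) (fun γ => c γ β j y.1) α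

section

variable {c : (Fin (k + 1) → ℕ) → (Fin (k + 1) → ℕ) → ℤ → Euc k → ℂ}

lemma expansionCoeff_eq_zero {α β : Fin (k + 1) → ℕ} {j : ℤ} (h : d - multiLength α < j)
    (y : Euc k × Euc k) : expansionCoeff d c α β j y = 0 := by
  have : (⌊d - multiLength α⌋ - j + 1).toNat = 0 := by
    have := Int.floor_lt.2 h
    omega
  rw [expansionCoeff, this]
  simp

lemma expansionCoeff_polynomial (α β : Fin (k + 1) → ℕ) {j : ℤ} (hj : (j : ℝ) ≤ d - multiLength α)
    (x : Euc k) :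
    IsPolynomialOfDegreeLE (d - j - multiLength α) (fun ξ => expansionCoeff d c α β j (x, ξ)) := by
  choose P hP hPe using fun r => tangentialOp_pow_polynomial (fun γ => c γ β j x) r α
  refine ⟨∑ r ∈ Finset.range (⌊d - multiLength α⌋ - j + 1).toNat,
    MvPolynomial.C (r.factorial : ℂ)⁻¹ * P r, ?_, fun ξ => ?_⟩
  · have h1 : (∑ r ∈ Finset.range (⌊d - multiLength α⌋ - j + 1).toNat,
        MvPolynomial.C (r.factorial : ℂ)⁻¹ * P r).totalDegree ≤
        (⌊d - multiLength α⌋ - j).toNat := by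
      refine MvPolynomial.totalDegree_finsetSum_le fun r hr => ?_
      refine (MvPolynomial.totalDegree_mul _ _).trans ?_
      have := hP r
      have := Finset.mem_range.1 hr
      rw [MvPolynomial.totalDegree_C]
      omega
    have h2 : 0 ≤ ⌊d - multiLength α⌋ - j := by linarith [Int.le_floor.2 hj]
    have h3 : (((⌊d - multiLength α⌋ - j).toNat : ℤ) : ℝ) ≤ d - j - multiLength α := by
      rw [Int.toNat_of_nonneg h2]
      push_cast
      linarith [Int.floor_le (d - multiLength α)]
    refine le_trans ?_ h3
    exact_mod_cast h1
  · change expansionCoeff d c α β j (x, ξ) = _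
    rw [expansionCoeff, map_sum]
    refine Finset.sum_congr rfl fun r _ => ?_
    rw [hPe r ξ]
    simp

lemma norm_expansionCoeff_le (hc : ∀ α β j, ∃ C : ℝ, ∀ x, ‖c α β j x‖ ≤ C)
    (α β : Fin (k + 1) → ℕ) (j : ℤ) : ∃ C : ℝ, 0 ≤ C ∧ ∀ x ξ : Euc k,
      ‖expansionCoeff d c α β j (x, ξ)‖ ≤ C * japBracket ξ ^ (d - multiLength α - j) := by
  have h : ∀ r : ℕ, ∃ C : ℝ, ∀ y : Euc k × Euc k,
      ‖(tangentialOp y.2 ^ r) (fun γ => c γ β j y.1) α‖ ≤ C * (japBracket y.2 ^ r * 1) := fun r =>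
    norm_tangentialOp_pow_le (fun y : Euc k × Euc k => fun γ => c γ β j y.1) (fun y => y.2)
      (fun _ => 1) r α (fun γ _ => by
        obtain ⟨C, hC⟩ := hc γ β j
        exact ⟨C, fun y => by simpa using hC y.1⟩)
  choose C hC using h
  refine ⟨∑ r ∈ Finset.range (⌊d - multiLength α⌋ - j + 1).toNat, |C r|,
    Finset.sum_nonneg fun _ _ => abs_nonneg _, fun x ξ => ?_⟩
  rw [expansionCoeff, Finset.sum_mul]
  refine norm_sum_le_of_le _ fun r hr => ?_
  rw [norm_mul, norm_inv, Complex.norm_natCast]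
  have h1 : ((r.factorial : ℝ))⁻¹ ≤ 1 :=
    inv_le_one_of_one_le₀ (by exact_mod_cast r.factorial_pos)
  have h2 : japBracket ξ ^ r ≤ japBracket ξ ^ (d - multiLength α - j) := by
    rw [← Real.rpow_natCast]
    refine Real.rpow_le_rpow_of_exponent_le (one_le_japBracket ξ) ?_
    have h3 := Finset.mem_range.1 hr
    have h4 : (r : ℤ) ≤ ⌊d - multiLength α⌋ - j := by omega
    have h5 : (r : ℝ) ≤ ⌊d - multiLength α⌋ - j := by exact_mod_cast h4
    linarith [Int.floor_le (d - multiLength α)]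
  calc ((r.factorial : ℝ))⁻¹ * ‖(tangentialOp ξ ^ r) (fun γ => c γ β j x) α‖
      ≤ 1 * (C r * (japBracket ξ ^ r * 1)) :=
        mul_le_mul h1 (hC r (x, ξ)) (norm_nonneg _) zero_le_one
    _ ≤ |C r| * japBracket ξ ^ r := by
        rw [one_mul, mul_one]
        exact mul_le_mul_of_nonneg_right (le_abs_self _) (pow_nonneg (japBracket_pos _).le _)
    _ ≤ _ := by gcongr

/-- The `r`-th term involves `c γ β j` with `|γ| = |α| + r`, which vanish once `j > d - |γ|`. So a
single Taylor order `N` serves all `j`. -/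
lemma sum_range_eq_expansionCoeff (hc0 : ∀ α β (j : ℤ), d - multiLength α < j → ∀ x, c α β j x = 0)
    (α β : Fin (k + 1) → ℕ) (j : ℤ) (y : Euc k × Euc k) {N : ℕ}
    (hN : (⌊d - multiLength α⌋ - j + 1).toNat ≤ N) :
    ∑ r ∈ Finset.range N, (r.factorial : ℂ)⁻¹ * (tangentialOp y.2 ^ r) (fun γ => c γ β j y.1) α =
      expansionCoeff d c α β j y := by
  rw [expansionCoeff]
  symm
  refine Finset.sum_subset (Finset.range_subset_range.2 hN) fun r _ hr => ?_
  rw [tangentialOp_pow_eq_zero _ _ _ _ fun γ hγ => ?_, mul_zero]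
  refine hc0 γ β j ?_ y.1
  rw [hγ]
  rw [Finset.mem_range, not_lt] at hr
  have h1 : ⌊d - multiLength α⌋ < j + r := by omega
  have := Int.floor_lt.1 h1
  push_cast at this ⊢
  linarith

/-- The Taylor coefficients at `ξ' = 0` give the expansion where `|t|` dominates. -/
lemma norm_remainder_le_of_le_abs (hp : IsSymbol d p)
    (hc0 : ∀ α β (j : ℤ), d - multiLength α < j → ∀ x, c α β j x = 0)
    (hexp : ∀ α β, ∀ m : ℕ, ∃ C : ℝ, ∀ (x : Euc k) (t : ℝ),
        ‖(t : ℂ) ^ m * normalSlice p α β x 0 t -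
          ∑ j ∈ Finset.Icc (-(m : ℤ)) ⌊d - multiLength α⌋, c α β j x * (t : ℂ) ^ (j + m)‖
          ≤ C * (1 + |t|)⁻¹)
    (α β : Fin (k + 1) → ℕ) (m : ℕ) :
    ∃ C : ℝ, ∀ (x ξ : Euc k) (t : ℝ), japBracket ξ ≤ |t| →
      ‖(t : ℂ) ^ m * normalSlice p α β x ξ t -
          ∑ j ∈ Finset.Icc (-(m : ℤ)) ⌊d - multiLength α⌋,
            expansionCoeff d c α β j (x, ξ) * (t : ℂ) ^ (j + m)‖
          ≤ C * japBracket ξ ^ (d + 1 - multiLength α + m) * |t|⁻¹ := by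
  set e : ℝ := d - multiLength α with he
  set E : ℝ := d + 1 - multiLength α + m with hE
  have heE : E = e + 1 + m := by rw [hE, he]; ring
  set M : ℤ := ⌊e⌋ with hM
  -- The order is large enough for the remainder, since `E - N ≤ 0` allows `|t|` to be replaced by
  -- `⟨ξ'⟩`, and small enough for the terms, since `r < N` still means `r < E`.
  set N : ℕ := ⌈E⌉₊ with hN
  have hEN : E ≤ N := Nat.le_ceil E
  -- the Taylor remainder
  obtain ⟨C₁, hC₁⟩ : ∃ C : ℝ, ∀ (x ξ : Euc k) (t : ℝ), japBracket ξ ≤ |t| →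
      ‖normalSlice p α β x ξ t - ∑ r ∈ Finset.range N, (r.factorial : ℂ)⁻¹ *
        (tangentialOp ξ ^ r) (fun γ => normalSlice p γ β x 0 t) α‖
      ≤ C * (japBracket ξ ^ N * |t| ^ (e - N)) := by
    -- The subtype carries the constraints `⟨ξ'⟩ ≤ |t|` and `τ ∈ [0, 1]`, under which `⟨(τξ', t)⟩`
    -- is comparable to `|t|`.
    obtain ⟨C, hC⟩ := norm_tangentialOp_pow_le
      (Y := {y : (Euc k × Euc k) × ℝ × ℝ // japBracket y.1.2 ≤ |y.2.1| ∧ y.2.2 ∈ Set.Icc (0 : ℝ) 1})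
      (fun y γ => normalSlice p γ β y.1.1.1 (y.1.2.2 • y.1.1.2) y.1.2.1) (fun y => y.1.1.2)
      (fun y => |y.1.2.1| ^ (e - N)) N α (by
        intro γ hγ
        obtain ⟨C, hC0, hC⟩ := hp.norm_normalSlice_le γ β
        refine ⟨C * 2 ^ |e - N|, ?_⟩
        rintro ⟨⟨⟨x, ξ⟩, t, τ⟩, ht, hτ⟩
        simp only at ht hτ ⊢
        refine (hC x (τ • ξ) t).trans ?_
        rw [hγ, mul_assoc]
        push_cast
        rw [← sub_sub, ← he]
        refine mul_le_mul_of_nonneg_left ?_ hC0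
        have ht0 : 0 < |t| := (japBracket_pos ξ).trans_le ht
        have hτa : japBracket (τ • ξ) ≤ japBracket ξ := by
          refine Real.sqrt_le_sqrt ?_
          rw [norm_smul, Real.norm_of_nonneg hτ.1]
          have : τ * ‖ξ‖ ≤ ‖ξ‖ := mul_le_of_le_one_left (norm_nonneg _) hτ.2
          have h0 : 0 ≤ τ * ‖ξ‖ := mul_nonneg hτ.1 (norm_nonneg _)
          gcongr
        have h1 := japBracket_joinLast_le (τ • ξ) t
        have h2 := abs_le_japBracket_joinLast (τ • ξ) t
        exact rpow_le_of_comparable (japBracket_pos _) ht0 (by linarith)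
          (by linarith [japBracket_pos (joinLast (τ • ξ) t)]) _)
    refine ⟨C, fun x ξ t ht => ?_⟩
    have h := norm_sub_taylor_le N (M := C * (japBracket ξ ^ N * |t| ^ (e - N)))
      (fun r τ => (tangentialOp ξ ^ r) (fun γ => normalSlice p γ β x (τ • ξ) t) α)
      (fun r τ => hasDerivAt_tangentialOp_pow ξ
        (fun γ τ => hasDerivAt_normalSlice_ray hp.1 γ β x ξ t τ) r α τ)
      (fun τ hτ => hC ⟨((x, ξ), t, τ), ht, hτ⟩) 1 (Set.right_mem_Icc.2 zero_le_one)
    simp only [pow_zero, Module.End.one_apply, one_smul, zero_smul, Complex.ofReal_one, one_pow,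
      one_div] at h
    simpa only [mul_comm] using h
  -- the expansion of the Taylor coefficients
  have hV : ∀ r : ℕ, ∃ C : ℝ, ∀ (x ξ : Euc k) (t : ℝ), t ≠ 0 →
      ‖(tangentialOp ξ ^ r) (fun γ => (t : ℂ) ^ m * normalSlice p γ β x 0 t -
        ∑ j ∈ Finset.Icc (-(m : ℤ)) M, c γ β j x * (t : ℂ) ^ (j + m)) α‖
        ≤ C * (japBracket ξ ^ r * |t|⁻¹) := by
    intro r
    obtain ⟨C, hC⟩ := norm_tangentialOp_pow_le
      (Y := {y : (Euc k × Euc k) × ℝ // y.2 ≠ 0})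
      (fun y γ => (y.1.2 : ℂ) ^ m * normalSlice p γ β y.1.1.1 0 y.1.2 -
        ∑ j ∈ Finset.Icc (-(m : ℤ)) M, c γ β j y.1.1.1 * (y.1.2 : ℂ) ^ (j + m))
      (fun y => y.1.1.2) (fun y => |y.1.2|⁻¹) r α (by
        intro γ hγ
        obtain ⟨C, hC⟩ := hexp γ β m
        refine ⟨C, ?_⟩
        rintro ⟨⟨⟨x, ξ⟩, t⟩, ht⟩
        simp only at ht ⊢
        have hC0 : 0 ≤ C := by simpa using (norm_nonneg _).trans (hC x 0)
        -- The expansion for `γ` stops earlier than the one for `α`; vanishing coefficients fill the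
        -- gap.
        have hle : ⌊d - multiLength γ⌋ ≤ M := by
          refine Int.floor_le_floor ?_
          rw [hγ, he]
          push_cast
          linarith [r.cast_nonneg (α := ℝ)]
        have hsum : ∑ j ∈ Finset.Icc (-(m : ℤ)) M, c γ β j x * (t : ℂ) ^ (j + m) =
            ∑ j ∈ Finset.Icc (-(m : ℤ)) ⌊d - multiLength γ⌋, c γ β j x * (t : ℂ) ^ (j + m) := by
          symm
          refine Finset.sum_subset (Finset.Icc_subset_Icc_right hle) fun j hj hj' => ?_
          have hj2 : ⌊d - multiLength γ⌋ < j := by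
            by_contra h
            exact hj' (Finset.mem_Icc.2 ⟨(Finset.mem_Icc.1 hj).1, not_lt.1 h⟩)
          rw [hc0 γ β j (Int.floor_lt.1 hj2), zero_mul]
        rw [hsum]
        refine (hC x t).trans (mul_le_mul_of_nonneg_left ?_ hC0)
        exact inv_anti₀ (abs_pos.2 ht) (by linarith))
    exact ⟨C, fun x ξ t ht => hC ⟨((x, ξ), t), ht⟩⟩
  choose C₂ hC₂ using hV
  refine ⟨|C₁| + ∑ r ∈ Finset.range N, |C₂ r|, fun x ξ t ht => ?_⟩
  set a := japBracket ξ with ha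
  have ha0 : 0 < a := japBracket_pos ξ
  have ha1 : 1 ≤ a := one_le_japBracket ξ
  have ht0 : 0 < |t| := ha0.trans_le ht
  have htne : t ≠ 0 := abs_pos.1 ht0
  have hs : ∑ j ∈ Finset.Icc (-(m : ℤ)) M, expansionCoeff d c α β j (x, ξ) * (t : ℂ) ^ (j + m) =
      ∑ r ∈ Finset.range N, (r.factorial : ℂ)⁻¹ * (tangentialOp ξ ^ r)
        (fun γ => ∑ j ∈ Finset.Icc (-(m : ℤ)) M, c γ β j x * (t : ℂ) ^ (j + m)) α := by
    have h1 : ∀ r : ℕ, (tangentialOp ξ ^ r)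
        (fun γ => ∑ j ∈ Finset.Icc (-(m : ℤ)) M, c γ β j x * (t : ℂ) ^ (j + m)) α =
        ∑ j ∈ Finset.Icc (-(m : ℤ)) M,
          (tangentialOp ξ ^ r) (fun γ => c γ β j x) α * (t : ℂ) ^ (j + m) := by
      intro r
      have : (fun γ => ∑ j ∈ Finset.Icc (-(m : ℤ)) M, c γ β j x * (t : ℂ) ^ (j + m)) =
          ∑ j ∈ Finset.Icc (-(m : ℤ)) M, (t : ℂ) ^ (j + m) • fun γ => c γ β j x := by
        funext γ
        simp [Finset.sum_apply, mul_comm]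
      rw [this, map_sum, Finset.sum_apply]
      refine Finset.sum_congr rfl fun j _ => ?_
      rw [map_smul, Pi.smul_apply, smul_eq_mul, mul_comm]
    simp only [h1, Finset.mul_sum]
    rw [Finset.sum_comm]
    refine Finset.sum_congr rfl fun j hj => ?_
    rw [← sum_range_eq_expansionCoeff hc0 α β j (x, ξ) (N := N), Finset.sum_mul]
    · exact Finset.sum_congr rfl fun r _ => by ring
    · have hj1 := (Finset.mem_Icc.1 hj).1
      have h2 : ((M - j + 1 : ℤ) : ℝ) ≤ N := by
        refine le_trans ?_ hEN
        have : (-(m : ℝ)) ≤ j := by exact_mod_cast hj1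
        push_cast
        rw [heE]
        linarith [Int.floor_le e]
      have h3 : M - j + 1 ≤ (N : ℤ) := by exact_mod_cast h2
      rw [← he, ← hM]
      omega
  have hlin : ∀ r : ℕ, (t : ℂ) ^ m * (tangentialOp ξ ^ r) (fun γ => normalSlice p γ β x 0 t) α -
      (tangentialOp ξ ^ r)
        (fun γ => ∑ j ∈ Finset.Icc (-(m : ℤ)) M, c γ β j x * (t : ℂ) ^ (j + m)) α =
      (tangentialOp ξ ^ r) (fun γ => (t : ℂ) ^ m * normalSlice p γ β x 0 t -
        ∑ j ∈ Finset.Icc (-(m : ℤ)) M, c γ β j x * (t : ℂ) ^ (j + m)) α := by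
    intro r
    have : (fun γ => (t : ℂ) ^ m * normalSlice p γ β x 0 t -
        ∑ j ∈ Finset.Icc (-(m : ℤ)) M, c γ β j x * (t : ℂ) ^ (j + m)) =
        (t : ℂ) ^ m • (fun γ => normalSlice p γ β x 0 t) -
        (fun γ => ∑ j ∈ Finset.Icc (-(m : ℤ)) M, c γ β j x * (t : ℂ) ^ (j + m)) := by
      funext γ; simp
    rw [this, map_sub, map_smul]
    simp
  have hdecomp : (t : ℂ) ^ m * normalSlice p α β x ξ t -
      ∑ j ∈ Finset.Icc (-(m : ℤ)) M, expansionCoeff d c α β j (x, ξ) * (t : ℂ) ^ (j + m) =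
      (t : ℂ) ^ m * (normalSlice p α β x ξ t - ∑ r ∈ Finset.range N, (r.factorial : ℂ)⁻¹ *
        (tangentialOp ξ ^ r) (fun γ => normalSlice p γ β x 0 t) α) +
      ∑ r ∈ Finset.range N, (r.factorial : ℂ)⁻¹ * (tangentialOp ξ ^ r)
        (fun γ => (t : ℂ) ^ m * normalSlice p γ β x 0 t -
        ∑ j ∈ Finset.Icc (-(m : ℤ)) M, c γ β j x * (t : ℂ) ^ (j + m)) α := by
    simp only [← hlin]
    rw [hs, mul_sub, Finset.mul_sum]
    simp only [mul_sub, Finset.sum_sub_distrib]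
    have : ∀ r : ℕ, (t : ℂ) ^ m * ((r.factorial : ℂ)⁻¹ *
        (tangentialOp ξ ^ r) (fun γ => normalSlice p γ β x 0 t) α) = (r.factorial : ℂ)⁻¹ *
        ((t : ℂ) ^ m * (tangentialOp ξ ^ r) (fun γ => normalSlice p γ β x 0 t) α) := fun r => by
      ring
    simp only [this]
    ring
  rw [hdecomp, add_mul, add_mul]
  refine (norm_add_le _ _).trans (add_le_add ?_ ?_)
  · rw [norm_mul, norm_pow, Complex.norm_real, Real.norm_eq_abs]
    have h1 := hC₁ x ξ t ht
    have h2 : a ^ N * |t| ^ (e - N) * |t| ^ m ≤ a ^ E * |t|⁻¹ := by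
      have h3 : |t| ^ (e - N) * |t| ^ m = |t| ^ (E - N) * |t|⁻¹ := by
        rw [← Real.rpow_natCast, ← Real.rpow_add ht0, ← Real.rpow_neg_one, ← Real.rpow_add ht0]
        congr 1; rw [heE]; ring
      have h4 : |t| ^ (E - N) ≤ a ^ (E - N) :=
        Real.rpow_le_rpow_of_nonpos ha0 ht (by linarith)
      have h5 : a ^ N * a ^ (E - N) = a ^ E := by
        rw [← Real.rpow_natCast, ← Real.rpow_add ha0]
        congr 1; ring
      rw [mul_assoc, h3, ← h5, mul_assoc]
      gcongr
    calc |t| ^ m * ‖normalSlice p α β x ξ t - ∑ r ∈ Finset.range N, (r.factorial : ℂ)⁻¹ *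
          (tangentialOp ξ ^ r) (fun γ => normalSlice p γ β x 0 t) α‖
        ≤ |t| ^ m * (C₁ * (a ^ N * |t| ^ (e - N))) := by gcongr
      _ = C₁ * (a ^ N * |t| ^ (e - N) * |t| ^ m) := by ring
      _ ≤ |C₁| * (a ^ N * |t| ^ (e - N) * |t| ^ m) := by
          refine mul_le_mul_of_nonneg_right (le_abs_self _) ?_
          have := Real.rpow_nonneg ht0.le (e - N)
          positivity
      _ ≤ |C₁| * (a ^ E * |t|⁻¹) := by gcongr
      _ = _ := by ring
  · rw [Finset.sum_mul, Finset.sum_mul]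
    refine norm_sum_le_of_le _ fun r hr => ?_
    rw [norm_mul, norm_inv, Complex.norm_natCast]
    have h1 : ((r.factorial : ℝ))⁻¹ ≤ 1 :=
      inv_le_one_of_one_le₀ (by exact_mod_cast r.factorial_pos)
    have hrE : (r : ℝ) < E := Nat.lt_ceil.1 (Finset.mem_range.1 hr)
    have h2 : a ^ r ≤ a ^ E := by
      rw [← Real.rpow_natCast]
      exact Real.rpow_le_rpow_of_exponent_le ha1 hrE.le
    refine (mul_le_mul h1 (hC₂ r x ξ t htne) (norm_nonneg _) zero_le_one).trans ?_
    rw [one_mul]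
    calc C₂ r * (a ^ r * |t|⁻¹) ≤ |C₂ r| * (a ^ r * |t|⁻¹) :=
          mul_le_mul_of_nonneg_right (le_abs_self _) (by positivity)
      _ ≤ |C₂ r| * (a ^ E * |t|⁻¹) := by gcongr
      _ = _ := by ring

/-- Where `|t| ≤ ⟨ξ'⟩` no cancellation is needed: the function and all terms are separately
`O(⟨ξ'⟩^(d-|α|+m))`, and `⟨ξ'⟩/⟨ξ⟩ ≥ 1/2` there. The other region is `norm_remainder_le_of_le_abs`.
-/
lemma norm_remainder_le (hp : IsSymbol d p)
    (hc : ∀ α β j, ∃ C : ℝ, ∀ x, ‖c α β j x‖ ≤ C)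
    (hc0 : ∀ α β (j : ℤ), d - multiLength α < j → ∀ x, c α β j x = 0)
    (hexp : ∀ α β, ∀ m : ℕ, ∃ C : ℝ, ∀ (x : Euc k) (t : ℝ),
        ‖(t : ℂ) ^ m * normalSlice p α β x 0 t -
          ∑ j ∈ Finset.Icc (-(m : ℤ)) ⌊d - multiLength α⌋, c α β j x * (t : ℂ) ^ (j + m)‖
          ≤ C * (1 + |t|)⁻¹)
    (α β : Fin (k + 1) → ℕ) (m : ℕ) :
    ∃ C : ℝ, ∀ (x ξ : Euc k) (t : ℝ),
      ‖(t : ℂ) ^ m * normalSlice p α β x ξ t -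
          ∑ j ∈ Finset.Icc (-(m : ℤ)) ⌊d - multiLength α⌋,
            expansionCoeff d c α β j (x, ξ) * (t : ℂ) ^ (j + m)‖
          ≤ C * japBracket ξ ^ (d + 1 - multiLength α + m) * (japBracket (joinLast ξ t))⁻¹ := by
  obtain ⟨C₁, hC₁⟩ := norm_remainder_le_of_le_abs hp hc0 hexp α β m
  obtain ⟨C₂, hC₂0, hC₂⟩ := hp.norm_normalSlice_le α β
  choose C₃ hC₃0 hC₃ using norm_expansionCoeff_le (d := d) hc α β
  set e : ℝ := d - multiLength α with he
  set S := ∑ j ∈ Finset.Icc (-(m : ℤ)) ⌊e⌋, C₃ j with hS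
  have hS0 : 0 ≤ S := Finset.sum_nonneg fun j _ => hC₃0 j
  refine ⟨2 * |C₁| + 2 * (C₂ * 2 ^ |e| + S), fun x ξ t => ?_⟩
  set a := japBracket ξ with ha
  set J := japBracket (joinLast ξ t) with hJ
  have ha0 : 0 < a := japBracket_pos ξ
  have hJ0 : 0 < J := japBracket_pos _
  have hJle : J ≤ a + |t| := japBracket_joinLast_le ξ t
  have haJ : a ≤ J := japBracket_le_joinLast ξ t
  have haE : 0 < a ^ (d + 1 - multiLength α + m) := Real.rpow_pos_of_pos ha0 _
  rcases le_total a |t| with ht | ht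
  · have ht0 : 0 < |t| := ha0.trans_le ht
    refine (hC₁ x ξ t ht).trans ?_
    have h1 : |t|⁻¹ ≤ 2 * J⁻¹ := by
      rw [← div_eq_mul_inv, le_div_iff₀ hJ0, inv_mul_le_iff₀ ht0]
      linarith
    calc C₁ * a ^ (d + 1 - multiLength α + m) * |t|⁻¹
        ≤ |C₁| * a ^ (d + 1 - multiLength α + m) * (2 * J⁻¹) := by
          gcongr
          exact le_abs_self _
      _ = 2 * |C₁| * a ^ (d + 1 - multiLength α + m) * J⁻¹ := by ring
      _ ≤ _ := by
          gcongr
          have : 0 ≤ C₂ * 2 ^ |e| := by positivity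
          linarith
  · have hpw : a ^ (d + 1 - multiLength α + m) = a ^ (e + m) * a := by
      rw [← Real.rpow_add_one ha0.ne']
      congr 1; rw [he]; ring
    have h1 : (1 : ℝ) ≤ 2 * (a * J⁻¹) := by
      rw [← mul_assoc, ← div_eq_mul_inv, le_div_iff₀ hJ0]
      linarith
    have hu : ‖(t : ℂ) ^ m * normalSlice p α β x ξ t‖ ≤ C₂ * 2 ^ |e| * a ^ (e + m) := by
      rw [norm_mul, norm_pow, Complex.norm_real, Real.norm_eq_abs]
      have h2 : J ^ e ≤ 2 ^ |e| * a ^ e :=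
        rpow_le_of_comparable hJ0 ha0 (by linarith) (by linarith) e
      calc |t| ^ m * ‖normalSlice p α β x ξ t‖ ≤ a ^ m * (C₂ * (2 ^ |e| * a ^ e)) := by
            gcongr
            exact (hC₂ x ξ t).trans (by gcongr)
        _ = C₂ * 2 ^ |e| * (a ^ e * a ^ m) := by ring
        _ = _ := by rw [← Real.rpow_natCast a m, ← Real.rpow_add ha0]
    have hsum : ‖∑ j ∈ Finset.Icc (-(m : ℤ)) ⌊e⌋,
        expansionCoeff d c α β j (x, ξ) * (t : ℂ) ^ (j + m)‖ ≤ S * a ^ (e + m) := by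
      rw [hS, Finset.sum_mul]
      refine norm_sum_le_of_le _ fun j hj => ?_
      have hj1 := (Finset.mem_Icc.1 hj).1
      obtain ⟨n, hn⟩ := Int.eq_ofNat_of_zero_le (show 0 ≤ j + m by linarith)
      rw [hn, zpow_natCast, norm_mul, norm_pow, Complex.norm_real, Real.norm_eq_abs]
      have hn' : (n : ℝ) = j + m := by exact_mod_cast hn.symm
      calc ‖expansionCoeff d c α β j (x, ξ)‖ * |t| ^ n ≤ (C₃ j * a ^ (e - j)) * a ^ n := by
            have := Real.rpow_nonneg ha0.le (e - j)
            have := hC₃0 j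
            gcongr
            exact hC₃ j x ξ
        _ = C₃ j * (a ^ (e - j) * a ^ n) := by ring
        _ = _ := by
          rw [← Real.rpow_natCast a n, ← Real.rpow_add ha0, hn']
          congr 2; ring
    calc ‖(t : ℂ) ^ m * normalSlice p α β x ξ t -
          ∑ j ∈ Finset.Icc (-(m : ℤ)) ⌊e⌋, expansionCoeff d c α β j (x, ξ) * (t : ℂ) ^ (j + m)‖
        ≤ C₂ * 2 ^ |e| * a ^ (e + m) + S * a ^ (e + m) :=
          (norm_sub_le _ _).trans (add_le_add hu hsum)
      _ = (C₂ * 2 ^ |e| + S) * a ^ (e + m) * 1 := by ring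
      _ ≤ (C₂ * 2 ^ |e| + S) * a ^ (e + m) * (2 * (a * J⁻¹)) := by
          have := Real.rpow_nonneg ha0.le (e + m)
          gcongr
      _ = 2 * (C₂ * 2 ^ |e| + S) * (a ^ (e + m) * a) * J⁻¹ := by ring
      _ ≤ _ := by
          rw [← hpw]
          gcongr
          have := abs_nonneg C₁
          linarith

end

end Coefficients

end

noncomputable section

/-! ### Smoothness and symbol property of the coefficients, and uniqueness. -/

section Regularity

open MeasureTheory Filter Topology

variable {k : ℕ} {d : ℝ} {p : Euc (k + 1) × Euc (k + 1) → ℂ}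

/-- The expansion divided by powers of `t`, uniformly for bounded `ξ'`. -/
lemma norm_normalSlice_sub_sum_le
    {s : (Fin (k + 1) → ℕ) → (Fin (k + 1) → ℕ) → ℤ → Euc k × Euc k → ℂ}
    (hs0 : ∀ α β (j : ℤ), d - multiLength α < j → ∀ y, s α β j y = 0)
    (hsb : ∀ α β j, ∃ C : ℝ, 0 ≤ C ∧ ∀ x ξ : Euc k,
      ‖s α β j (x, ξ)‖ ≤ C * japBracket ξ ^ (d - multiLength α - j))
    (hs : ∀ α β, ∀ m : ℕ, ∃ C : ℝ, ∀ (x ξ : Euc k) (t : ℝ),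
      ‖(t : ℂ) ^ m * normalSlice p α β x ξ t -
          ∑ j ∈ Finset.Icc (-(m : ℤ)) ⌊d - multiLength α⌋, s α β j (x, ξ) * (t : ℂ) ^ (j + m)‖
          ≤ C * japBracket ξ ^ (d + 1 - multiLength α + m) * (japBracket (joinLast ξ t))⁻¹)
    (α β : Fin (k + 1) → ℕ) (R : ℝ) (j : ℤ) :
    ∃ C : ℝ, ∀ (x ξ : Euc k) (t : ℝ), japBracket ξ < R → 1 ≤ t →
      ‖normalSlice p α β x ξ t - ∑ i ∈ Finset.Icc j ⌊d⌋, s α β i (x, ξ) * (t : ℂ) ^ i‖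
        ≤ C * t ^ (j - 1) := by
  have hR : ∀ (e : ℝ) (ξ : Euc k), japBracket ξ < R → japBracket ξ ^ e ≤ R ^ |e| := by
    intro e ξ hξ
    refine (Real.rpow_le_rpow_of_exponent_le (one_le_japBracket ξ) (le_abs_self e)).trans ?_
    exact Real.rpow_le_rpow (japBracket_pos ξ).le hξ.le (abs_nonneg e)
  -- Summing up to `⌊d⌋` for every `α` keeps the range fixed when differentiation changes `α`.
  have hup : ∀ (a : ℤ) (y : Euc k × Euc k) (F : ℤ → ℂ),
      ∑ i ∈ Finset.Icc a ⌊d⌋, s α β i y * F i =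
      ∑ i ∈ Finset.Icc a ⌊d - multiLength α⌋, s α β i y * F i := by
    intro a y F
    symm
    have hle : ⌊d - multiLength α⌋ ≤ ⌊d⌋ :=
      Int.floor_le_floor (by linarith [(multiLength α).cast_nonneg (α := ℝ)])
    refine Finset.sum_subset (Finset.Icc_subset_Icc_right hle) fun i hi hi' => ?_
    have hi2 : ⌊d - multiLength α⌋ < i := by
      by_contra h
      exact hi' (Finset.mem_Icc.2 ⟨(Finset.mem_Icc.1 hi).1, not_lt.1 h⟩)
    rw [hs0 α β i (Int.floor_lt.1 hi2), zero_mul]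
  have hneg : ∀ m : ℕ, ∃ C : ℝ, ∀ (x ξ : Euc k) (t : ℝ), japBracket ξ < R → 1 ≤ t →
      ‖normalSlice p α β x ξ t - ∑ i ∈ Finset.Icc (-(m : ℤ)) ⌊d⌋, s α β i (x, ξ) * (t : ℂ) ^ i‖
        ≤ C * t ^ (-(m : ℤ) - 1) := by
    intro m
    obtain ⟨C, hC⟩ := hs α β m
    refine ⟨|C| * R ^ |d + 1 - multiLength α + m|, fun x ξ t hξ ht => ?_⟩
    have ht0 : 0 < t := by linarith
    have htC : (t : ℂ) ≠ 0 := by exact_mod_cast ht0.ne'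
    have hR0 : 0 < R := (japBracket_pos ξ).trans hξ
    rw [hup]
    have e : (t : ℂ) ^ m * (normalSlice p α β x ξ t -
        ∑ i ∈ Finset.Icc (-(m : ℤ)) ⌊d - multiLength α⌋, s α β i (x, ξ) * (t : ℂ) ^ i) =
        (t : ℂ) ^ m * normalSlice p α β x ξ t -
          ∑ j ∈ Finset.Icc (-(m : ℤ)) ⌊d - multiLength α⌋,
            s α β j (x, ξ) * (t : ℂ) ^ (j + m) := by
      rw [mul_sub, Finset.mul_sum]
      congr 1
      refine Finset.sum_congr rfl fun i _ => ?_
      rw [zpow_add₀ htC, zpow_natCast]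
      ring
    have h := hC x ξ t
    rw [← e, norm_mul, norm_pow, Complex.norm_real, Real.norm_of_nonneg ht0.le,
      ← le_div_iff₀' (by positivity)] at h
    refine h.trans ?_
    have hJ : (japBracket (joinLast ξ t))⁻¹ ≤ t⁻¹ :=
      inv_anti₀ ht0 ((le_abs_self t).trans (abs_le_japBracket_joinLast ξ t))
    rw [div_eq_mul_inv, zpow_sub₀ ht0.ne', zpow_one, zpow_neg, zpow_natCast]
    have h2 := hR (d + 1 - multiLength α + m) ξ hξ
    have h3 := Real.rpow_nonneg (japBracket_pos ξ).le (d + 1 - multiLength α + m)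
    calc C * japBracket ξ ^ (d + 1 - multiLength α + m) * (japBracket (joinLast ξ t))⁻¹ * (t ^ m)⁻¹
        ≤ |C| * R ^ |d + 1 - multiLength α + m| * t⁻¹ * (t ^ m)⁻¹ := by
          have := (japBracket_pos (joinLast ξ t)).le
          gcongr
          exact le_abs_self C
      _ = _ := by rw [div_eq_mul_inv]; ring
  have hj0 : -((j.natAbs : ℕ) : ℤ) ≤ j := by omega
  -- The hypothesis gives cut-offs `-m` only. From `-|j|` one climbs to `j`, each dropped term being
  -- of the size of the permitted error.
  refine Int.leInduction (motive := fun j _ => ∃ C : ℝ, ∀ (x ξ : Euc k) (t : ℝ),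
    japBracket ξ < R → 1 ≤ t →
      ‖normalSlice p α β x ξ t - ∑ i ∈ Finset.Icc j ⌊d⌋, s α β i (x, ξ) * (t : ℂ) ^ i‖
        ≤ C * t ^ (j - 1)) (hneg j.natAbs) ?_ j hj0
  rintro i - ⟨C, hC⟩
  obtain ⟨C', hC'0, hC'⟩ := hsb α β i
  refine ⟨|C| + C' * R ^ |d - multiLength α - i|, fun x ξ t hξ ht => ?_⟩
  have ht0 : 0 < t := by linarith
  have hR0 : 0 < R := (japBracket_pos ξ).trans hξ
  have hsb' : ‖s α β i (x, ξ) * (t : ℂ) ^ i‖ ≤ C' * R ^ |d - multiLength α - i| * t ^ i := by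
    rw [norm_mul, norm_zpow, Complex.norm_real, Real.norm_of_nonneg ht0.le]
    have := hR (d - multiLength α - i) ξ hξ
    gcongr
    exact (hC' x ξ).trans (by gcongr)
  have h1 := hC x ξ t hξ ht
  have h2 : ‖normalSlice p α β x ξ t - ∑ i ∈ Finset.Icc i ⌊d⌋, s α β i (x, ξ) * (t : ℂ) ^ i‖ ≤
      |C| * t ^ i := by
    refine h1.trans ?_
    calc C * t ^ (i - 1) ≤ |C| * t ^ (i - 1) := by
          gcongr
          exact le_abs_self C
      _ ≤ |C| * t ^ i := by
          gcongr
          omega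
  rw [add_sub_cancel_right, add_mul]
  by_cases hid : i ≤ ⌊d⌋
  · rw [← Finset.insert_Icc_add_one_left_eq_Icc hid, Finset.sum_insert (by simp)] at h2
    have e : normalSlice p α β x ξ t - ∑ i ∈ Finset.Icc (i + 1) ⌊d⌋, s α β i (x, ξ) * (t : ℂ) ^ i =
        (normalSlice p α β x ξ t - (s α β i (x, ξ) * (t : ℂ) ^ i +
          ∑ i ∈ Finset.Icc (i + 1) ⌊d⌋, s α β i (x, ξ) * (t : ℂ) ^ i)) +
        s α β i (x, ξ) * (t : ℂ) ^ i := by ring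
    rw [e]
    exact (norm_add_le _ _).trans (add_le_add h2 hsb')
  · rw [Finset.Icc_eq_empty (by omega)] at h2 ⊢
    have := (norm_nonneg _).trans hsb'
    linarith

/-- Uniform limits of functions whose gradients converge uniformly. -/
lemma hasFDerivAt_of_gradCLM_limit {S : Set (Euc k × Euc k)} (hS : IsOpen S) {τ : ℕ → ℝ}
    (hτ : Tendsto τ atTop (𝓝 0)) {G : ℕ → Euc k × Euc k → ℂ}
    {A B : Fin k → ℕ → Euc k × Euc k → ℂ} {g : Euc k × Euc k → ℂ}
    {a b : Fin k → Euc k × Euc k → ℂ}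
    (hG : ∀ n y, HasFDerivAt (G n) (Complex.I • gradCLM (fun l => A l n y) (fun l => B l n y)) y)
    (hg : ∃ C : ℝ, ∀ n, ∀ y ∈ S, ‖G n y - g y‖ ≤ C * τ n)
    (ha : ∀ l, ∃ C : ℝ, ∀ n, ∀ y ∈ S, ‖A l n y - a l y‖ ≤ C * τ n)
    (hb : ∀ l, ∃ C : ℝ, ∀ n, ∀ y ∈ S, ‖B l n y - b l y‖ ≤ C * τ n)
    {y : Euc k × Euc k} (hy : y ∈ S) :
    HasFDerivAt g (Complex.I • gradCLM (fun l => a l y) (fun l => b l y)) y := by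
  have hU : TendstoUniformlyOn
      (fun n y => Complex.I • gradCLM (fun l => A l n y) (fun l => B l n y))
      (fun y => Complex.I • gradCLM (fun l => a l y) (fun l => b l y)) atTop S := by
    choose C₁ hC₁ using ha
    choose C₂ hC₂ using hb
    rw [Metric.tendstoUniformlyOn_iff]
    intro ε hε
    have hlim := hτ.const_mul (∑ l, C₁ l + ∑ l, C₂ l)
    rw [mul_zero] at hlim
    filter_upwards [hlim.eventually_lt_const hε] with n hn y' hy'
    refine lt_of_le_of_lt ?_ hn
    rw [dist_comm, dist_eq_norm, ← gradCLM_smul, ← gradCLM_smul, ← gradCLM_sub]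
    refine (norm_gradCLM_le _ _).trans ?_
    rw [add_mul, Finset.sum_mul, Finset.sum_mul]
    refine add_le_add (Finset.sum_le_sum fun l _ => ?_) (Finset.sum_le_sum fun l _ => ?_)
    · simpa [← mul_sub] using hC₁ l n y' hy'
    · simpa [← mul_sub] using hC₂ l n y' hy'
  have hL : ∀ y' ∈ S, Tendsto (fun n => G n y') atTop (𝓝 (g y')) := by
    intro y' hy'
    obtain ⟨C, hC⟩ := hg
    rw [tendsto_iff_norm_sub_tendsto_zero]
    have hlim := hτ.const_mul C
    rw [mul_zero] at hlim
    exact squeeze_zero (fun n => norm_nonneg _) (fun n => hC n y' hy') hlim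
  exact hasFDerivAt_of_tendstoUniformlyOn (𝕜 := ℝ) hS hU (fun n y' _ => hG n y') hL hy

/-- The coefficients of the expansion are differentiable, and differentiation shifts the
multi-indices. -/
lemma hasFDerivAt_coeff (hp : ContDiff ℝ ∞ p)
    {s : (Fin (k + 1) → ℕ) → (Fin (k + 1) → ℕ) → ℤ → Euc k × Euc k → ℂ}
    (hs0 : ∀ α β (j : ℤ), d - multiLength α < j → ∀ y, s α β j y = 0)
    (hA : ∀ α β (R : ℝ) (j : ℤ), ∃ C : ℝ, ∀ (x ξ : Euc k) (t : ℝ), japBracket ξ < R → 1 ≤ t →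
      ‖normalSlice p α β x ξ t - ∑ i ∈ Finset.Icc j ⌊d⌋, s α β i (x, ξ) * (t : ℂ) ^ i‖
        ≤ C * t ^ (j - 1)) (j : ℤ) :
    ∀ (α β : Fin (k + 1) → ℕ) (y : Euc k × Euc k), HasFDerivAt (s α β j)
      (Complex.I • gradCLM (fun i => s α (β + Pi.single i.castSucc 1) j y)
        (fun i => s (α + Pi.single i.castSucc 1) β j y)) y := by
  -- Descending induction on `j`, starting above `⌊d⌋`, where all coefficients vanish.
  obtain ⟨n, hn⟩ : ∃ n : ℕ, ⌊d⌋ - n < j := ⟨(⌊d⌋ - j + 1).toNat, by omega⟩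
  induction n generalizing j with
  | zero =>
    intro α β y
    have hz : ∀ α β, s α β j = fun _ => 0 := fun α β => funext fun y => hs0 α β j (by
      have h1 : ⌊d⌋ < j := by simpa using hn
      have := Int.floor_lt.1 h1
      linarith [(multiLength α).cast_nonneg (α := ℝ)]) y
    simp only [hz]
    refine (hasFDerivAt_const (0 : ℂ) y).congr_fderiv ?_
    refine ContinuousLinearMap.ext fun ⟨v, w⟩ => ?_
    rw [_root_.smul_apply, gradCLM_apply]
    simp
  | succ n ih =>
    intro α β y
    have ih' : ∀ i ∈ Finset.Icc (j + 1) ⌊d⌋, ∀ (α β : Fin (k + 1) → ℕ) (y : Euc k × Euc k),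
        HasFDerivAt (s α β i)
        (Complex.I • gradCLM (fun l => s α (β + Pi.single l.castSucc 1) i y)
        (fun l => s (α + Pi.single l.castSucc 1) β i y)) y := fun i hi =>
      ih i (by have := (Finset.mem_Icc.1 hi).1; push_cast at hn; omega)
    set T : ℕ → ℝ := fun n => (n : ℝ) + 1 with hT
    have hT1 : ∀ n, 1 ≤ T n := fun n => by simp [hT]
    -- Removing the terms above `j` and dividing by `T ^ j` isolates the `j`-th coefficient up to
    -- `O(1/T)`, uniformly on `S`.
    set G : (Fin (k + 1) → ℕ) → (Fin (k + 1) → ℕ) → ℕ → Euc k × Euc k → ℂ := fun α β n y =>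
      ((T n : ℂ) ^ j)⁻¹ * (normalSlice p α β y.1 y.2 (T n) -
        ∑ i ∈ Finset.Icc (j + 1) ⌊d⌋, (T n : ℂ) ^ i * s α β i y) with hG
    set S : Set (Euc k × Euc k) := {y' | japBracket y'.2 < japBracket y.2 + 1} with hS
    have hSo : IsOpen S := by
      refine isOpen_lt ?_ continuous_const
      unfold japBracket
      fun_prop
    have hyS : y ∈ S := by simp [hS]
    have hconv : ∀ α β, ∃ C : ℝ, ∀ n, ∀ y' ∈ S, ‖G α β n y' - s α β j y'‖ ≤ C * (T n)⁻¹ := by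
      intro α β
      obtain ⟨C, hC⟩ := hA α β (japBracket y.2 + 1) j
      refine ⟨C, fun n y' hy' => ?_⟩
      have ht0 : 0 < T n := by linarith [hT1 n]
      have htC : (T n : ℂ) ^ j ≠ 0 := zpow_ne_zero _ (by exact_mod_cast ht0.ne')
      have h := hC y'.1 y'.2 (T n) hy' (hT1 n)
      have e : G α β n y' - s α β j y' = ((T n : ℂ) ^ j)⁻¹ * (normalSlice p α β y'.1 y'.2 (T n) -
          ∑ i ∈ Finset.Icc j ⌊d⌋, s α β i (y'.1, y'.2) * (T n : ℂ) ^ i) := by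
        simp only [hG]
        by_cases hj : j ≤ ⌊d⌋
        · rw [← Finset.insert_Icc_add_one_left_eq_Icc hj, Finset.sum_insert (by simp)]
          simp only [mul_comm (s α β _ _)]
          field_simp
          ring
        · rw [Finset.Icc_eq_empty hj, Finset.Icc_eq_empty (by omega)]
          have h1 : ⌊d⌋ < j := by omega
          have := Int.floor_lt.1 h1
          rw [hs0 α β j (by linarith [(multiLength α).cast_nonneg (α := ℝ)])]
          simp
      rw [e, norm_mul, norm_inv, norm_zpow, Complex.norm_real, Real.norm_of_nonneg ht0.le,
        inv_mul_le_iff₀ (zpow_pos ht0 j)]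
      refine h.trans (le_of_eq ?_)
      rw [zpow_sub₀ ht0.ne', zpow_one]
      ring
    have hTinv : Tendsto (fun n => (T n)⁻¹) atTop (𝓝 0) := by
      simpa [hT, one_div] using tendsto_one_div_add_atTop_nhds_zero_nat (𝕜 := ℝ)
    -- By the induction hypothesis for `i > j`, the partial derivatives of `G α β` are `i` times `G`
    -- at shifted indices, so they converge by the same estimate.
    have hGd : ∀ n, ∀ y' : Euc k × Euc k, HasFDerivAt (G α β n)
        (Complex.I • gradCLM (fun l => G α (β + Pi.single l.castSucc 1) n y')
          (fun l => G (α + Pi.single l.castSucc 1) β n y')) y' := by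
      intro n y'
      have h1 := (hasFDerivAt_normalSlice hp α β (T n) y').sub
        (HasFDerivAt.fun_sum fun i hi => (ih' i hi α β y').const_mul ((T n : ℂ) ^ i))
      refine (h1.const_mul ((T n : ℂ) ^ j)⁻¹).congr_fderiv ?_
      have ea : (fun l => G α (β + Pi.single l.castSucc 1) n y') = ((T n : ℂ) ^ j)⁻¹ •
          ((fun l : Fin k => normalSlice p α (β + Pi.single l.castSucc 1) y'.1 y'.2 (T n)) -
            ∑ i ∈ Finset.Icc (j + 1) ⌊d⌋,
              (T n : ℂ) ^ i • fun l : Fin k => s α (β + Pi.single l.castSucc 1) i y') := by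
        funext l
        simp only [hG, Pi.smul_apply, Pi.sub_apply, Finset.sum_apply, smul_eq_mul]
      have eb : (fun l => G (α + Pi.single l.castSucc 1) β n y') = ((T n : ℂ) ^ j)⁻¹ •
          ((fun l : Fin k => normalSlice p (α + Pi.single l.castSucc 1) β y'.1 y'.2 (T n)) -
            ∑ i ∈ Finset.Icc (j + 1) ⌊d⌋,
              (T n : ℂ) ^ i • fun l : Fin k => s (α + Pi.single l.castSucc 1) β i y') := by
        funext l
        simp only [hG, Pi.smul_apply, Pi.sub_apply, Finset.sum_apply, smul_eq_mul]
      rw [ea, eb, gradCLM_smul, gradCLM_sub, gradCLM_finset_sum, smul_comm Complex.I]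
      simp only [gradCLM_smul, smul_sub, Finset.smul_sum, smul_comm Complex.I]
    exact hasFDerivAt_of_gradCLM_limit hSo hTinv hGd (hconv α β) (fun l => hconv _ _)
      (fun l => hconv _ _) hyS

/-- Extension of a multi-index by a zero in the last place. -/
def extendMulti (γ : Fin k → ℕ) : Fin (k + 1) → ℕ := Fin.snoc (α := fun _ => ℕ) γ 0

lemma extendMulti_add_single (γ : Fin k → ℕ) (i : Fin k) :
    extendMulti (γ + Pi.single i 1) = extendMulti γ + Pi.single i.castSucc 1 := by
  funext l
  refine Fin.lastCases ?_ (fun l => ?_) l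
  · simp [extendMulti, (Fin.castSucc_ne_last i).symm]
  · simp [extendMulti, Pi.single_apply]

lemma extendMulti_zero : extendMulti (0 : Fin k → ℕ) = 0 := by
  funext l
  refine Fin.lastCases ?_ (fun l => ?_) l <;> simp [extendMulti]

lemma multiLength_extendMulti (γ : Fin k → ℕ) : multiLength (extendMulti γ) = multiLength γ := by
  simp [multiLength, extendMulti, Fin.sum_univ_castSucc]

/-- A family closed under differentiation by shifts of the indices, with symbol bounds, consists of
symbols. -/
lemma isSymbol_of_family
    {s : (Fin (k + 1) → ℕ) → (Fin (k + 1) → ℕ) → Euc k × Euc k → ℂ} {r : ℝ}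
    (hsb : ∀ α β, ∃ C : ℝ, 0 ≤ C ∧ ∀ x ξ : Euc k,
      ‖s α β (x, ξ)‖ ≤ C * japBracket ξ ^ (r - multiLength α))
    (hsd : ∀ (α β : Fin (k + 1) → ℕ) (y : Euc k × Euc k), HasFDerivAt (s α β)
      (Complex.I • gradCLM (fun i => s α (β + Pi.single i.castSucc 1) y)
        (fun i => s (α + Pi.single i.castSucc 1) β y)) y) (α β : Fin (k + 1) → ℕ) :
    IsSymbol (r - multiLength α) (s α β) := by
  -- The induction runs over the whole family at once, since a derivative leaves the member but not
  -- the family.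
  have hcd : ∀ (n : ℕ) (α β : Fin (k + 1) → ℕ), ContDiff ℝ n (s α β) := by
    intro n
    induction n with
    | zero =>
      intro α β
      rw [Nat.cast_zero, contDiff_zero]
      exact continuous_iff_continuousAt.2 fun y => (hsd α β y).continuousAt
    | succ n ih =>
      intro α β
      refine contDiff_succ_iff_hasFDerivAt.2 ⟨_, ?_, hsd α β⟩
      refine ContDiff.const_smul _ ?_
      unfold gradCLM
      exact (ContDiff.sum fun i _ => contDiff_const.smulRight (ih _ _)).add
        (ContDiff.sum fun i _ => contDiff_const.smulRight (ih _ _))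
  have hdξ : ∀ γ δ : Fin k → ℕ, Dxi γ (s α (β + extendMulti δ)) =
      s (α + extendMulti γ) (β + extendMulti δ) := by
    intro γ δ
    have h := multiD_family (fun i => ((0 : Euc k), EuclideanSpace.single i (1 : ℝ)))
      (fun γ => s (α + extendMulti γ) (β + extendMulti δ)) (fun γ i => by
        funext y
        rw [dirDeriv, (hsd _ _ y).fderiv, _root_.smul_apply, gradCLM_apply]
        simp [extendMulti_add_single, add_assoc]) 0 γ
    simp only [extendMulti_zero, add_zero, zero_add] at h
    exact h
  have hdx : ∀ γ δ : Fin k → ℕ, Dx δ (s (α + extendMulti γ) β) =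
      s (α + extendMulti γ) (β + extendMulti δ) := by
    intro γ δ
    have h := multiD_family (fun i => (EuclideanSpace.single i (1 : ℝ), (0 : Euc k)))
      (fun δ => s (α + extendMulti γ) (β + extendMulti δ)) (fun γ i => by
        funext y
        rw [dirDeriv, (hsd _ _ y).fderiv, _root_.smul_apply, gradCLM_apply]
        simp [extendMulti_add_single, add_assoc]) 0 δ
    simp only [extendMulti_zero, add_zero, zero_add] at h
    exact h
  refine ⟨contDiff_infty.2 fun n => hcd n α β, fun γ δ => ?_⟩
  obtain ⟨C, hC0, hC⟩ := hsb (α + extendMulti γ) (β + extendMulti δ)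
  refine ⟨C, fun x ξ => ?_⟩
  have h0 := hdξ γ 0
  rw [extendMulti_zero, add_zero] at h0
  rw [h0, hdx, Real.rpow_neg (japBracket_pos _).le,
    inv_mul_le_iff₀ (Real.rpow_pos_of_pos (japBracket_pos _) _), mul_comm]
  have := hC x ξ
  rwa [multiLength_add, multiLength_extendMulti, Nat.cast_add, ← sub_sub] at this

/-- The uniform transmission condition gives expansions with coefficients polynomial in `ξ'`. -/
theorem IsSymbolUTTR.exists_polynomial_expansion (hp : IsSymbolUTTR d p)
    (α β : Fin (k + 1) → ℕ) :
    ∃ s : ℤ → Euc k × Euc k → ℂ, IsNormalExpansion d p α β s ∧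
      ∀ j : ℤ, (j : ℝ) ≤ d - multiLength α → ∀ x : Euc k,
        IsPolynomialOfDegreeLE (d - j - multiLength α) (fun ξ => s j (x, ξ)) := by
  -- No regularity in `x'` is known for `c`; it follows only afterwards, from `hasFDerivAt_coeff`.
  choose c hcb hc0 hcexp using hp.exists_expansion_zero
  have hb := norm_expansionCoeff_le (d := d) hcb
  have hexp := norm_remainder_le hp.1 hcb hc0 hcexp
  have hz : ∀ α β (j : ℤ), d - multiLength α < j → ∀ y, expansionCoeff d c α β j y = 0 :=
    fun α β j h y => expansionCoeff_eq_zero h y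
  have hA := norm_normalSlice_sub_sum_le hz hb hexp
  refine ⟨expansionCoeff d c α β, ⟨fun j _ => ?_, hexp α β⟩,
    fun j hj x => expansionCoeff_polynomial α β hj x⟩
  refine isSymbol_of_family (s := fun α β => expansionCoeff d c α β j) (r := d - j) ?_
    (hasFDerivAt_coeff hp.1.1 hz hA j) α β
  intro α β
  obtain ⟨C, hC0, hC⟩ := hb α β j
  exact ⟨C, hC0, fun x ξ => by rw [sub_right_comm]; exact hC x ξ⟩

/-- The coefficients of the expansion are uniquely determined. -/
theorem IsNormalExpansion.unique {α β : Fin (k + 1) → ℕ} {s s' : ℤ → Euc k × Euc k → ℂ}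
    (hs : IsNormalExpansion d p α β s) (hs' : IsNormalExpansion d p α β s') {j : ℤ}
    (hj : (j : ℝ) ≤ d - multiLength α) : s' j = s j := by
  funext ⟨x, ξ⟩
  -- This brings `j` into the range `[-m, ⌊d - |α|⌋]`, while the difference of the two remainders is
  -- `O(t^(-m-1))`, below every power in it.
  set m : ℕ := j.natAbs with hm
  have hmj : -(m : ℤ) ≤ j := by omega
  obtain ⟨C, hC⟩ := hs.2 m
  obtain ⟨C', hC'⟩ := hs'.2 m
  set A := japBracket ξ ^ (d + 1 - multiLength α + m) with hA
  have hA0 : 0 < A := Real.rpow_pos_of_pos (japBracket_pos ξ) _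
  refine sub_eq_zero.1 (coeff_eq_zero_of_growth (a := -(m : ℤ)) (b := ⌊d - multiLength α⌋)
    (c := fun j => s' j (x, ξ) - s j (x, ξ)) (C := (|C| + |C'|) * A) (r := -m - 1) ?_ j
    (Finset.mem_Icc.2 ⟨hmj, Int.le_floor.2 hj⟩) ?_)
  · intro t ht
    have ht0 : 0 < t := by linarith
    have htC : (t : ℂ) ≠ 0 := by exact_mod_cast ht0.ne'
    have hJ : (japBracket (joinLast ξ t))⁻¹ ≤ t⁻¹ :=
      inv_anti₀ ht0 ((le_abs_self t).trans (abs_le_japBracket_joinLast ξ t))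
    have hJ0 := inv_nonneg.2 (japBracket_pos (joinLast ξ t)).le
    have e : (t : ℂ) ^ m * ∑ j ∈ Finset.Icc (-(m : ℤ)) ⌊d - multiLength α⌋,
        (s' j (x, ξ) - s j (x, ξ)) * (t : ℂ) ^ j =
        ((t : ℂ) ^ m * normalSlice p α β x ξ t - ∑ j ∈ Finset.Icc (-(m : ℤ)) ⌊d - multiLength α⌋,
          s j (x, ξ) * (t : ℂ) ^ (j + m)) -
        ((t : ℂ) ^ m * normalSlice p α β x ξ t - ∑ j ∈ Finset.Icc (-(m : ℤ)) ⌊d - multiLength α⌋,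
          s' j (x, ξ) * (t : ℂ) ^ (j + m)) := by
      rw [sub_sub_sub_cancel_left, ← Finset.sum_sub_distrib, Finset.mul_sum]
      refine Finset.sum_congr rfl fun i _ => ?_
      rw [zpow_add₀ htC, zpow_natCast]
      ring
    have hb : ∀ D : ℝ, D * A * (japBracket (joinLast ξ t))⁻¹ ≤ |D| * A * t⁻¹ := fun D => by
      gcongr
      exact le_abs_self D
    have h1 := norm_sub_le_of_le ((hC x ξ t).trans (hb C)) ((hC' x ξ t).trans (hb C'))
    rw [← e, norm_mul, norm_pow, Complex.norm_real, Real.norm_of_nonneg ht0.le,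
      ← le_div_iff₀' (by positivity)] at h1
    refine h1.trans (le_of_eq ?_)
    rw [Real.rpow_sub ht0, Real.rpow_neg ht0.le, Real.rpow_natCast, Real.rpow_one]
    field_simp
  · have : (-(m : ℤ) - 1 : ℤ) < j := by omega
    exact_mod_cast this

end Regularity

end

theorem proposition3p1 {k : ℕ} (d : ℝ) (p : Euc (k + 1) × Euc (k + 1) → ℂ)
    (hp : IsSymbol d p) :
    [IsSymbolUTTR d p,
      ∀ α β : Fin (k + 1) → ℕ, ∃ s : ℤ → Euc k × Euc k → ℂ, IsNormalExpansion d p α β s,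
      HasWeightedKernelBounds d p].TFAE ∧
    (IsSymbolUTTR d p →
      ∀ (α β : Fin (k + 1) → ℕ) (s : ℤ → Euc k × Euc k → ℂ), IsNormalExpansion d p α β s →
        (∀ s' : ℤ → Euc k × Euc k → ℂ, IsNormalExpansion d p α β s' →
          ∀ j : ℤ, (j : ℝ) ≤ d - multiLength α → s' j = s j) ∧
        ∀ j : ℤ, (j : ℝ) ≤ d - multiLength α → ∀ x' : Euc k,
          IsPolynomialOfDegreeLE (d - j - multiLength α) (fun ξ' => s j (x', ξ'))) := by
  constructor
  · tfae_have 1 → 2 := fun h α β => by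
      obtain ⟨s, hs, -⟩ := h.exists_polynomial_expansion α β
      exact ⟨s, hs⟩
    tfae_have 2 → 3 := hasWeightedKernelBounds_of_expansion hp
    tfae_have 3 → 1 := fun h => h.isSymbolUTTR hp
    tfae_finish
  · intro h α β s hs
    obtain ⟨s₀, hs₀, hpoly⟩ := h.exists_polynomial_expansion α β
    refine ⟨fun s' hs' j hj => hs.unique hs' hj, fun j hj x => ?_⟩
    rw [hs₀.unique hs hj]
    exact hpoly j hj x
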